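/- Incremental dynamic subset sum: a multiset of items with non-negative integer weights is initially empty, and a positive integer $t_{\max}$ is given to the algorithm before any operation. The operations arrive online, one at a time: either an item of given weight $w$ is inserted, or, for a given $0 \le t \le t_{\max}$, the algorithm must answer whether some subset of the current items has total weight exactly $t$. The number $\mathsf{oprs}$ of operations is not known to the algorithm in advance. Theorem. There are a randomized word-RAM algorithm for incremental dynamic subset sum and an absolute constant $\kappa$ such that the following holds for every $t_{\max} \ge 1$, every fixed sequence of $\mathsf{oprs} \ge 2$ operations, and every word length $W \ge \kappa \log_2 (t_{\max} + \mathsf{oprs})$ such that each inserted weight fits into one $W$-bit word. (Arithmetic, comparison, bitwise and memory operations on words, and drawing a uniformly random integer in $\{0,\dots,y\}$ for a word $y$, cost one time step each; the algorithm does not depend on $W$.) 1. Whatever the random choices, the amortized processing time per operation, that is, the total time of the preprocessing and of all operations divided by $\mathsf{oprs}$, is $$O\left(1 + \frac{t_{\max}^{5/3} \, \log^2 t_{\max} \, \log \mathsf{oprs}}{\mathsf{oprs}}\right).$$ 2. In particular it is truly sublinear once $\mathsf{oprs} \ge t_{\max}^{2/3+\Omega(1)}$: for every $\varepsilon > 0$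 there is a $\delta > 0$ such that the amortized processing time is $O_\varepsilon(t_{\max}^{1-\delta})$ whenever $\mathsf{oprs} \ge t_{\max}^{2/3+\varepsilon}$. 3. Each query is answered correctly with probability at least $1 - 1/t_{\max}^3$. The constant in 1 is absolute, and the one in 2 depends only on $\varepsilon$. -/

import Mathlib

/-!
# Randomized word RAM programs for incremental dynamic subset sum
-/

namespace DynSubsetSum

/-! ## The problem -/

/-- An operation of incremental dynamic subset sum: insertion of an item of weight `w`, or the
question whether some subset of the current items has total weight `t`. -/
inductive Op where
  | insert (w : ℕ)
  | query (t : ℕ)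

/-- The multiset of item weights present after the given operations, starting from no items. -/
def items : List Op → Multiset ℕ
  | [] => 0
  | Op.insert w :: ops => w ::ₘ items ops
  | Op.query _ :: ops => items ops

/-- Some sub-multiset of the items has total weight exactly `t`. -/
def IsSubsetSum (s : Multiset ℕ) (t : ℕ) : Prop :=
  ∃ u : Multiset ℕ, u ≤ s ∧ u.sum = t

/-! ## The machine

A randomized word RAM with `W`-bit words.  A program uses finitely many registers and finitely
many arrays, each named by a number in the program text.  Every register and every array cell
holds one word, arrays are indexed by words, and everything is initially zero.  Control flow is
structured (sequence, conditional, loop). -/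

/-- Unit-cost operations on words. -/
inductive BinOp where
  | add | sub | mul | div | mod | and | or | xor | shl | shr | lt | eq

/-- Value of an operation on two `W`-bit words.  The result is reduced modulo `2 ^ W` when it is
written to a register.  Subtraction wraps around; the quotient by zero is zero. -/
def BinOp.eval (W : ℕ) : BinOp → ℕ → ℕ → ℕ
  | add, a, b => a + b
  | sub, a, b => a + (2 ^ W - b)
  | mul, a, b => a * b
  | div, a, b => a / b
  | mod, a, b => a % b
  | and, a, b => a &&& b
  | or, a, b => a ||| b
  | xor, a, b => a ^^^ b
  | shl, a, b => a * 2 ^ b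
  | shr, a, b => a / 2 ^ b
  | lt, a, b => if a < b then 1 else 0
  | eq, a, b => if a = b then 1 else 0

/-- Elementary instructions; `x y z` are registers and `a` is an array. -/
inductive Instr where
  /-- `x := n` -/
  | const (x n : ℕ)
  /-- `x := y` -/
  | move (x y : ℕ)
  /-- `x := y ∘ z` -/
  | bin (o : BinOp) (x y z : ℕ)
  /-- `x := a[y]` -/
  | load (x a y : ℕ)
  /-- `a[x] := y` -/
  | store (a x y : ℕ)
  /-- `x :=` a fresh uniformly random element of `{0, …, y}` -/
  | rand (x y : ℕ)

/-- Programs. -/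
inductive Cmd where
  | instr (i : Instr)
  | seq (c d : Cmd)
  /-- If register `x` is nonzero then `c` else `d`. -/
  | ite (x : ℕ) (c d : Cmd)
  /-- While register `x` is nonzero do `c`. -/
  | loop (x : ℕ) (c : Cmd)

/-- Contents of the registers and of the arrays. -/
structure Store where
  reg : ℕ → ℕ
  arr : ℕ → ℕ → ℕ

/-- The all-zero store. -/
def Store.zero : Store := ⟨fun _ => 0, fun _ _ => 0⟩

/-- Write a value, cut down to a `W`-bit word, to register `x`. -/
def Store.setReg (W : ℕ) (s : Store) (x v : ℕ) : Store :=
  { s with reg := Function.update s.reg x (v % 2 ^ W) }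

/-- Write a value, cut down to a `W`-bit word, to cell `j` of array `a`. -/
def Store.setCell (W : ℕ) (s : Store) (a j v : ℕ) : Store :=
  { s with arr := Function.update s.arr a (Function.update (s.arr a) j (v % 2 ^ W)) }

/-- The effect of an elementary instruction, as a distribution on stores. -/
noncomputable def Instr.exec (W : ℕ) (s : Store) : Instr → PMF Store
  | const x n => PMF.pure (s.setReg W x n)
  | move x y => PMF.pure (s.setReg W x (s.reg y))
  | bin o x y z => PMF.pure (s.setReg W x (o.eval W (s.reg y) (s.reg z)))
  | load x a y => PMF.pure (s.setReg W x (s.arr a (s.reg y)))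
  | store a x y => PMF.pure (s.setCell W a (s.reg x) (s.reg y))
  | rand x y =>
      (PMF.uniformOfFinset (Finset.range (s.reg y + 1)) ⟨0, by simp⟩).map
        fun v => s.setReg W x v

/-! ## Online interaction -/

/-- A dynamic algorithm: one program for the preprocessing and one for each kind of operation.
The three share their registers and arrays.  Each receives its argument (`tmax`, the weight, or
the target) in register `0`; the last one leaves its answer there (nonzero means yes). -/
structure Algorithm where
  init : Cmd
  insert : Cmd
  query : Cmd

/-- What the machine still has to do: receive a value in register `0`, execute a program, or hand
out register `0` as the answer to the operation number `i`. -/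
inductive Task where
  | input (v : ℕ)
  | run (c : Cmd)
  | output (i : ℕ)

/-- The tasks caused by a sequence of operations, which are numbered from `i` on. -/
def Algorithm.tasks (A : Algorithm) : ℕ → List Op → List Task
  | _, [] => []
  | i, Op.insert w :: ops =>
      Task.input w :: Task.run A.insert :: A.tasks (i + 1) ops
  | i, Op.query t :: ops =>
      Task.input t :: Task.run A.query :: Task.output i :: A.tasks (i + 1) ops

/-- Configurations.  Programs see the store only, never the tasks that lie ahead, so an operation
is completely processed before the next one is revealed. -/
structure Config where
  todo : List Task
  store : Store
  answer : ℕ → Option Bool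

/-- One time step: an elementary instruction, a test of a register, the unfolding of a sequence,
or the transfer of one input or output word.  A configuration with nothing left to do rests. -/
noncomputable def step (W : ℕ) : Config → PMF Config
  | ⟨[], s, r⟩ => PMF.pure ⟨[], s, r⟩
  | ⟨Task.input v :: k, s, r⟩ => PMF.pure ⟨k, s.setReg W 0 v, r⟩
  | ⟨Task.output i :: k, s, r⟩ =>
      PMF.pure ⟨k, s, Function.update r i (some (decide (s.reg 0 ≠ 0)))⟩
  | ⟨Task.run (Cmd.instr i) :: k, s, r⟩ => (i.exec W s).map fun s' => ⟨k, s', r⟩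
  | ⟨Task.run (Cmd.seq c d) :: k, s, r⟩ => PMF.pure ⟨Task.run c :: Task.run d :: k, s, r⟩
  | ⟨Task.run (Cmd.ite x c d) :: k, s, r⟩ =>
      PMF.pure ⟨Task.run (if s.reg x ≠ 0 then c else d) :: k, s, r⟩
  | ⟨Task.run (Cmd.loop x c) :: k, s, r⟩ =>
      PMF.pure ⟨if s.reg x ≠ 0 then Task.run c :: Task.run (Cmd.loop x c) :: k else k, s, r⟩

/-- The distribution of the configuration after `n` time steps. -/
noncomputable def steps (W : ℕ) : ℕ → Config → PMF Config
  | 0, c => PMF.pure c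
  | n + 1, c => (step W c).bind (steps W n)

/-- The start: `tmax` and then the operations are given to the algorithm, one after the other. -/
def Algorithm.start (A : Algorithm) (tmax : ℕ) (ops : List Op) : Config :=
  ⟨Task.input tmax :: Task.run A.init :: A.tasks 0 ops, Store.zero, fun _ => none⟩

/-- Whatever the random choices, the preprocessing and all the operations together are finished
after at most `T` time steps. -/
def Algorithm.FinishesWithin (A : Algorithm) (W tmax : ℕ) (ops : List Op) (T : ℕ) : Prop :=
  ∀ c ∈ (steps W T (A.start tmax ops)).support, c.todo = []

/-- The probability that the operation number `i`, a query with target `t`, has been answered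
correctly after `T` time steps. -/
noncomputable def Algorithm.probCorrect (A : Algorithm) (W tmax : ℕ) (ops : List Op)
    (T i t : ℕ) : ENNReal :=
  (steps W T (A.start tmax ops)).toOuterMeasure
    {c | ∃ b : Bool, c.answer i = some b ∧ (b = true ↔ IsSubsetSum (items (ops.take i)) t)}

/-- Admissible inputs: `tmax` is positive, there are at least two operations, targets are at most
`tmax`, a word has at least `κ * log₂ (tmax + oprs)` bits and each weight fits into one word. -/
structure Admissible (κ W tmax : ℕ) (ops : List Op) : Prop where
  tmax_pos : 1 ≤ tmax
  two_le_oprs : 2 ≤ ops.length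
  target_le : ∀ t, Op.query t ∈ ops → t ≤ tmax
  weight_lt : ∀ w, Op.insert w ∈ ops → w < 2 ^ W
  word_size : (tmax + ops.length) ^ κ ≤ 2 ^ W

end DynSubsetSum

namespace DynSubsetSum

/-! ## Deterministic runs of the machine -/

/-! The algorithm uses no randomness: every answer is correct with probability one, and the total
time is `O(oprs + t^(5/3) * (1 + log t))`, where `t` stands for `tmax`. It maintains the set `B` of
attained sums up to `t`. Inserting `w` adds the sums `x + w ≤ t` outside `B` with `x ∈ B`; these `x`
form the set `missing`. At most `t` sums besides 0 are ever added, so it suffices to find each of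
them in time about `t^(2/3) * log t` and to recognize an empty `missing` in time about `t^(2/3)`.
The latter is needed at most once for each `w ≤ t`, because emptiness persists when `B` grows
(`closed_newSums`).

Counting. The range is cut into `r ≈ t^(1/3)` blocks of length `q = r^2`. For a snapshot `A` of `B`,
the number of `x ∈ A` in a given block with `x + w ≤ t` outside `A` is a coefficient of products of
block polynomials, one for `A` and one, reversed, for the complement; only two target blocks are
possible. The coefficient is read off from values at the `p - 1` roots of unity, with a prime `p`
between `2q` and `4q + 1` (`sum_eval_mul`). The products are summed over the leaves below each node
of a binary tree of blocks and tabulated for each offset of blocks, so the count at any node costs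
`O(q)`, however many leaves lie below it (`nodeValue_eq`). Counts can exceed `p`, so the computation
is done modulo `p^2`, which they never reach. That ring still contains the roots of unity `a^p`,
with their orthogonality relations (`sum_root_pow`). The result is `p - 1` times the count, and `p -
1` is a unit, so testing for zero is exact (`nodeValue_zero_iff`).

Snapshots. Before an insertion fewer than `q` sums have been added since the snapshot; they are
accounted for one by one (`leaf_identity`). Once there are `q` of them, the snapshot is renewed:
`O(q)` for each new sum to update the evaluations and `O(q^2)` for the tables, hence `O(q)` per new
sum.

Search. Only children of nodes with nonzero count are visited. The counts on any level add up to the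
size of `missing`, so `O(log r)` visits are made for each new sum (`sum_heapSum_le`), besides the
root. The potential function in `addTime_add_potential_le` adds everything up.

Machine. The programs are written in a language of bounded loops without overflow. `Prog.code_runs`
transfers their effect and exact running time to the word RAM, and `Ok` is a Hoare triple that
treats size of numbers, time and effect together. -/

theorem steps_add (W m n : ℕ) (c : Config) :
    steps W (m + n) c = (steps W m c).bind (steps W n) := by
  induction m generalizing c with
  | zero => simp [steps]
  | succ m ih =>
    rw [show m + 1 + n = (m + n) + 1 by omega]
    simp only [steps, PMF.bind_bind]
    congr 1
    funext x
    exact ih x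

/-- After exactly `n` steps the configuration is surely `c'`. -/
def Reaches (W n : ℕ) (c c' : Config) : Prop := steps W n c = PMF.pure c'

theorem Reaches.refl (W : ℕ) (c : Config) : Reaches W 0 c c := rfl

theorem Reaches.trans {W m n : ℕ} {c c' c'' : Config} (h : Reaches W m c c')
    (h' : Reaches W n c' c'') : Reaches W (m + n) c c'' := by
  unfold Reaches at *
  rw [steps_add, h, PMF.pure_bind, h']

theorem Reaches.of_step {W : ℕ} {c c' : Config} (h : step W c = PMF.pure c') :
    Reaches W 1 c c' := by
  simp [Reaches, steps, h]

theorem Reaches.rest (W n : ℕ) (s : Store) (r : ℕ → Option Bool) :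
    Reaches W n ⟨[], s, r⟩ ⟨[], s, r⟩ := by
  induction n with
  | zero => rfl
  | succ n ih => rw [add_comm]; exact (Reaches.of_step rfl).trans ih

/-- Executing `c` turns `s` into `s'` in exactly `n` steps. -/
def Runs (W : ℕ) (c : Cmd) (s s' : Store) (n : ℕ) : Prop :=
  ∀ k r, Reaches W n ⟨Task.run c :: k, s, r⟩ ⟨k, s', r⟩

theorem Runs.instr {W : ℕ} {i : Instr} {s s' : Store} (h : i.exec W s = PMF.pure s') :
    Runs W (.instr i) s s' 1 := fun k r => by
  apply Reaches.of_step
  simp [step, h, PMF.pure_map]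

theorem Runs.const (W : ℕ) (s : Store) (x n : ℕ) :
    Runs W (.instr (.const x n)) s (s.setReg W x n) 1 := Runs.instr rfl

theorem Runs.move (W : ℕ) (s : Store) (x y : ℕ) :
    Runs W (.instr (.move x y)) s (s.setReg W x (s.reg y)) 1 := Runs.instr rfl

theorem Runs.bin (W : ℕ) (s : Store) (o : BinOp) (x y z : ℕ) :
    Runs W (.instr (.bin o x y z)) s (s.setReg W x (o.eval W (s.reg y) (s.reg z))) 1 :=
  Runs.instr rfl

theorem Runs.load (W : ℕ) (s : Store) (x a y : ℕ) :
    Runs W (.instr (.load x a y)) s (s.setReg W x (s.arr a (s.reg y))) 1 := Runs.instr rfl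

theorem Runs.store (W : ℕ) (s : Store) (a x y : ℕ) :
    Runs W (.instr (.store a x y)) s (s.setCell W a (s.reg x) (s.reg y)) 1 := Runs.instr rfl

theorem Runs.seq {W : ℕ} {c d : Cmd} {s s₁ s₂ : Store} {m n : ℕ} (h : Runs W c s s₁ m)
    (h' : Runs W d s₁ s₂ n) : Runs W (.seq c d) s s₂ (1 + (m + n)) := fun k r =>
  (Reaches.of_step rfl).trans ((h _ r).trans (h' k r))

theorem Runs.ite_true {W x : ℕ} {c d : Cmd} {s s' : Store} {n : ℕ} (hx : s.reg x ≠ 0)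
    (h : Runs W c s s' n) : Runs W (.ite x c d) s s' (1 + n) := fun k r =>
  (Reaches.of_step (by simp [step, hx])).trans (h k r)

theorem Runs.ite_false {W x : ℕ} {c d : Cmd} {s s' : Store} {n : ℕ} (hx : s.reg x = 0)
    (h : Runs W d s s' n) : Runs W (.ite x c d) s s' (1 + n) := fun k r =>
  (Reaches.of_step (by simp [step, hx])).trans (h k r)

theorem Runs.loop_done {W x : ℕ} {c : Cmd} {s : Store} (hx : s.reg x = 0) :
    Runs W (.loop x c) s s 1 := fun k r =>
  Reaches.of_step (by simp [step, hx])

theorem Runs.loop_next {W x : ℕ} {c : Cmd} {s s₁ s₂ : Store} {m n : ℕ} (hx : s.reg x ≠ 0)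
    (h : Runs W c s s₁ m) (h' : Runs W (.loop x c) s₁ s₂ n) :
    Runs W (.loop x c) s s₂ (1 + (m + n)) := fun k r =>
  (Reaches.of_step (by simp [step, hx])).trans ((h _ r).trans (h' k r))

/-! ### Reading a store after a write. -/

theorem Store.setReg_reg (W : ℕ) (s : Store) (x v y : ℕ) :
    (s.setReg W x v).reg y = if y = x then v % 2 ^ W else s.reg y := by
  simp [Store.setReg, Function.update_apply]

theorem Store.setReg_arr (W : ℕ) (s : Store) (x v : ℕ) : (s.setReg W x v).arr = s.arr := rfl

theorem Store.setCell_reg (W : ℕ) (s : Store) (a j v : ℕ) : (s.setCell W a j v).reg = s.reg := rfl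

theorem Store.setCell_arr (W : ℕ) (s : Store) (a j v b i : ℕ) :
    (s.setCell W a j v).arr b i = if b = a ∧ i = j then v % 2 ^ W else s.arr b i := by
  by_cases hb : b = a
  · subst hb; simp [Store.setCell, Function.update_apply]
  · simp [Store.setCell, hb]

set_option linter.constructorNameAsVariable false

/-! ## A small language of terminating programs

Variables and three-dimensional arrays of natural numbers, expressions without overflow, and loops
over ranges of numbers.  Programs are translated to the machine and run there as long as no number
exceeds the word length. -/

/-- Variables; `io` holds the argument of an operation and its answer. -/
inductive Var where
  | io | t | r | q | p1 | p | M | np | nn | w | dl | d | h | X | a | k | x | y | e | f | z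
  deriving DecidableEq

/-- Arrays. -/
inductive Arr where
  | S | N | P | E | F | G | C | D | L | K
  deriving DecidableEq

/-- The register of a variable. -/
def Var.idx : Var → ℕ
  | io => 0 | t => 1 | r => 2 | q => 3 | p1 => 4 | p => 5 | M => 6 | np => 7 | nn => 8 | w => 9
  | dl => 10 | d => 11 | h => 12 | X => 13 | a => 14 | k => 15 | x => 16 | y => 17 | e => 18
  | f => 19 | z => 20

/-- The machine array of an array. -/
def Arr.idx : Arr → ℕ
  | S => 0 | N => 1 | P => 2 | E => 3 | F => 4 | G => 5 | C => 6 | D => 7 | L => 8 | K => 9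

theorem Var.idx_lt (x : Var) : x.idx < 22 := by cases x <;> decide

theorem Var.idx_inj {x y : Var} : x.idx = y.idx ↔ x = y := by
  constructor
  · cases x <;> cases y <;> simp [Var.idx]
  · rintro rfl; rfl

theorem Arr.idx_inj {x y : Arr} : x.idx = y.idx ↔ x = y := by
  constructor
  · cases x <;> cases y <;> simp [Arr.idx]
  · rintro rfl; rfl

/-- Contents of variables and arrays. -/
structure Mem where
  v : Var → ℕ
  m : Arr → ℕ → ℕ → ℕ → ℕ

/-- Write to a variable. -/
def Mem.set (σ : Mem) (x : Var) (n : ℕ) : Mem :=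
  { σ with v := fun y => if y = x then n else σ.v y }

/-- Write to an array. -/
def Mem.put (σ : Mem) (a : Arr) (i j k n : ℕ) : Mem :=
  { σ with m := fun b i' j' k' => if b = a ∧ i' = i ∧ j' = j ∧ k' = k then n else σ.m b i' j' k' }

@[simp] theorem Mem.set_v (σ : Mem) (x y : Var) (n : ℕ) :
    (σ.set x n).v y = if y = x then n else σ.v y := rfl

@[simp] theorem Mem.set_m (σ : Mem) (x : Var) (n : ℕ) : (σ.set x n).m = σ.m := rfl

@[simp] theorem Mem.put_v (σ : Mem) (a : Arr) (i j k n : ℕ) : (σ.put a i j k n).v = σ.v := rfl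

@[simp] theorem Mem.put_m (σ : Mem) (a b : Arr) (i j k n i' j' k' : ℕ) :
    (σ.put a i j k n).m b i' j' k' =
      if b = a ∧ i' = i ∧ j' = j ∧ k' = k then n else σ.m b i' j' k' := rfl

/-- Operations; subtraction is truncated. -/
inductive AOp where
  | add | sub | mul | div | mod | lt | eq

/-- Value of an operation. -/
def AOp.eval : AOp → ℕ → ℕ → ℕ
  | add, a, b => a + b
  | sub, a, b => a - b
  | mul, a, b => a * b
  | div, a, b => a / b
  | mod, a, b => a % b
  | lt, a, b => if a < b then 1 else 0
  | eq, a, b => if a = b then 1 else 0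

/-- Expressions. -/
inductive Expr where
  | c (n : ℕ)
  | v (x : Var)
  | op (o : AOp) (a b : Expr)
  | ld (a : Arr) (i j k : Expr)

/-- The value of an expression. -/
def Expr.eval (σ : Mem) : Expr → ℕ
  | c n => n
  | v x => σ.v x
  | op o a b => o.eval (a.eval σ) (b.eval σ)
  | ld a i j k => σ.m a (i.eval σ) (j.eval σ) (k.eval σ)

instance : Add Expr := ⟨Expr.op .add⟩
instance : Sub Expr := ⟨Expr.op .sub⟩
instance : Mul Expr := ⟨Expr.op .mul⟩
instance : Div Expr := ⟨Expr.op .div⟩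
instance : Mod Expr := ⟨Expr.op .mod⟩

/-- Comparison. -/
def Expr.lt (a b : Expr) : Expr := Expr.op .lt a b

@[simp] theorem Expr.eval_v (σ : Mem) (x : Var) : (Expr.v x).eval σ = σ.v x := rfl
@[simp] theorem Expr.eval_c (σ : Mem) (n : ℕ) : (Expr.c n).eval σ = n := rfl
@[simp] theorem Expr.eval_add (σ : Mem) (a b : Expr) : (a + b).eval σ = a.eval σ + b.eval σ := rfl
@[simp] theorem Expr.eval_sub (σ : Mem) (a b : Expr) : (a - b).eval σ = a.eval σ - b.eval σ := rfl
@[simp] theorem Expr.eval_mul (σ : Mem) (a b : Expr) : (a * b).eval σ = a.eval σ * b.eval σ := rfl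
@[simp] theorem Expr.eval_div (σ : Mem) (a b : Expr) : (a / b).eval σ = a.eval σ / b.eval σ := rfl
@[simp] theorem Expr.eval_mod (σ : Mem) (a b : Expr) : (a % b).eval σ = a.eval σ % b.eval σ := rfl
@[simp] theorem Expr.eval_lt (σ : Mem) (a b : Expr) :
    (a.lt b).eval σ = if a.eval σ < b.eval σ then 1 else 0 := rfl
@[simp] theorem Expr.eval_ld (σ : Mem) (a : Arr) (i j k : Expr) :
    (Expr.ld a i j k).eval σ = σ.m a (i.eval σ) (j.eval σ) (k.eval σ) := rfl

/-- Programs. -/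
inductive Prog where
  | skip
  | assign (x : Var) (e : Expr)
  | store (a : Arr) (i j k e : Expr)
  | seq (c d : Prog)
  | ite (e : Expr) (c d : Prog)
  /-- For all `x < e`, in increasing order, do `c`. -/
  | loop (x : Var) (e : Expr) (c : Prog)

infixr:60 " ;; " => Prog.seq

/-- The contents after `n` rounds of a loop over `x`. -/
def iter (x : Var) (f : Mem → Mem) (σ : Mem) : ℕ → Mem
  | 0 => σ
  | n + 1 => f ((iter x f σ n).set x n)

/-- The effect of a program. -/
def Prog.run : Prog → Mem → Mem
  | skip, σ => σ
  | assign x e, σ => σ.set x (e.eval σ)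
  | store a i j k e, σ => σ.put a (i.eval σ) (j.eval σ) (k.eval σ) (e.eval σ)
  | seq c d, σ => d.run (c.run σ)
  | ite e c d, σ => if e.eval σ ≠ 0 then c.run σ else d.run σ
  | .loop x e c, σ => iter x c.run σ (e.eval σ)

/-! ### Translation -/

/-- An injection of pairs of numbers into numbers. -/
def enc (i j : ℕ) : ℕ := i + (i + j) * (i + j)

/-- With `s = i + j` the code lies between `s ^ 2` and `s ^ 2 + s`. These intervals are disjoint for
different `s`, so the code determines `s` and then `i`. -/
theorem enc_inj {i j i' j' : ℕ} : enc i j = enc i' j' ↔ i = i' ∧ j = j' := by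
  constructor
  · intro h
    unfold enc at h
    have h1 : i + j = i' + j' := by
      by_contra hne
      rcases Nat.lt_or_gt_of_ne hne with hlt | hlt
      · nlinarith
      · nlinarith
    rw [h1] at h
    omega
  · rintro ⟨rfl, rfl⟩; rfl

/-- Replace `i` in register `k` and `j` in register `l` by `enc i j` in register `k`. -/
def encCode (k l : ℕ) : Cmd :=
  .seq (.instr (.bin .add l k l)) (.seq (.instr (.bin .mul l l l)) (.instr (.bin .add k k l)))

/-- The operands are in the registers `k` and `k + 1`, the result is left in register `k`. -/
def AOp.code (k : ℕ) : AOp → Cmd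
  | add => .instr (.bin .add k k (k + 1))
  | mul => .instr (.bin .mul k k (k + 1))
  | div => .instr (.bin .div k k (k + 1))
  | mod => .instr (.bin .mod k k (k + 1))
  | lt => .instr (.bin .lt k k (k + 1))
  | eq => .instr (.bin .eq k k (k + 1))
  | sub =>
      .seq (.instr (.bin .lt (k + 2) k (k + 1)))
        (.seq (.instr (.bin .sub k k (k + 1)))
          (.seq (.instr (.const (k + 1) 1))
            (.seq (.instr (.bin .sub (k + 2) (k + 1) (k + 2)))
              (.instr (.bin .mul k k (k + 2))))))

/-- Running time of `AOp.code`. -/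
def AOp.cost : AOp → ℕ
  | sub => 9
  | _ => 1

/-- Compute an expression in register `k` with work space from there on. -/
def Expr.code (k : ℕ) : Expr → Cmd
  | c n => .instr (.const k n)
  | v x => .instr (.move k x.idx)
  | op o a b => .seq (a.code k) (.seq (b.code (k + 1)) (o.code k))
  | ld a i j l =>
      .seq (i.code k) (.seq (j.code (k + 1)) (.seq (encCode k (k + 1))
        (.seq (l.code (k + 1)) (.seq (encCode k (k + 1)) (.instr (.load k a.idx k))))))

/-- Running time of `Expr.code`. -/
def Expr.cost : Expr → ℕ
  | c _ => 1
  | v _ => 1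
  | op o a b => a.cost + b.cost + o.cost + 2
  | ld _ i j l => i.cost + j.cost + l.cost + 16

@[simp] theorem Expr.cost_c (n : ℕ) : (Expr.c n).cost = 1 := rfl
@[simp] theorem Expr.cost_v (x : Var) : (Expr.v x).cost = 1 := rfl
@[simp] theorem Expr.cost_add (a b : Expr) : (a + b).cost = a.cost + b.cost + 3 := rfl
@[simp] theorem Expr.cost_sub (a b : Expr) : (a - b).cost = a.cost + b.cost + 11 := rfl
@[simp] theorem Expr.cost_mul (a b : Expr) : (a * b).cost = a.cost + b.cost + 3 := rfl
@[simp] theorem Expr.cost_div (a b : Expr) : (a / b).cost = a.cost + b.cost + 3 := rfl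
@[simp] theorem Expr.cost_mod (a b : Expr) : (a % b).cost = a.cost + b.cost + 3 := rfl
@[simp] theorem Expr.cost_lt (a b : Expr) : (a.lt b).cost = a.cost + b.cost + 3 := rfl
@[simp] theorem Expr.cost_ld (a : Arr) (i j k : Expr) :
    (Expr.ld a i j k).cost = i.cost + j.cost + k.cost + 16 := rfl

/-- Translation of a program, with work space from register `k` on. -/
def Prog.code (k : ℕ) : Prog → Cmd
  | skip => .instr (.const k 0)
  | assign x e => .seq (e.code k) (.instr (.move x.idx k))
  | store a i j l e =>
      .seq (i.code k) (.seq (j.code (k + 1)) (.seq (encCode k (k + 1))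
        (.seq (l.code (k + 1)) (.seq (encCode k (k + 1))
          (.seq (e.code (k + 1)) (.instr (.store a.idx k (k + 1))))))))
  | seq c d => .seq (c.code k) (d.code k)
  | ite e c d => .seq (e.code k) (.ite k (c.code k) (d.code k))
  | .loop x e c =>
      .seq (e.code (k + 1)) (.seq (.instr (.const k 0))
        (.seq (.instr (.bin .lt (k + 2) k (k + 1)))
          (.loop (k + 2) (.seq (.instr (.move x.idx k)) (.seq (c.code (k + 2))
            (.seq (.instr (.const (k + 2) 1)) (.seq (.instr (.bin .add k k (k + 2)))
              (.instr (.bin .lt (k + 2) k (k + 1))))))))))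

/-- Running time of `n` rounds of a loop. -/
def iterCost (x : Var) (f : Mem → Mem) (g : Mem → ℕ) (σ : Mem) (n : ℕ) : ℕ :=
  ∑ k ∈ Finset.range n, (g ((iter x f σ k).set x k) + 9)

/-- Running time of `Prog.code`. -/
def Prog.cost : Prog → Mem → ℕ
  | skip, _ => 1
  | assign _ e, _ => e.cost + 2
  | store _ i j k e, _ => i.cost + j.cost + k.cost + e.cost + 17
  | seq c d, σ => c.cost σ + d.cost (c.run σ) + 1
  | ite e c d, σ => e.cost + 2 + if e.eval σ ≠ 0 then c.cost σ else d.cost σ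
  | .loop x e c, σ => e.cost + 6 + iterCost x c.run c.cost σ (e.eval σ)

/-- No overflow in the evaluation of an expression. -/
def Expr.Safe (W : ℕ) (σ : Mem) : Expr → Prop
  | c n => n < 2 ^ W
  | v x => σ.v x < 2 ^ W
  | op o a b => a.Safe W σ ∧ b.Safe W σ ∧ o.eval (a.eval σ) (b.eval σ) < 2 ^ W
  | ld a i j k => i.Safe W σ ∧ j.Safe W σ ∧ k.Safe W σ ∧
      enc (enc (i.eval σ) (j.eval σ)) (k.eval σ) < 2 ^ W ∧
      σ.m a (i.eval σ) (j.eval σ) (k.eval σ) < 2 ^ W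

/-- No overflow in the execution of a program. -/
def Prog.Safe (W : ℕ) : Prog → Mem → Prop
  | skip, _ => True
  | assign _ e, σ => e.Safe W σ
  | store _ i j k e, σ => i.Safe W σ ∧ j.Safe W σ ∧ k.Safe W σ ∧ e.Safe W σ ∧
      enc (enc (i.eval σ) (j.eval σ)) (k.eval σ) < 2 ^ W
  | seq c d, σ => c.Safe W σ ∧ d.Safe W (c.run σ)
  | ite e c d, σ => e.Safe W σ ∧ if e.eval σ ≠ 0 then c.Safe W σ else d.Safe W σ
  | .loop x e c, σ => e.Safe W σ ∧ ∀ k < e.eval σ, c.Safe W ((iter x c.run σ k).set x k)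

/-! ### Correctness and exact running time of the translation. -/

theorem Expr.Safe.eval_lt {W : ℕ} {σ : Mem} {e : Expr} (h : e.Safe W σ) : e.eval σ < 2 ^ W := by
  cases e with
  | c n => exact h
  | v x => exact h
  | op o a b => exact h.2.2
  | ld a i j k => exact h.2.2.2.2

/-- The store represents the contents of the variables and arrays. -/
structure Agree (s : Store) (σ : Mem) : Prop where
  reg : ∀ x : Var, s.reg x.idx = σ.v x
  arr : ∀ (a : Arr) (i j k : ℕ), s.arr a.idx (enc (enc i j) k) = σ.m a i j k

theorem Agree.zero : Agree Store.zero ⟨fun _ => 0, fun _ _ _ _ => 0⟩ := ⟨fun _ => rfl, fun _ _ _ _ => rfl⟩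

/-- Registers from 22 on are work space; overwriting them does not disturb the representation. -/
theorem Agree.of_eq {s s' : Store} {σ : Mem} (h : Agree s σ)
    (hr : ∀ x < 22, s'.reg x = s.reg x) (ha : s'.arr = s.arr) : Agree s' σ :=
  ⟨fun x => by rw [hr _ x.idx_lt, h.reg], fun a i j k => by rw [ha, h.arr]⟩

theorem Agree.set {s : Store} {σ : Mem} (h : Agree s σ) (W : ℕ) (x : Var) {n : ℕ}
    (hn : n < 2 ^ W) : Agree (s.setReg W x.idx n) (σ.set x n) := by
  refine ⟨fun y => ?_, fun a i j k => ?_⟩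
  · simp [Store.setReg_reg, Var.idx_inj, Nat.mod_eq_of_lt hn, h.reg]
  · simp [Store.setReg_arr, h.arr]

theorem Agree.put {s : Store} {σ : Mem} (h : Agree s σ) (W : ℕ) (a : Arr) (i j k : ℕ) {n : ℕ}
    (hn : n < 2 ^ W) :
    Agree (s.setCell W a.idx (enc (enc i j) k) n) (σ.put a i j k n) := by
  refine ⟨fun y => ?_, fun b i' j' k' => ?_⟩
  · simp [Store.setCell_reg, h.reg]
  · simp [Store.setCell_arr, Arr.idx_inj, enc_inj, Nat.mod_eq_of_lt hn, h.arr, and_assoc]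

theorem Runs.cast {W : ℕ} {c : Cmd} {s s' : Store} {m n : ℕ} (h : Runs W c s s' m)
    (e : m = n) : Runs W c s s' n := e ▸ h

theorem encCode_runs {W k l i j : ℕ} {s : Store} (hi : s.reg k = i) (hj : s.reg l = j)
    (hkl : k < l) (hb : enc i j < 2 ^ W) :
    ∃ s', Runs W (encCode k l) s s' 5 ∧ s'.reg k = enc i j ∧ (∀ x < k, s'.reg x = s.reg x) ∧
      s'.arr = s.arr := by
  refine ⟨_, (Runs.bin W _ _ _ _ _).seq ((Runs.bin W _ _ _ _ _).seq (Runs.bin W _ _ _ _ _)),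
    ?_, ?_, rfl⟩
  -- The code dominates the intermediate square, and the square dominates the intermediate sum, so a
  -- bound on the code excludes every overflow.
  · have h1 : i + j < 2 ^ W := by unfold enc at hb; nlinarith [Nat.le_mul_self (i + j)]
    have h2 : (i + j) * (i + j) < 2 ^ W := by unfold enc at hb; omega
    have hne : k ≠ l := hkl.ne
    simp only [Store.setReg_reg, BinOp.eval, hi, hj, if_true, if_neg hne, Nat.mod_eq_of_lt h1,
      Nat.mod_eq_of_lt h2]
    exact Nat.mod_eq_of_lt hb
  · intro x hx
    have : x ≠ k := hx.ne
    have : x ≠ l := (hx.trans hkl).ne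
    simp [Store.setReg_reg, *]

theorem AOp.code_runs {W k i j : ℕ} (o : AOp) {s : Store} (hi : s.reg k = i)
    (hj : s.reg (k + 1) = j) (_ : i < 2 ^ W) (hjW : j < 2 ^ W) (hW : 1 < 2 ^ W)
    (hb : o.eval i j < 2 ^ W) :
    ∃ s', Runs W (o.code k) s s' o.cost ∧ s'.reg k = o.eval i j ∧ (∀ x < k, s'.reg x = s.reg x) ∧
      s'.arr = s.arr := by
  have aux : ∀ b : BinOp, b.eval W i j = o.eval i j →
      ∃ s', Runs W (.instr (.bin b k k (k + 1))) s s' 1 ∧ s'.reg k = o.eval i j ∧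
        (∀ x < k, s'.reg x = s.reg x) ∧ s'.arr = s.arr := fun b hbe => by
    refine ⟨_, Runs.bin W _ _ _ _ _, ?_, fun x hx => ?_, rfl⟩
    · simp [Store.setReg_reg, hi, hj, hbe, Nat.mod_eq_of_lt hb]
    · simp [Store.setReg_reg, hx.ne]
  cases o with
  | add => exact aux .add rfl
  | mul => exact aux .mul rfl
  | div => exact aux .div rfl
  | mod => exact aux .mod rfl
  | lt => exact aux .lt rfl
  | eq => exact aux .eq rfl
  | sub =>
    refine ⟨_, (Runs.bin W _ _ _ _ _).seq ((Runs.bin W _ _ _ _ _).seq ((Runs.const W _ _ _).seq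
      ((Runs.bin W _ _ _ _ _).seq (Runs.bin W _ _ _ _ _)))), ?_, fun x hx => ?_, rfl⟩
    · have h1 : (1 : ℕ) % 2 ^ W = 1 := Nat.mod_eq_of_lt hW
      simp only [Store.setReg_reg, BinOp.eval, AOp.eval, hi, hj, if_true, h1,
        show k ≠ k + 1 by omega, show k ≠ k + 2 by omega, show k + 1 ≠ k by omega,
        show k + 1 ≠ k + 2 by omega, show k + 2 ≠ k by omega, show k + 2 ≠ k + 1 by omega, if_false]
      -- Machine subtraction wraps around. Multiplying the difference by one minus the comparison
      -- bit turns it into truncated subtraction.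
      by_cases hij : i < j
      · have h2 : (1 + (2 ^ W - 1)) = 2 ^ W := by omega
        simp only [hij, if_true, h1, h2, Nat.mod_self, mul_zero, Nat.zero_mod]
        omega
      · have h2 : 1 + 2 ^ W = 2 ^ W + 1 := by omega
        have h3 : i + (2 ^ W - j) = 2 ^ W + (i - j) := by omega
        simp only [hij, if_false, Nat.zero_mod, Nat.sub_zero, h2, h3, Nat.add_mod_left, h1, mul_one,
          Nat.mod_mod]
        exact Nat.mod_eq_of_lt hb
    · simp [Store.setReg_reg, show x ≠ k by omega, show x ≠ k + 1 by omega,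
        show x ≠ k + 2 by omega]

theorem Expr.code_runs {W : ℕ} (hW : 1 < 2 ^ W) {σ : Mem} (e : Expr) :
    ∀ {k : ℕ} {s : Store}, 22 ≤ k → Agree s σ → e.Safe W σ →
    ∃ s', Runs W (e.code k) s s' e.cost ∧ s'.reg k = e.eval σ ∧ (∀ x < k, s'.reg x = s.reg x) ∧
      s'.arr = s.arr := by
  induction e with
  | c n =>
    intro k s hk hs h
    refine ⟨_, Runs.const W _ _ _, ?_, fun x hx => ?_, rfl⟩
    · simpa [Store.setReg_reg, Expr.eval] using Nat.mod_eq_of_lt h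
    · simp [Store.setReg_reg, hx.ne]
  | v x =>
    intro k s hk hs h
    refine ⟨_, Runs.move W _ _ _, ?_, fun x hx => ?_, rfl⟩
    · simpa [Store.setReg_reg, hs.reg, Expr.eval] using Nat.mod_eq_of_lt h
    · simp [Store.setReg_reg, hx.ne]
  | op o a b iha ihb =>
    intro k s hk hs h
    obtain ⟨s1, r1, e1, f1, g1⟩ := iha hk hs h.1
    have hs1 : Agree s1 σ := hs.of_eq (fun x hx => f1 x (by omega)) g1
    obtain ⟨s2, r2, e2, f2, g2⟩ := ihb (k := k + 1) (by omega) hs1 h.2.1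
    obtain ⟨s3, r3, e3, f3, g3⟩ := o.code_runs (k := k) (s := s2) (i := a.eval σ) (j := b.eval σ)
      (by rw [f2 k (by omega), e1]) e2 h.1.eval_lt h.2.1.eval_lt hW h.2.2
    refine ⟨s3, ?_, e3, fun x hx => by rw [f3 x hx, f2 x (by omega), f1 x hx], by rw [g3, g2, g1]⟩
    exact Runs.cast (r1.seq (r2.seq r3)) (by simp only [Expr.cost]; omega)
  | ld a i j l ihi ihj ihl =>
    intro k s hk hs h
    obtain ⟨hi, hj, hl, hb, hc⟩ := h
    have hb' : enc (i.eval σ) (j.eval σ) < 2 ^ W := by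
      refine lt_of_le_of_lt ?_ hb; exact Nat.le_add_right _ _
    obtain ⟨s1, r1, e1, f1, g1⟩ := ihi hk hs hi
    have hs1 : Agree s1 σ := hs.of_eq (fun x hx => f1 x (by omega)) g1
    obtain ⟨s2, r2, e2, f2, g2⟩ := ihj (k := k + 1) (by omega) hs1 hj
    obtain ⟨s3, r3, e3, f3, g3⟩ := encCode_runs (k := k) (l := k + 1) (s := s2)
      (i := i.eval σ) (j := j.eval σ) (by rw [f2 k (by omega), e1]) e2 (by omega) hb'
    have hs3 : Agree s3 σ := hs1.of_eq
      (fun x hx => by rw [f3 x (by omega), f2 x (by omega)]) (by rw [g3, g2])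
    obtain ⟨s4, r4, e4, f4, g4⟩ := ihl (k := k + 1) (by omega) hs3 hl
    obtain ⟨s5, r5, e5, f5, g5⟩ := encCode_runs (k := k) (l := k + 1) (s := s4)
      (i := enc (i.eval σ) (j.eval σ)) (j := l.eval σ) (by rw [f4 k (by omega), e3]) e4 (by omega) hb
    refine ⟨s5.setReg W k (s5.arr a.idx (s5.reg k)), ?_, ?_, fun x hx => ?_, ?_⟩
    · exact Runs.cast ((r1.seq (r2.seq (r3.seq (r4.seq (r5.seq (Runs.load W s5 k a.idx k))))))) (by simp only [Expr.cost]; omega)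
    · rw [Store.setReg_reg, if_pos rfl, e5, g5, g4, g3, g2, g1, hs.arr, Expr.eval]
      exact Nat.mod_eq_of_lt hc
    · rw [Store.setReg_reg, if_neg hx.ne, f5 x hx, f4 x (by omega), f3 x hx, f2 x (by omega), f1 x hx]
    · rw [Store.setReg_arr, g5, g4, g3, g2, g1]

/-- Induction on the program. The registers from 22 up to `k` must survive because they hold the
counters and bounds of enclosing loops; those below 22 are the variables, whose change is described
by `Prog.run`. -/
theorem Prog.code_runs {W : ℕ} (hW : 1 < 2 ^ W) (c : Prog) :
    ∀ {k : ℕ} {s : Store} {σ : Mem}, 22 ≤ k → Agree s σ → c.Safe W σ →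
    ∃ s', Runs W (c.code k) s s' (c.cost σ) ∧ Agree s' (c.run σ) ∧
      (∀ x < k, 22 ≤ x → s'.reg x = s.reg x) := by
  induction c with
  | skip =>
    intro k s σ hk hs h
    refine ⟨_, Runs.const W _ _ _, ?_, fun x hx _ => ?_⟩
    · refine hs.of_eq (fun x hx => ?_) rfl
      simp [Store.setReg_reg, show x ≠ k by omega]
    · simp [Store.setReg_reg, hx.ne]
  | assign x e =>
    intro k s σ hk hs h
    obtain ⟨s1, r1, e1, f1, g1⟩ := e.code_runs hW hk hs h
    have hs1 : Agree s1 σ := hs.of_eq (fun x hx => f1 x (by omega)) g1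
    refine ⟨_, ?_, hs1.set W x (Expr.Safe.eval_lt h), fun y hy hy' => ?_⟩
    · have := r1.seq (Runs.move W s1 x.idx k)
      rw [e1] at this
      exact Runs.cast (this) (by simp only [Prog.cost]; omega)
    · have := x.idx_lt
      rw [Store.setReg_reg, if_neg (by omega), f1 y hy]
  | store a i j l e =>
    intro k s σ hk hs h
    obtain ⟨hi, hj, hl, he, hb⟩ := h
    have hb' : enc (i.eval σ) (j.eval σ) < 2 ^ W := by
      refine lt_of_le_of_lt ?_ hb; exact Nat.le_add_right _ _
    obtain ⟨s1, r1, e1, f1, g1⟩ := i.code_runs hW hk hs hi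
    have hs1 : Agree s1 σ := hs.of_eq (fun x hx => f1 x (by omega)) g1
    obtain ⟨s2, r2, e2, f2, g2⟩ := j.code_runs hW (k := k + 1) (by omega) hs1 hj
    obtain ⟨s3, r3, e3, f3, g3⟩ := encCode_runs (k := k) (l := k + 1) (s := s2)
      (i := i.eval σ) (j := j.eval σ) (by rw [f2 k (by omega), e1]) e2 (by omega) hb'
    have hs3 : Agree s3 σ := hs1.of_eq
      (fun x hx => by rw [f3 x (by omega), f2 x (by omega)]) (by rw [g3, g2])
    obtain ⟨s4, r4, e4, f4, g4⟩ := l.code_runs hW (k := k + 1) (by omega) hs3 hl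
    obtain ⟨s5, r5, e5, f5, g5⟩ := encCode_runs (k := k) (l := k + 1) (s := s4)
      (i := enc (i.eval σ) (j.eval σ)) (j := l.eval σ) (by rw [f4 k (by omega), e3]) e4 (by omega) hb
    have hs5 : Agree s5 σ := hs3.of_eq
      (fun x hx => by rw [f5 x (by omega), f4 x (by omega)]) (by rw [g5, g4])
    obtain ⟨s6, r6, e6, f6, g6⟩ := e.code_runs hW (k := k + 1) (by omega) hs5 he
    have hs6 : Agree s6 σ := hs5.of_eq (fun x hx => f6 x (by omega)) g6
    refine ⟨_, ?_, hs6.put W a (i.eval σ) (j.eval σ) (l.eval σ) he.eval_lt, fun x hx hx' => ?_⟩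
    · have := r1.seq (r2.seq (r3.seq (r4.seq (r5.seq (r6.seq (Runs.store W s6 a.idx k (k + 1)))))))
      rw [e6, f6 k (by omega), e5] at this
      exact Runs.cast (this) (by simp only [Prog.cost]; omega)
    · rw [Store.setCell_reg, f6 x (by omega), f5 x hx, f4 x (by omega), f3 x hx, f2 x (by omega),
        f1 x hx]
  | seq c d ihc ihd =>
    intro k s σ hk hs h
    obtain ⟨s1, r1, a1, f1⟩ := ihc hk hs h.1
    obtain ⟨s2, r2, a2, f2⟩ := ihd hk a1 h.2
    refine ⟨s2, ?_, a2, fun x hx hx' => by rw [f2 x hx hx', f1 x hx hx']⟩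
    exact Runs.cast (r1.seq r2) (by simp only [Prog.cost]; omega)
  | ite e c d ihc ihd =>
    intro k s σ hk hs h
    obtain ⟨s1, r1, e1, f1, g1⟩ := e.code_runs hW hk hs h.1
    have hs1 : Agree s1 σ := hs.of_eq (fun x hx => f1 x (by omega)) g1
    have h2 := h.2
    by_cases he : e.eval σ = 0
    · simp only [he, ne_eq, not_true_eq_false, if_false] at h2
      obtain ⟨s2, r2, a2, f2⟩ := ihd hk hs1 h2
      refine ⟨s2, ?_, by simpa [Prog.run, he] using a2,
        fun x hx hx' => by rw [f2 x hx hx', f1 x hx]⟩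
      exact Runs.cast (r1.seq (Runs.ite_false (c := c.code k) (by rw [e1, he]) r2)) (by simp only [Prog.cost, he, ne_eq, not_true_eq_false, if_false]; omega)
    · simp only [he, ne_eq, not_false_eq_true, if_true] at h2
      obtain ⟨s2, r2, a2, f2⟩ := ihc hk hs1 h2
      refine ⟨s2, ?_, by simpa [Prog.run, he] using a2,
        fun x hx hx' => by rw [f2 x hx hx', f1 x hx]⟩
      exact Runs.cast (r1.seq (Runs.ite_true (d := d.code k) (by rwa [e1]) r2)) (by simp only [Prog.cost, he, ne_eq, not_false_eq_true, if_true]; omega)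
  | loop x e c ih =>
    intro k s σ hk hs h
    obtain ⟨he, hb⟩ := h
    set n := e.eval σ with hn
    have hnW : n < 2 ^ W := he.eval_lt
    -- Induction on the number `j` of rounds left. Register `k` counts, `k + 1` holds the bound and
    -- `k + 2` the test. The counter is copied to the variable `x` in each round, so the body may
    -- overwrite `x`. The test register doubles as work space of the body and is computed afresh
    -- after it.
    have key : ∀ j i : ℕ, i + j = n → ∀ s : Store, Agree s (iter x c.run σ i) → s.reg k = i →
        s.reg (k + 1) = n → s.reg (k + 2) = (if i < n then 1 else 0) →
        ∃ s', Runs W (.loop (k + 2) (.seq (.instr (.move x.idx k)) (.seq (c.code (k + 2))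
            (.seq (.instr (.const (k + 2) 1)) (.seq (.instr (.bin .add k k (k + 2)))
              (.instr (.bin .lt (k + 2) k (k + 1)))))))) s s'
            (1 + ∑ l ∈ Finset.range j, (c.cost ((iter x c.run σ (i + l)).set x (i + l)) + 9)) ∧
          Agree s' (iter x c.run σ n) ∧ (∀ x < k, 22 ≤ x → s'.reg x = s.reg x) := by
      intro j
      induction j with
      | zero =>
        intro i hi s hs h0 h1 h2
        obtain rfl : i = n := by omega
        exact ⟨s, Runs.loop_done (by simpa using h2), hs, fun _ _ _ => rfl⟩
      | succ j ihj =>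
        intro i hi s hs h0 h1 h2
        have hin : i < n := by omega
        rw [if_pos hin] at h2
        have hxl := x.idx_lt
        have hs1 := hs.set W x (n := i) (by omega)
        obtain ⟨s2, r2, a2, f2⟩ := ih (k := k + 2) (by omega) hs1 (hb i hin)
        have r1 := Runs.move W s x.idx k
        rw [h0] at r1
        have r := r1.seq (r2.seq ((Runs.const W _ (k + 2) 1).seq
          ((Runs.bin W _ .add k k (k + 2)).seq (Runs.bin W _ .lt (k + 2) k (k + 1)))))
        set s3 := (((s2.setReg W (k + 2) 1).setReg W k (BinOp.add.eval W
          ((s2.setReg W (k + 2) 1).reg k) ((s2.setReg W (k + 2) 1).reg (k + 2))))) with hs3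
        have e2 : s2.reg k = i := by
          rw [f2 k (by omega) hk, Store.setReg_reg, if_neg (by omega), h0]
        have e2' : s2.reg (k + 1) = n := by
          rw [f2 (k + 1) (by omega) (by omega), Store.setReg_reg, if_neg (by omega), h1]
        have e3 : s3.reg k = i + 1 := by
          rw [hs3]
          simp only [Store.setReg_reg, if_true, BinOp.eval, if_neg (show k ≠ k + 2 by omega), e2,
            Nat.mod_eq_of_lt hW]
          exact Nat.mod_eq_of_lt (by omega)
        have e3' : s3.reg (k + 1) = n := by
          rw [hs3]
          simp only [Store.setReg_reg, if_neg (show k + 1 ≠ k + 2 by omega),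
            if_neg (show k + 1 ≠ k by omega), e2']
        set s4 := s3.setReg W (k + 2) (BinOp.lt.eval W (s3.reg k) (s3.reg (k + 1))) with hs4
        have f4 : ∀ y, y ≠ k + 2 → s4.reg y = s3.reg y := fun y hy => by
          rw [hs4, Store.setReg_reg, if_neg hy]
        have f3 : ∀ y, y ≠ k → y ≠ k + 2 → s3.reg y = s2.reg y := fun y hy hy' => by
          rw [hs3, Store.setReg_reg, if_neg hy, Store.setReg_reg, if_neg hy']
        have e4 : s4.reg (k + 2) = if i + 1 < n then 1 else 0 := by
          rw [hs4, Store.setReg_reg, if_pos rfl, e3, e3', BinOp.eval]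
          split_ifs
          · exact Nat.mod_eq_of_lt hW
          · simp
        have a4 : Agree s4 (iter x c.run σ (i + 1)) := by
          refine a2.of_eq (fun y hy => ?_) rfl
          rw [f4 y (by omega), f3 y (by omega) (by omega)]
        obtain ⟨s', r', a', f'⟩ := ihj (i + 1) (by omega) s4 a4
          (by rw [f4 _ (by omega), e3]) (by rw [f4 _ (by omega), e3']) e4
        refine ⟨s', ?_, a', fun y hy hy' => ?_⟩
        · refine Runs.cast (Runs.loop_next (by rw [h2]; exact one_ne_zero) r r') ?_
          rw [Finset.sum_range_succ']
          simp only [add_zero, show ∀ l, i + 1 + l = i + (l + 1) from fun l => by omega]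
          omega
        · rw [f' y hy hy', f4 y (by omega), f3 y (by omega) (by omega), f2 y (by omega) hy',
            Store.setReg_reg, if_neg (by omega)]
    obtain ⟨s1, r1, e1, f1, g1⟩ := e.code_runs hW (k := k + 1) (by omega) hs he
    have r2 := Runs.const W s1 k 0
    have r3 := Runs.bin W (s1.setReg W k 0) .lt (k + 2) k (k + 1)
    set s2 := s1.setReg W k 0 with hs2
    set s3 := s2.setReg W (k + 2) (BinOp.lt.eval W (s2.reg k) (s2.reg (k + 1))) with hs3
    have e2 : s2.reg k = 0 := by rw [hs2, Store.setReg_reg, if_pos rfl, Nat.zero_mod]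
    have e2' : s2.reg (k + 1) = n := by rw [hs2, Store.setReg_reg, if_neg (by omega), e1]
    have f3 : ∀ y, y ≠ k + 2 → s3.reg y = s2.reg y := fun y hy => by
      rw [hs3, Store.setReg_reg, if_neg hy]
    have f2 : ∀ y, y ≠ k → s2.reg y = s1.reg y := fun y hy => by
      rw [hs2, Store.setReg_reg, if_neg hy]
    have e3 : s3.reg (k + 2) = if 0 < n then 1 else 0 := by
      rw [hs3, Store.setReg_reg, if_pos rfl, e2, e2', BinOp.eval]
      split_ifs
      · exact Nat.mod_eq_of_lt hW
      · simp
    have a3 : Agree s3 σ := by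
      refine hs.of_eq (fun y hy => ?_) g1
      rw [f3 y (by omega), f2 y (by omega), f1 y (by omega)]
    obtain ⟨s', r', a', f'⟩ := key n 0 (by omega) s3 a3 (by rw [f3 _ (by omega), e2])
      (by rw [f3 _ (by omega), e2']) e3
    refine ⟨s', ?_, a', fun y hy hy' => ?_⟩
    · exact Runs.cast (r1.seq (r2.seq (r3.seq r'))) (by simp only [Prog.cost, iterCost, zero_add, ← hn]; omega)
    · rw [f' y hy hy', f3 y (by omega), f2 y (by omega), f1 y (by omega)]

/-! ### Bounds on the numbers that occur -/

/-- Everything stored is at most `Z`. -/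
structure Bdd (Z : ℕ) (σ : Mem) : Prop where
  v : ∀ x, σ.v x ≤ Z
  m : ∀ a i j k, σ.m a i j k ≤ Z

theorem Bdd.set {Z : ℕ} {σ : Mem} (h : Bdd Z σ) (x : Var) {n : ℕ} (hn : n ≤ Z) :
    Bdd Z (σ.set x n) :=
  ⟨fun y => by rw [Mem.set_v]; split_ifs; exacts [hn, h.v y], h.m⟩

theorem Bdd.put {Z : ℕ} {σ : Mem} (h : Bdd Z σ) (a : Arr) (i j k : ℕ) {n : ℕ} (hn : n ≤ Z) :
    Bdd Z (σ.put a i j k n) :=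
  ⟨h.v, fun b i' j' k' => by rw [Mem.put_m]; split_ifs; exacts [hn, h.m ..]⟩

/-- An exponent for the numbers that occur in the evaluation of an expression. -/
def Expr.deg : Expr → ℕ
  | c n => n + 1
  | v _ => 1
  | op .add a b => max a.deg b.deg + 1
  | op .mul a b => a.deg + b.deg
  | op _ a b => max a.deg b.deg
  | ld _ i j k => 4 * max (max i.deg j.deg) k.deg + 9

/-- An exponent for the numbers that occur in the execution of a program. -/
def Prog.deg : Prog → ℕ
  | skip => 0
  | assign _ e => e.deg
  | store a i j k e => max (Expr.ld a i j k).deg e.deg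
  | seq c d => max c.deg d.deg
  | ite e c d => max e.deg (max c.deg d.deg)
  | .loop _ e c => max e.deg c.deg

theorem Expr.one_le_deg (e : Expr) : 1 ≤ e.deg := by
  induction e with
  | c n => simp [deg]
  | v x => simp [deg]
  | op o a b iha ihb => cases o <;> simp only [deg] <;> omega
  | ld a i j k => simp only [deg]; omega

/-- The exponent depends on the text of the expression only. Since `2 ≤ Z`, an addition costs one
more factor `Z`, and a constant `n` is below `Z ^ n`. -/
theorem Expr.eval_le {Z : ℕ} (hZ : 2 ≤ Z) {σ : Mem} (h : Bdd Z σ) (e : Expr) :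
    e.eval σ ≤ Z ^ e.deg := by
  have hp : ∀ {m n : ℕ}, m ≤ n → Z ^ m ≤ Z ^ n := fun h => Nat.pow_le_pow_right (by omega) h
  have h1 : ∀ n : ℕ, 1 ≤ Z ^ n := fun n => Nat.one_le_pow _ _ (by omega)
  induction e with
  | c n => exact (Nat.lt_pow_self (by omega : 1 < Z)).le.trans (hp (Nat.le_succ n))
  | v x => simpa [deg, eval] using h.v x
  | op o a b iha ihb =>
    have ha := iha.trans (hp (le_max_left a.deg b.deg))
    have hb := ihb.trans (hp (le_max_right a.deg b.deg))
    cases o with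
    | add => simp only [eval, AOp.eval, deg, pow_succ]; nlinarith
    | mul => simp only [eval, AOp.eval, deg, pow_add]; exact Nat.mul_le_mul iha ihb
    | sub => simp only [eval, AOp.eval, deg]; omega
    | div => simp only [eval, AOp.eval, deg]; exact (Nat.div_le_self _ _).trans ha
    | mod => simp only [eval, AOp.eval, deg]; exact (Nat.mod_le _ _).trans ha
    | lt => simp only [eval, AOp.eval, deg]; split_ifs; exacts [h1 _, Nat.zero_le _]
    | eq => simp only [eval, AOp.eval, deg]; split_ifs; exacts [h1 _, Nat.zero_le _]
  | ld a i j k => exact (h.m ..).trans (by simpa using hp (one_le_deg (ld a i j k)))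

/-- The square of `i + j` is at most `Z ^ (2 * m + 2)`, and adding `i` at most doubles it. Applied
twice, this gives the `4 * m + 9` in the exponent of a load. -/
theorem enc_le_pow {Z m i j : ℕ} (hZ : 2 ≤ Z) (hi : i ≤ Z ^ m) (hj : j ≤ Z ^ m) :
    enc i j ≤ Z ^ (2 * m + 3) := by
  have h1 : 1 ≤ Z ^ m := Nat.one_le_pow _ _ (by omega)
  have h2 : i + j ≤ Z ^ (m + 1) := by rw [pow_succ]; nlinarith
  have h3 : i ≤ Z ^ (m + 1) * Z ^ (m + 1) := by
    refine hi.trans ?_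
    rw [← pow_add]; exact Nat.pow_le_pow_right (by omega) (by omega)
  have h4 := Nat.mul_le_mul h2 h2
  rw [show 2 * m + 3 = (m + 1) + (m + 1) + 1 by ring, pow_succ, pow_add, enc]
  nlinarith

theorem Expr.enc_le {Z : ℕ} (hZ : 2 ≤ Z) {σ : Mem} (h : Bdd Z σ) (a : Arr) (i j k : Expr) :
    enc (enc (i.eval σ) (j.eval σ)) (k.eval σ) ≤ Z ^ (ld a i j k).deg := by
  have hp : ∀ {m n : ℕ}, m ≤ n → Z ^ m ≤ Z ^ n := fun h => Nat.pow_le_pow_right (by omega) h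
  set m := max (max i.deg j.deg) k.deg with hm
  have hi : i.eval σ ≤ Z ^ m := (eval_le hZ h i).trans (hp (by omega))
  have hj : j.eval σ ≤ Z ^ m := (eval_le hZ h j).trans (hp (by omega))
  have hk : k.eval σ ≤ Z ^ m := (eval_le hZ h k).trans (hp (by omega))
  have := enc_le_pow hZ (enc_le_pow hZ hi hj) (hk.trans (hp (by omega)))
  exact this.trans (hp (by simp only [deg]; omega))

theorem Expr.safe_of_bdd {Z D W : ℕ} (hZ : 2 ≤ Z) (hD : Z ^ D < 2 ^ W) {σ : Mem} (h : Bdd Z σ)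
    {e : Expr} (he : e.deg ≤ D) : e.Safe W σ := by
  have hp : ∀ {m : ℕ}, m ≤ D → Z ^ m < 2 ^ W := fun h =>
    (Nat.pow_le_pow_right (by omega) h).trans_lt hD
  induction e with
  | c n => exact (eval_le hZ h (.c n)).trans_lt (hp he)
  | v x => exact (eval_le hZ h (.v x)).trans_lt (hp he)
  | op o a b iha ihb =>
    have h1 := a.one_le_deg
    have h2 := b.one_le_deg
    have h3 : a.deg ≤ D ∧ b.deg ≤ D := by
      cases o <;> simp only [deg] at he <;> omega
    exact ⟨iha h3.1, ihb h3.2, (eval_le hZ h (.op o a b)).trans_lt (hp he)⟩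
  | ld a i j k ihi ihj ihk =>
    have h3 := he
    simp only [deg] at h3
    exact ⟨ihi (by omega), ihj (by omega), ihk (by omega), (enc_le hZ h a i j k).trans_lt (hp he),
      (eval_le hZ h (.ld a i j k)).trans_lt (hp he)⟩

/-- Everything written is at most `Z`. -/
def Prog.Good (Z : ℕ) : Prog → Mem → Prop
  | skip, _ => True
  | assign _ e, σ => e.eval σ ≤ Z
  | store _ _ _ _ e, σ => e.eval σ ≤ Z
  | seq c d, σ => c.Good Z σ ∧ d.Good Z (c.run σ)
  | ite e c d, σ => if e.eval σ ≠ 0 then c.Good Z σ else d.Good Z σ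
  | .loop x e c, σ => e.eval σ ≤ Z ∧ ∀ k < e.eval σ, c.Good Z ((iter x c.run σ k).set x k)

theorem Bdd.run {Z : ℕ} (c : Prog) : ∀ {σ : Mem}, Bdd Z σ → c.Good Z σ → Bdd Z (c.run σ) := by
  induction c with
  | skip => exact fun h _ => h
  | assign x e => exact fun h hg => h.set x hg
  | store a i j k e => exact fun h hg => h.put _ _ _ _ hg
  | seq c d ihc ihd => exact fun h hg => ihd (ihc h hg.1) hg.2
  | ite e c d ihc ihd =>
    intro σ h hg
    simp only [Prog.Good] at hg
    simp only [Prog.run]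
    split_ifs at hg ⊢
    exacts [ihc h hg, ihd h hg]
  | loop x e c ih =>
    intro σ h hg
    have : ∀ n ≤ e.eval σ, Bdd Z (iter x c.run σ n) := by
      intro n
      induction n with
      | zero => exact fun _ => h
      | succ n ihn =>
        exact fun hn => ih ((ihn (by omega)).set x (by have := hg.1; omega)) (hg.2 n (by omega))
    exact this _ le_rfl

/-- All intermediate values and addresses are polynomially bounded in the stored numbers, with an
exponent known from the text. So only the values that are written have to be bounded dynamically;
everything else is a matter of word length. -/
theorem Prog.safe_of_good {Z D W : ℕ} (hZ : 2 ≤ Z) (hD : Z ^ D < 2 ^ W) (c : Prog) :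
    ∀ {σ : Mem}, c.deg ≤ D → Bdd Z σ → c.Good Z σ → c.Safe W σ := by
  induction c with
  | skip => exact fun _ _ _ => trivial
  | assign x e => exact fun hd h _ => Expr.safe_of_bdd hZ hD h hd
  | store a i j k e =>
    intro σ hd h _
    simp only [Prog.deg] at hd
    have hs := Expr.safe_of_bdd (e := .ld a i j k) hZ hD h (by omega)
    exact ⟨hs.1, hs.2.1, hs.2.2.1, Expr.safe_of_bdd hZ hD h (by omega), hs.2.2.2.1⟩
  | seq c d ihc ihd =>
    intro σ hd h hg
    simp only [Prog.deg] at hd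
    exact ⟨ihc (by omega) h hg.1, ihd (by omega) (h.run c hg.1) hg.2⟩
  | ite e c d ihc ihd =>
    intro σ hd h hg
    simp only [Prog.deg] at hd
    refine ⟨Expr.safe_of_bdd hZ hD h (by omega), ?_⟩
    simp only [Prog.Good] at hg
    split_ifs at hg ⊢
    exacts [ihc (by omega) h hg, ihd (by omega) h hg]
  | loop x e c ih =>
    intro σ hd h hg
    simp only [Prog.deg] at hd
    refine ⟨Expr.safe_of_bdd hZ hD h (by omega), fun k hk => ih (by omega) ?_ (hg.2 k hk)⟩
    refine Bdd.set ?_ x (by have := hg.1; omega)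
    have : ∀ n ≤ e.eval σ, Bdd Z (iter x c.run σ n) := by
      intro n
      induction n with
      | zero => exact fun _ => h
      | succ n ihn =>
        exact fun hn => ((ihn (by omega)).set x (by have := hg.1; omega)).run c (hg.2 n (by omega))
    exact this k hk.le

/-! ### What a program leaves alone -/

/-- Does the program write to the variable? -/
def Prog.writes : Prog → Var → Bool
  | skip, _ => false
  | assign x _, y => decide (y = x)
  | store .., _ => false
  | seq c d, y => c.writes y || d.writes y
  | ite _ c d, y => c.writes y || d.writes y
  | .loop x _ c, y => decide (y = x) || c.writes y

/-- Does the program write to the array? -/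
def Prog.stores : Prog → Arr → Bool
  | skip, _ => false
  | assign .., _ => false
  | store a .., b => decide (b = a)
  | seq c d, b => c.stores b || d.stores b
  | ite _ c d, b => c.stores b || d.stores b
  | .loop _ _ c, b => c.stores b

/-- The contents agree except where the program writes. -/
structure Same (c : Prog) (σ σ' : Mem) : Prop where
  v : ∀ y, c.writes y = false → σ'.v y = σ.v y
  m : ∀ b, c.stores b = false → σ'.m b = σ.m b

theorem same_iter {x : Var} {e : Expr} {c : Prog} (ih : ∀ σ, Same c σ (c.run σ)) (σ : Mem) (n : ℕ) :
    Same (.loop x e c) σ (iter x c.run σ n) := by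
  induction n with
  | zero => exact ⟨fun _ _ => rfl, fun _ _ => rfl⟩
  | succ n ihn =>
    refine ⟨fun y hy => ?_, fun b hb => ?_⟩
    · have hy' := hy
      simp only [Prog.writes, Bool.or_eq_false_iff, decide_eq_false_iff_not] at hy'
      rw [iter, (ih _).v y hy'.2, Mem.set_v, if_neg hy'.1, ihn.v y hy]
    · rw [iter, (ih _).m b hb, Mem.set_m, ihn.m b hb]

theorem same_run (c : Prog) : ∀ σ, Same c σ (c.run σ) := by
  induction c with
  | skip => exact fun σ => ⟨fun _ _ => rfl, fun _ _ => rfl⟩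
  | assign x e =>
    refine fun σ => ⟨fun y hy => ?_, fun _ _ => rfl⟩
    simp only [Prog.writes, decide_eq_false_iff_not] at hy
    simp [Prog.run, hy]
  | store a i j k e =>
    refine fun σ => ⟨fun _ _ => rfl, fun b hb => ?_⟩
    simp only [Prog.stores, decide_eq_false_iff_not] at hb
    funext i' j' k'
    simp [Prog.run, hb]
  | seq c d ihc ihd =>
    refine fun σ => ⟨fun y hy => ?_, fun b hb => ?_⟩
    · simp only [Prog.writes, Bool.or_eq_false_iff] at hy
      rw [Prog.run, (ihd _).v y hy.2, (ihc _).v y hy.1]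
    · simp only [Prog.stores, Bool.or_eq_false_iff] at hb
      rw [Prog.run, (ihd _).m b hb.2, (ihc _).m b hb.1]
  | ite e c d ihc ihd =>
    refine fun σ => ⟨fun y hy => ?_, fun b hb => ?_⟩
    · simp only [Prog.writes, Bool.or_eq_false_iff] at hy
      rw [Prog.run]; split_ifs
      exacts [(ihc σ).v y hy.1, (ihd σ).v y hy.2]
    · simp only [Prog.stores, Bool.or_eq_false_iff] at hb
      rw [Prog.run]; split_ifs
      exacts [(ihc σ).m b hb.1, (ihd σ).m b hb.2]
  | loop x e c ih => exact fun σ => same_iter ih σ _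

/-! ### Rules for bounds, running time and effect -/

/-- Started with numbers up to `Z`, the program writes numbers up to `Z` only, its running time
is at most `T`, and `Q` holds at the end. -/
def Ok (Z : ℕ) (c : Prog) (σ : Mem) (T : ℕ) (Q : Mem → Prop) : Prop :=
  Bdd Z σ → c.Good Z σ ∧ c.cost σ ≤ T ∧ Q (c.run σ)

theorem Ok.mono {Z : ℕ} {c : Prog} {σ : Mem} {T T' : ℕ} {Q Q' : Mem → Prop} (h : Ok Z c σ T Q)
    (hT : T ≤ T') (hQ : ∀ σ', Same c σ σ' → Bdd Z σ' → Q σ' → Q' σ') : Ok Z c σ T' Q' := fun hb =>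
  have ⟨h1, h2, h3⟩ := h hb
  ⟨h1, h2.trans hT, hQ _ (same_run c σ) (hb.run c h1) h3⟩

theorem Ok.of_bdd {Z : ℕ} {c : Prog} {σ : Mem} {T : ℕ} {Q : Mem → Prop}
    (h : Bdd Z σ → Ok Z c σ T Q) : Ok Z c σ T Q := fun hb => h hb hb

theorem Ok.skip {Z : ℕ} {σ : Mem} {T : ℕ} {Q : Mem → Prop} (hT : 1 ≤ T) (hQ : Q σ) :
    Ok Z .skip σ T Q := fun _ => ⟨trivial, hT, hQ⟩

theorem Ok.assign {Z : ℕ} {x : Var} {e : Expr} {σ : Mem} {T : ℕ} {Q : Mem → Prop}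
    (hT : e.cost + 2 ≤ T) (he : e.eval σ ≤ Z) (hQ : Q (σ.set x (e.eval σ))) :
    Ok Z (.assign x e) σ T Q := fun _ => ⟨he, hT, hQ⟩

theorem Ok.store {Z : ℕ} {a : Arr} {i j k e : Expr} {σ : Mem} {T : ℕ} {Q : Mem → Prop}
    (hT : i.cost + j.cost + k.cost + e.cost + 17 ≤ T) (he : e.eval σ ≤ Z)
    (hQ : Q (σ.put a (i.eval σ) (j.eval σ) (k.eval σ) (e.eval σ))) :
    Ok Z (.store a i j k e) σ T Q := fun _ => ⟨he, hT, hQ⟩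

theorem Ok.seq {Z : ℕ} {c d : Prog} {σ : Mem} {T T₁ T₂ : ℕ} {R Q : Mem → Prop}
    (h₁ : Ok Z c σ T₁ R)
    (h₂ : ∀ σ', Same c σ σ' → Bdd Z σ' → R σ' → Ok Z d σ' T₂ Q) (hT : T₁ + T₂ + 1 ≤ T) :
    Ok Z (c ;; d) σ T Q := fun hb => by
  obtain ⟨g1, t1, q1⟩ := h₁ hb
  obtain ⟨g2, t2, q2⟩ := h₂ _ (same_run c σ) (hb.run c g1) q1 (hb.run c g1)
  exact ⟨⟨g1, g2⟩, by simp only [Prog.cost]; omega, q2⟩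

theorem Ok.assign_seq {Z : ℕ} {x : Var} {e : Expr} {d : Prog} {σ : Mem} {T T₂ : ℕ} {Q : Mem → Prop}
    (he : e.eval σ ≤ Z) (h : Ok Z d (σ.set x (e.eval σ)) T₂ Q) (hT : e.cost + 3 + T₂ ≤ T) :
    Ok Z (.assign x e ;; d) σ T Q :=
  Ok.seq (R := fun σ' => σ' = σ.set x (e.eval σ)) (Ok.assign le_rfl he rfl)
    (fun _ _ _ hs => hs ▸ h) (by omega)

theorem Ok.store_seq {Z : ℕ} {a : Arr} {i j k e : Expr} {d : Prog} {σ : Mem} {T T₂ : ℕ}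
    {Q : Mem → Prop} (he : e.eval σ ≤ Z)
    (h : Ok Z d (σ.put a (i.eval σ) (j.eval σ) (k.eval σ) (e.eval σ)) T₂ Q)
    (hT : i.cost + j.cost + k.cost + e.cost + 18 + T₂ ≤ T) : Ok Z (.store a i j k e ;; d) σ T Q :=
  Ok.seq (R := fun σ' => σ' = σ.put a (i.eval σ) (j.eval σ) (k.eval σ) (e.eval σ))
    (Ok.store le_rfl he rfl) (fun _ _ _ hs => hs ▸ h) (by omega)

theorem Ok.ite {Z : ℕ} {e : Expr} {c d : Prog} {σ : Mem} {T T₁ : ℕ} {Q : Mem → Prop}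
    (hc : e.eval σ ≠ 0 → Ok Z c σ T₁ Q) (hd : e.eval σ = 0 → Ok Z d σ T₁ Q)
    (hT : e.cost + 2 + T₁ ≤ T) : Ok Z (.ite e c d) σ T Q := fun hb => by
  by_cases he : e.eval σ = 0
  · obtain ⟨g, t, q⟩ := hd he hb
    simp only [Prog.Good, Prog.cost, Prog.run, he, ne_eq, not_true_eq_false, if_false]
    exact ⟨g, by omega, q⟩
  · obtain ⟨g, t, q⟩ := hc he hb
    simp only [Prog.Good, Prog.cost, Prog.run, he, ne_eq, not_false_eq_true, if_true]
    exact ⟨g, by omega, q⟩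

/-- The invariant speaks of the memory before the variable receives the value `k`; the 9 extra steps
in each round are loop control. Bounds `τ` that vary with the round are needed for the tree search,
where only the total is small. -/
theorem Ok.loop {Z : ℕ} {x : Var} {e : Expr} {c : Prog} {σ : Mem} {n T : ℕ} {Q : Mem → Prop}
    (τ : ℕ → ℕ) (I : ℕ → Mem → Prop) (hn : e.eval σ = n) (hZ : n ≤ Z) (h0 : I 0 σ)
    (hs : ∀ k < n, ∀ σ', Same (.loop x e c) σ σ' → I k σ' → Ok Z c (σ'.set x k) (τ k) (I (k + 1)))
    (hT : e.cost + 6 + ∑ k ∈ Finset.range n, (τ k + 9) ≤ T)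
    (hQ : ∀ σ', Same (.loop x e c) σ σ' → I n σ' → Q σ') : Ok Z (.loop x e c) σ T Q := fun hb => by
  have key : ∀ k ≤ n, Bdd Z (iter x c.run σ k) ∧ I k (iter x c.run σ k) := by
    intro k
    induction k with
    | zero => exact fun _ => ⟨hb, h0⟩
    | succ k ih =>
      intro hk
      obtain ⟨b, i⟩ := ih (by omega)
      have b' := b.set x (n := k) (by omega)
      obtain ⟨g, -, q⟩ := hs k (by omega) _ (same_iter (same_run c) σ k) i b'
      exact ⟨b'.run c g, q⟩
  have step : ∀ k < n, c.Good Z ((iter x c.run σ k).set x k) ∧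
      c.cost ((iter x c.run σ k).set x k) ≤ τ k := fun k hk => by
    obtain ⟨b, i⟩ := key k hk.le
    obtain ⟨g, t, -⟩ := hs k hk _ (same_iter (same_run c) σ k) i (b.set x (by omega))
    exact ⟨g, t⟩
  refine ⟨⟨by omega, fun k hk => (step k (by omega)).1⟩, ?_, ?_⟩
  · refine le_trans ?_ hT
    simp only [Prog.cost, iterCost, hn]
    gcongr with k hk
    exact (step k (Finset.mem_range.1 hk)).2
  · have := key n le_rfl
    simp only [Prog.run, hn]
    exact hQ _ (same_iter (same_run c) σ n) this.2

/-- The rule for loops whose rounds have a common time bound. -/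
theorem Ok.loop' {Z : ℕ} {x : Var} {e : Expr} {c : Prog} {σ : Mem} {n T : ℕ} {Q : Mem → Prop}
    (τ : ℕ) (I : ℕ → Mem → Prop) (hn : e.eval σ = n) (hZ : n ≤ Z) (h0 : I 0 σ)
    (hs : ∀ k < n, ∀ σ', Same (.loop x e c) σ σ' → I k σ' → Ok Z c (σ'.set x k) τ (I (k + 1)))
    (hT : e.cost + 6 + n * (τ + 9) ≤ T)
    (hQ : ∀ σ', Same (.loop x e c) σ σ' → I n σ' → Q σ') : Ok Z (.loop x e c) σ T Q :=
  Ok.loop (fun _ => τ) I hn hZ h0 hs (by simpa using hT) hQ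

/-! ## Roots of unity modulo the square of a prime -/

/-- The `(p - 1)`-st roots of unity modulo `p ^ 2`. -/
def root (p a : ℕ) : ZMod (p * p) := ((a + 1 : ℕ) : ZMod (p * p)) ^ p

/-- If `p` divides `a - b`, then `p ^ 2` divides `a ^ p - b ^ p`. Hence the `p`-th power is a
well-defined map from residues modulo `p` to residues modulo `p ^ 2`. -/
theorem pow_eq_pow_of_modEq {p a b : ℕ} (h : (a : ZMod p) = b) :
    (a : ZMod (p * p)) ^ p = (b : ZMod (p * p)) ^ p := by
  have h1 : (p : ℤ) ∣ (a : ℤ) - b := by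
    rw [← ZMod.intCast_zmod_eq_zero_iff_dvd _ p] 
    push_cast
    rw [h, sub_self]
  have h2 := dvd_sub_pow_of_dvd_sub h1 1
  rw [pow_one, one_add_one_eq_two, sq] at h2
  have h3 : (((a : ℤ) ^ p - (b : ℤ) ^ p : ℤ) : ZMod (p * p)) = 0 := by
    rw [ZMod.intCast_zmod_eq_zero_iff_dvd]
    exact_mod_cast h2
  push_cast at h3
  exact sub_eq_zero.1 h3

/-- A residue modulo `p ^ 2` is invertible as soon as `p` does not divide it. This replaces the
absence of zero divisors in the orthogonality relations. -/
theorem isUnit_of_cast_ne_zero {p : ℕ} (hp : p.Prime) {x : ZMod (p * p)}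
    (h : ZMod.castHom (dvd_mul_right p p) (ZMod p) x ≠ 0) : IsUnit x := by
  have : NeZero (p * p) := ⟨(Nat.mul_pos hp.pos hp.pos).ne'⟩
  rw [← ZMod.natCast_zmod_val x, ZMod.isUnit_iff_coprime, Nat.coprime_mul_iff_right]
  have : Nat.Coprime x.val p := by
    rw [Nat.coprime_comm, hp.coprime_iff_not_dvd]
    intro hd
    apply h
    rw [← ZMod.natCast_zmod_val x, map_natCast]
    exact (ZMod.natCast_eq_zero_iff _ _).2 hd
  exact ⟨this, this⟩

/-- Orthogonality of characters. The `p`-th power lifts the group of units modulo `p`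
homomorphically to units modulo `p ^ 2`. Translation by a generator `g` multiplies the sum by `θ g ^
e`; if `p - 1` does not divide `e`, this factor differs from 1 even modulo `p`, so its difference
from 1 is a unit and the sum vanishes. -/
theorem sum_root_pow {p : ℕ} (hp : p.Prime) (e : ℕ) :
    ∑ a ∈ Finset.range (p - 1), root p a ^ e = if p - 1 ∣ e then ((p - 1 : ℕ) : ZMod (p * p)) else 0 := by
  have : Fact p.Prime := ⟨hp⟩
  let θ : (ZMod p)ˣ →* ZMod (p * p) :=
    { toFun := fun u => ((u : ZMod p).val : ZMod (p * p)) ^ p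
      map_one' := by simp [ZMod.val_one]
      map_mul' := fun u v => by
        rw [← mul_pow, ← Nat.cast_mul]
        apply pow_eq_pow_of_modEq
        push_cast
        simp }
  have hsum : ∑ a ∈ Finset.range (p - 1), root p a ^ e = ∑ u : (ZMod p)ˣ, θ u ^ e := by
    refine Finset.sum_bij' (i := fun a ha => ZMod.unitOfCoprime (a + 1) ?_)
      (j := fun u _ => (u : ZMod p).val - 1) ?_ ?_ ?_ ?_ ?_
    · rw [Nat.coprime_comm]
      refine (Nat.Prime.coprime_iff_not_dvd hp).2 fun hd => ?_
      have := Nat.le_of_dvd (by omega) hd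
      have := Finset.mem_range.1 ha
      omega
    · simp
    · intro u _
      have := (u : ZMod p).val_lt
      have h1 : (u : ZMod p).val ≠ 0 := by simp
      simp only [Finset.mem_range]; omega
    · intro a ha
      have := Finset.mem_range.1 ha
      simp only [ZMod.coe_unitOfCoprime]
      rw [ZMod.val_natCast, Nat.mod_eq_of_lt (by omega)]
      omega
    · intro u _
      have h1 : (u : ZMod p).val ≠ 0 := by simp
      ext
      simp only [ZMod.coe_unitOfCoprime]
      rw [Nat.sub_add_cancel (by omega)]
      simp
    · intro a ha
      have := Finset.mem_range.1 ha
      simp only [θ, MonoidHom.coe_mk, OneHom.coe_mk, ZMod.coe_unitOfCoprime, root]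
      rw [ZMod.val_natCast, Nat.mod_eq_of_lt (by omega)]
  rw [hsum]
  have hcard : Fintype.card (ZMod p)ˣ = p - 1 := ZMod.card_units p
  split_ifs with he
  · rw [Finset.sum_congr rfl fun u _ => ?_, Finset.sum_const, Finset.card_univ, hcard, nsmul_one]
    obtain ⟨k, rfl⟩ := he
    rw [← map_pow, ← hcard, pow_mul, pow_card_eq_one, one_pow, map_one]
  · obtain ⟨g, hg⟩ := IsCyclic.exists_generator (α := (ZMod p)ˣ)
    have h1 : θ g ^ e * ∑ u : (ZMod p)ˣ, θ u ^ e = ∑ u : (ZMod p)ˣ, θ u ^ e := by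
      rw [Finset.mul_sum]
      rw [← Equiv.sum_comp (Equiv.mulLeft g) (fun u => θ u ^ e)]
      refine Finset.sum_congr rfl fun u _ => ?_
      simp [map_mul, mul_pow]
    have h2 : IsUnit (θ g ^ e - 1) := by
      apply isUnit_of_cast_ne_zero hp
      intro h
      rw [map_sub, map_pow, map_one, sub_eq_zero] at h
      -- By Fermat's little theorem, reduction modulo `p` undoes the lift.
      have h3 : ZMod.castHom (dvd_mul_right p p) (ZMod p) (θ g) = (g : ZMod p) := by
        simp [θ, map_pow]
      rw [h3] at h
      have h4 : g ^ e = 1 := by ext; simpa using h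
      have h5 := orderOf_dvd_of_pow_eq_one h4
      rw [orderOf_eq_card_of_forall_mem_zpowers hg, Nat.card_eq_fintype_card, hcard] at h5
      exact he h5
    have h3 : (θ g ^ e - 1) * ∑ u : (ZMod p)ˣ, θ u ^ e = 0 := by
      rw [sub_mul, h1, one_mul, sub_self]
    exact (h2.mul_right_eq_zero).1 h3

/-! ## Counting differences by evaluation at roots of unity -/

/-- Evaluation of the part of a set in a block of length `q` at a root of unity. -/
def evalF (p q : ℕ) (A : Finset ℕ) (u a : ℕ) : ZMod (p * p) :=
  ∑ x ∈ A with x / q = u, root p a ^ (x % q)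

/-- Evaluation of the part of a set in a block of length `q` at the inverse of a root of unity. -/
def evalG (p q : ℕ) (A : Finset ℕ) (u a : ℕ) : ZMod (p * p) :=
  ∑ x ∈ A with x / q = u, root p a ^ (p - 1 - x % q)

/-- Expanding the products, orthogonality keeps the pairs `(x, y)` whose total exponent is a
multiple of `p - 1`. For `x` in block `u` the number `x + w` lies in block `u + w / q` if the
remainders add up without a carry, and in the next block otherwise; the two summands treat the two
cases. As `2 * q < p`, the exponents stay in a window that contains a single multiple of `p - 1`, so
nothing wraps around. -/
theorem sum_eval_mul {p q : ℕ} (hp : p.Prime) (hq : 0 < q) (hpq : 2 * q < p) (A B : Finset ℕ)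
    (u w : ℕ) :
    ∑ a ∈ Finset.range (p - 1),
      (evalF p q A u a * evalG p q B (u + w / q) a * root p a ^ (w % q) +
        evalF p q A u a * evalG p q B (u + w / q + 1) a * root p a ^ (w % q + (p - 1) - q)) =
      ((p - 1 : ℕ) : ZMod (p * p)) * ((A.filter fun x => x / q = u ∧ x + w ∈ B).card : ZMod (p * p)) := by
  have key : ∀ u' e, ∑ a ∈ Finset.range (p - 1),
      evalF p q A u a * evalG p q B u' a * root p a ^ e =
      ∑ x ∈ A with x / q = u, ∑ y ∈ B with y / q = u',
        if p - 1 ∣ x % q + (p - 1 - y % q) + e then ((p - 1 : ℕ) : ZMod (p * p)) else 0 := by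
    intro u' e
    simp only [evalF, evalG, Finset.sum_mul, Finset.mul_sum]
    rw [Finset.sum_comm]
    conv_rhs => rw [Finset.sum_comm]
    refine Finset.sum_congr rfl fun y _ => ?_
    rw [Finset.sum_comm]
    refine Finset.sum_congr rfl fun x _ => ?_
    rw [← sum_root_pow hp]
    refine Finset.sum_congr rfl fun a _ => ?_
    rw [← pow_add, ← pow_add]
  have hw := Nat.mod_lt w hq
  have hdvd : ∀ n : ℕ, 0 < n → n < 2 * (p - 1) → (p - 1 ∣ n ↔ n = p - 1) := by
    intro n h0 h1
    constructor
    · rintro ⟨k, hk⟩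
      have hk1 : k < 2 := by
        by_contra h
        have : 2 * (p - 1) ≤ k * (p - 1) := Nat.mul_le_mul_right _ (by omega)
        rw [hk, mul_comm] at h1
        omega
      interval_cases k <;> omega
    · rintro rfl; exact dvd_rfl
  -- In the case of a carry the exponent has to be lowered by `q`. An additional `p - 1` keeps it a
  -- natural number and moves the relevant multiple to `2 * (p - 1)`.
  have hdvd' : ∀ n : ℕ, p - 1 < n → n < 3 * (p - 1) → (p - 1 ∣ n ↔ n = 2 * (p - 1)) := by
    intro n h0 h1
    obtain ⟨m, rfl⟩ := Nat.exists_eq_add_of_le h0.le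
    rw [Nat.dvd_add_right dvd_rfl, hdvd _ (by omega) (by omega)]
    omega
  rw [Finset.sum_add_distrib, key, key, ← Finset.sum_add_distrib, Finset.card_filter,
    Nat.cast_sum, Finset.mul_sum]
  simp only [ite_and]
  rw [Finset.sum_filter]
  refine Finset.sum_congr rfl fun x _ => ?_
  by_cases hx : x / q = u
  swap
  · simp [hx]
  rw [if_pos hx, if_pos hx]
  have hxm := Nat.mod_lt x hq
  have hxw : (x + w) / q = u + w / q + (x % q + w % q) / q ∧ (x + w) % q = (x % q + w % q) % q := by
    have h1 : x + w = q * (u + w / q) + (x % q + w % q) := by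
      have h1 := Nat.div_add_mod x q
      have h2 := Nat.div_add_mod w q
      rw [hx] at h1
      nlinarith
    constructor
    · rw [h1, Nat.mul_add_div hq]
    · rw [h1, Nat.mul_add_mod]
  have h1 : ∀ y, y / q = u + w / q → (p - 1 ∣ x % q + (p - 1 - y % q) + w % q ↔ y = x + w) := by
    intro y hy
    have hym := Nat.mod_lt y hq
    rw [hdvd _ (by omega) (by omega)]
    have h2 := Nat.div_add_mod y q
    have h3 := Nat.div_add_mod (x + w) q
    constructor
    · intro h
      have h4 : (x % q + w % q) / q = 0 := Nat.div_eq_of_lt (by omega)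
      have h5 : (x % q + w % q) % q = x % q + w % q := Nat.mod_eq_of_lt (by omega)
      rw [hxw.1, hxw.2, h4, h5, add_zero, ← hy] at h3
      omega
    · rintro rfl
      have h4 : (x % q + w % q) / q = 0 := by omega
      rw [hxw.2, Nat.mod_eq_of_lt ((Nat.div_eq_zero_iff_lt hq).1 h4)]
      omega
  have h2 : ∀ y, y / q = u + w / q + 1 →
      (p - 1 ∣ x % q + (p - 1 - y % q) + (w % q + (p - 1) - q) ↔ y = x + w) := by
    intro y hy
    have hym := Nat.mod_lt y hq
    rw [hdvd' _ (by omega) (by omega)]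
    have h2 := Nat.div_add_mod y q
    have h3 := Nat.div_add_mod (x + w) q
    have h6 : ∀ z, q ≤ z → z < 2 * q → z / q = 1 ∧ z % q = z - q := by
      intro z hz hz'
      constructor
      · exact Nat.div_eq_of_lt_le (by omega) (by omega)
      · rw [Nat.mod_eq_sub_mod hz, Nat.mod_eq_of_lt (by omega)]
    constructor
    · intro h
      obtain ⟨h4, h5⟩ := h6 (x % q + w % q) (by omega) (by omega)
      rw [hxw.1, hxw.2, h4, h5, ← hy] at h3
      omega
    · rintro rfl
      have h4 : q ≤ x % q + w % q := by
        by_contra h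
        have : (x % q + w % q) / q = 0 := Nat.div_eq_of_lt (by omega)
        omega
      rw [hxw.2, (h6 _ h4 (by omega)).2]
      omega
  have h3 : ∀ u' (e : ℕ), (∀ y, y / q = u' → (p - 1 ∣ x % q + (p - 1 - y % q) + e ↔ y = x + w)) →
      (∑ y ∈ B with y / q = u', if p - 1 ∣ x % q + (p - 1 - y % q) + e then
        ((p - 1 : ℕ) : ZMod (p * p)) else 0) =
      if x + w ∈ B ∧ (x + w) / q = u' then ((p - 1 : ℕ) : ZMod (p * p)) else 0 := by
    intro u' e h
    rw [Finset.sum_congr rfl fun y hy => if_congr (h y (Finset.mem_filter.1 hy).2) rfl rfl,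
      Finset.sum_ite_eq']
    simp
  rw [h3 _ _ h1, h3 _ _ h2]
  have h4 : (x + w) / q = u + w / q ∨ (x + w) / q = u + w / q + 1 := by
    have h5 : (x % q + w % q) / q < 2 := Nat.div_lt_of_lt_mul (by omega)
    rw [hxw.1]
    generalize (x % q + w % q) / q = z at h5
    omega
  by_cases hB : x + w ∈ B
  · rcases h4 with h4 | h4 <;> simp [hB, h4]
  · simp [hB]

/-! ## Sums over the leaves of a heap-ordered tree -/

/-- The sum of `f` over the leaves below node `h` of the binary tree with the nodes
`1, …, 2 * r - 1`, where `h` has the children `2 * h` and `2 * h + 1` and the leaf `u` is the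
node `u + r`. -/
def heapSum {R : Type*} [AddCommMonoid R] (r : ℕ) (f : ℕ → R) (h : ℕ) : R :=
  if h = 0 ∨ 2 * r ≤ h then 0
  else if r ≤ h then f (h - r) else heapSum r f (2 * h) + heapSum r f (2 * h + 1)
termination_by 2 * r - h
decreasing_by all_goals omega

section
variable {R : Type*} [AddCommMonoid R] {r : ℕ}

theorem heapSum_leaf (f : ℕ → R) {h : ℕ} (h0 : 0 < h) (h1 : r ≤ h) (h2 : h < 2 * r) :
    heapSum r f h = f (h - r) := by
  rw [heapSum, if_neg (by omega), if_pos h1]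

theorem heapSum_node (f : ℕ → R) {h : ℕ} (h0 : 0 < h) (h1 : h < r) :
    heapSum r f h = heapSum r f (2 * h) + heapSum r f (2 * h + 1) := by
  rw [heapSum, if_neg (by omega), if_neg (by omega)]

theorem heapSum_out (f : ℕ → R) {h : ℕ} (h1 : 2 * r ≤ h) : heapSum r f h = 0 := by
  rw [heapSum, if_pos (Or.inr h1)]

theorem heapSum_zero (f : ℕ → R) : heapSum r f 0 = 0 := by
  rw [heapSum, if_pos (Or.inl rfl)]

/-- The induction over the tree, done once: any relation compatible with zero and addition passes
from leaves to nodes. Congruence, additivity and compatibility with homomorphisms are obtained by a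
choice of `Q`. -/
theorem heapSum_rel {R' : Type*} [AddCommMonoid R'] (Q : R → R' → Prop) (h0 : Q 0 0)
    (ha : ∀ x x' y y', Q x x' → Q y y' → Q (x + y) (x' + y')) {f : ℕ → R} {g : ℕ → R'}
    (hf : ∀ u < r, Q (f u) (g u)) (h : ℕ) : Q (heapSum r f h) (heapSum r g h) := by
  induction hn : 2 * r - h using Nat.strong_induction_on generalizing h with
  | _ n ih =>
    by_cases h1 : h = 0 ∨ 2 * r ≤ h
    · rcases h1 with rfl | h1
      · simpa only [heapSum_zero] using h0
      · simpa only [heapSum_out _ h1] using h0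
    · by_cases h2 : r ≤ h
      · rw [heapSum_leaf _ (by omega) h2 (by omega), heapSum_leaf _ (by omega) h2 (by omega)]
        exact hf _ (by omega)
      · have h3 : 0 < h := by omega
        have h4 : h < r := by omega
        rw [heapSum_node _ h3 h4, heapSum_node _ h3 h4]
        exact ha _ _ _ _ (ih _ (by omega) _ rfl) (ih _ (by omega) _ rfl)

theorem heapSum_congr {f g : ℕ → R} (hf : ∀ u < r, f u = g u) (h : ℕ) :
    heapSum r f h = heapSum r g h :=
  heapSum_rel (fun x y => x = y) rfl (by rintro _ _ _ _ rfl rfl; rfl) hf h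

theorem map_heapSum {R' : Type*} [AddCommMonoid R'] (φ : R →+ R') (f : ℕ → R) (h : ℕ) :
    φ (heapSum r f h) = heapSum r (fun u => φ (f u)) h :=
  heapSum_rel (fun x y => φ x = y) (map_zero φ) (by rintro _ _ _ _ rfl rfl; exact map_add φ _ _)
    (fun _ _ => rfl) h

theorem heapSum_add (f g : ℕ → R) (h : ℕ) :
    heapSum r (fun u => f u + g u) h = heapSum r f h + heapSum r g h := by
  have := heapSum_rel (r := r) (fun (x : R × R) y => x.1 + x.2 = y) (by simp)
    (f := fun u => (f u, g u)) (g := fun u => f u + g u)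
    (by rintro ⟨a, b⟩ _ ⟨c, d⟩ _ rfl rfl; exact add_add_add_comm _ _ _ _) (fun _ _ => rfl) h
  rw [← this]
  congr 1
  · exact map_heapSum (AddMonoidHom.fst R R) (fun u => (f u, g u)) h
  · exact map_heapSum (AddMonoidHom.snd R R) (fun u => (f u, g u)) h

theorem heapSum_sum {ι : Type*} (s : Finset ι) (f : ι → ℕ → R) (h : ℕ) :
    heapSum r (fun u => ∑ i ∈ s, f i u) h = ∑ i ∈ s, heapSum r (f i) h := by
  classical
  induction s using Finset.induction_on with
  | empty =>
    simp only [Finset.sum_empty]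
    exact heapSum_rel (fun (x : R) (y : R) => x = 0) rfl (by rintro _ _ _ _ rfl rfl; simp)
      (g := fun _ => 0) (fun _ _ => rfl) h
  | insert i s hi ih => simp only [Finset.sum_insert hi, heapSum_add, ih]

/-- The nodes from `m` to `2 * m - 1` form a cut through the tree: going from `m` to `m + 1`
replaces node `m` by its children `2 * m` and `2 * m + 1`. The number of leaves need not be a power
of two. -/
theorem sum_heapSum_level (f : ℕ → R) {m : ℕ} (h1 : 1 ≤ m) (hm : m ≤ r) :
    ∑ h ∈ Finset.Ico m (2 * m), heapSum r f h = heapSum r f 1 := by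
  induction m, h1 using Nat.le_induction with
  | base => simp
  | succ m h1 ih =>
    rw [← ih (by omega), Finset.sum_eq_sum_Ico_succ_bot (by omega : m < 2 * m),
      show 2 * (m + 1) = 2 * m + 1 + 1 by ring, Finset.sum_Ico_succ_top (by omega),
      Finset.sum_Ico_succ_top (by omega), heapSum_node f (by omega) (by omega : m < r)]
    abel

theorem heapSum_one (f : ℕ → R) (hr : 0 < r) : heapSum r f 1 = ∑ u ∈ Finset.range r, f u := by
  rw [← sum_heapSum_level f hr le_rfl, Finset.sum_Ico_eq_sum_range, show 2 * r - r = r by omega]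
  refine Finset.sum_congr rfl fun u hu => ?_
  have := Finset.mem_range.1 hu
  rw [heapSum_leaf f (by omega) (by omega) (by omega), Nat.add_sub_cancel_left]

end

/-- All nodes are covered by the dyadic levels that start at some `2 ^ j ≤ r`, together with the
level of the leaves. Each of these is a cut and contributes the value at the root. -/
theorem sum_heapSum_le {r : ℕ} (f : ℕ → ℕ) (hr : 0 < r) :
    ∑ h ∈ Finset.Ico 1 (2 * r), heapSum r f h ≤ (Nat.log 2 r + 2) * heapSum r f 1 := by
  have h1 : ∀ j, 2 ^ j ≤ r →
      ∑ h ∈ Finset.Ico 1 (2 ^ (j + 1)), heapSum r f h = (j + 1) * heapSum r f 1 := by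
    intro j
    induction j with
    | zero => intro _; simp
    | succ j ih =>
      intro hj
      have hj' : 2 ^ j ≤ r := (Nat.pow_le_pow_right (by omega) (Nat.le_succ j)).trans hj
      rw [← Finset.sum_Ico_consecutive _ (Nat.one_le_two_pow) (Nat.pow_le_pow_right (by omega)
        (Nat.le_succ (j + 1))), ih hj', pow_succ 2 (j + 1), mul_comm _ 2,
        sum_heapSum_level f Nat.one_le_two_pow hj]
      ring
  have h2 := h1 (Nat.log 2 r) (Nat.pow_log_le_self 2 hr.ne')
  have h3 : Finset.Ico 1 (2 * r) ⊆ Finset.Ico 1 (2 ^ (Nat.log 2 r + 1)) ∪ Finset.Ico r (2 * r) := by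
    intro h hh
    have := Nat.lt_pow_succ_log_self (by omega : 1 < 2) r
    simp only [Finset.mem_union, Finset.mem_Ico] at hh ⊢
    omega
  calc _ ≤ _ := Finset.sum_le_sum_of_subset h3
    _ ≤ _ := (Nat.le_add_right _ _).trans (Finset.sum_union_inter).le
    _ = (Nat.log 2 r + 2) * heapSum r f 1 := by
      rw [h2, sum_heapSum_level f hr le_rfl]; ring

theorem heapSum_child_eq_zero {r : ℕ} {f : ℕ → ℕ} {h : ℕ} (h1 : 1 < h) (h2 : h < 2 * r)
    (hz : heapSum r f (h / 2) = 0) : heapSum r f h = 0 := by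
  rw [heapSum_node f (by omega) (by omega)] at hz
  rcases Nat.mod_two_eq_zero_or_one h with h3 | h3
  · rw [show h = 2 * (h / 2) by omega]; omega
  · rw [show h = 2 * (h / 2) + 1 by omega]; omega

/-! ## The algorithm

Let `S` be the set of the sums up to `t` that are attained.  It is kept in the array `S`, together
with a snapshot `N` of it and the list `P` of the elements that are new since then.  The range of
the sums is cut into `r` blocks of length `q = r ^ 2`, where `r` is about `t ^ (1 / 3)`.  The blocks
are the leaves of a heap-ordered tree.  `E` holds the powers of the `p - 1` roots of unity modulo
`M = p ^ 2`, `F` and `G` hold the evaluations of the blocks of the snapshot and of the blocks of its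
complement, and `C` holds the sums of the products over the leaves below each node of the tree,
for each offset of the blocks.

An insertion of `w` looks for the `x` in `S` with `x + w ≤ t` and `x + w` not in `S`.  If there is
none, then this remains so forever and `w` is marked in `K`.  Otherwise they are found by descending
in the tree: their number below a node is computed from `C` and from the corrections `D` on account
of the new elements, and `L` marks the nodes where it is not zero. -/

section
open Var Arr DynSubsetSum.Expr

/-- Find `r`, `q` and the prime number `p`. -/
def paramProg : Prog :=
  .assign t (v io) ;; .assign r (c 0) ;;
  .loop k (v t + c 1) (.ite ((v t).lt (v r * v r * v r)) .skip (.assign r (v r + c 1))) ;;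
  .assign q (v r * v r) ;; .assign p1 (c 0) ;;
  .loop k (v q + v q + c 1)
    (.assign y (v q + v q + v k) ;; .assign f (c 0) ;;
      .loop e (v y - c 1) (.ite ((v y + c 1) % (v e + c 2)) .skip (.assign f (c 1))) ;;
      .ite (v f + v p1) .skip (.assign p1 (v y))) ;;
  .assign p (v p1 + c 1) ;; .assign M (v p * v p)

/-- Compute the powers of the roots of unity. -/
def powerProg : Prog :=
  .loop a (v p1)
    (.assign z (c 1) ;; .loop k (v p) (.assign z (v z * (v a + c 1) % v M)) ;;
      .assign y (c 1) ;;
      .loop k (v p) (.store E (v a) (v k) (c 0) (v y) ;; .assign y (v y * v z % v M)))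

/-- Evaluate the complement of the empty set. -/
def complProg : Prog :=
  .loop x (v t + c 1) (.loop a (v p1)
    (.store G (v x / v q) (v a) (c 0)
      ((ld G (v x / v q) (v a) (c 0) + ld E (v a) (v p1 - v x % v q) (c 0)) % v M)))

/-- The preprocessing. -/
def initProg : Prog :=
  paramProg ;; powerProg ;; complProg ;; .store S (c 0) (c 0) (c 0) (c 1) ;;
  .store L (c 0) (c 0) (c 0) (c 1) ;; .assign np (c 1)

/-- Compute the corrections for the leaves. -/
def corrProg : Prog :=
  .loop h (v r + v r) (.store D (v h) (c 0) (c 0) (c 0)) ;;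
  .loop k (v np)
    (.assign y (ld P (v k) (c 0) (c 0)) ;;
      .ite ((v y + v w).lt (v t + c 1) * (c 1 - ld S (v y + v w) (c 0) (c 0)))
        (.store D (v r + v y / v q) (c 0) (c 0)
          ((ld D (v r + v y / v q) (c 0) (c 0) + v p1) % v M)) .skip ;;
      .ite ((v w).lt (v y + c 1) * ld N (v y - v w) (c 0) (c 0))
        (.store D (v r + (v y - v w) / v q) (c 0) (c 0)
          ((ld D (v r + (v y - v w) / v q) (c 0) (c 0) + (v M - v p1)) % v M)) .skip)

/-- Compute the corrections for the inner nodes. -/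
def heapProg : Prog :=
  .loop k (v r - c 1)
    (.assign h (v r - c 1 - v k) ;;
      .store D (v h) (c 0) (c 0)
        ((ld D (v h + v h) (c 0) (c 0) + ld D (v h + v h + c 1) (c 0) (c 0)) % v M))

/-- Search a block. -/
def scanProg : Prog :=
  .loop k (v q)
    (.assign x ((v h - v r) * v q + v k) ;;
      .ite (ld S (v x) (c 0) (c 0) * (v x + v w).lt (v t + c 1) *
          (c 1 - ld S (v x + v w) (c 0) (c 0)))
        (.store P (v np + v nn) (c 0) (c 0) (v x + v w) ;; .assign nn (v nn + c 1)) .skip)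

/-- Visit a node. -/
def visitProg : Prog :=
  .assign X (ld D (v h) (c 0) (c 0)) ;;
  .loop a (v p1)
    (.assign X ((v X + (ld C (v h) (v d) (v a) * ld E (v a) (v dl) (c 0) +
      ld C (v h) (v d + c 1) (v a) * ld E (v a) (v dl + v p1 - v q) (c 0))) % v M)) ;;
  .ite (v X) (.store L (v h) (c 0) (c 0) (c 1) ;; .ite ((v h).lt (v r)) .skip scanProg) .skip

/-- Search the tree. -/
def searchProg : Prog :=
  .loop e (v r + v r - c 1)
    (.assign h (v e + c 1) ;; .store L (v h) (c 0) (c 0) (c 0) ;;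
      .ite (ld L (v h / c 2) (c 0) (c 0)) visitProg .skip)

/-- Enter the sums that have been found. -/
def commitProg : Prog :=
  .ite (v nn) .skip (.store K (v w) (c 0) (c 0) (c 1)) ;;
  .loop k (v nn) (.store S (ld P (v np + v k) (c 0) (c 0)) (c 0) (c 0) (c 1)) ;;
  .assign np (v np + v nn)

/-- Enter the new elements into the snapshot. -/
def evalProg : Prog :=
  .loop k (v np)
    (.assign y (ld P (v k) (c 0) (c 0)) ;; .store N (v y) (c 0) (c 0) (c 1) ;;
      .loop a (v p1)
        (.store F (v y / v q) (v a) (c 0)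
            ((ld F (v y / v q) (v a) (c 0) + ld E (v a) (v y % v q) (c 0)) % v M) ;;
          .store G (v y / v q) (v a) (c 0)
            ((ld G (v y / v q) (v a) (c 0) + (v M - ld E (v a) (v p1 - v y % v q) (c 0))) % v M)))

/-- Compute the sums of products. -/
def tableProg : Prog :=
  .loop k (v r + v r - c 1)
    (.assign h (v r + v r - c 1 - v k) ;;
      .loop d (v r + c 1) (.loop a (v p1)
        (.ite ((v h).lt (v r))
          (.store C (v h) (v d) (v a)
            ((ld C (v h + v h) (v d) (v a) + ld C (v h + v h + c 1) (v d) (v a)) % v M))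
          (.store C (v h) (v d) (v a)
            (ld F (v h - v r) (v a) (c 0) * ld G (v h - v r + v d) (v a) (c 0) % v M)))))

/-- Renew the snapshot. -/
def rebuildProg : Prog := evalProg ;; .assign np (c 0) ;; tableProg

/-- The insertion of an item whose weight is at most `t` and not marked. -/
def addProg : Prog :=
  .assign d (v w / v q) ;; .assign dl (v w % v q) ;; .assign nn (c 0) ;;
  corrProg ;; heapProg ;; searchProg ;; commitProg ;; .ite ((v np).lt (v q)) .skip rebuildProg

/-- The insertion of an item. -/
def insertProg : Prog :=
  .ite ((v t).lt (v io)) .skip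
    (.assign w (v io) ;; .ite (ld K (v w) (c 0) (c 0)) .skip addProg)

/-- The answer to a question. -/
def queryProg : Prog := .assign io (ld S (v io) (c 0) (c 0))

end

/-! ### The invariant -/

/-- The numbers used by the algorithm. -/
structure Dim where
  t : ℕ
  r : ℕ
  p : ℕ
  t_pos : 0 < t
  t_lt : t < r * r * r
  le_t : (r - 1) * (r - 1) * (r - 1) ≤ t
  prime : p.Prime
  lt_p : 2 * (r * r) < p
  p_le : p ≤ 4 * (r * r) + 1

namespace Dim

variable (n : Dim)

/-- The length of a block. -/
def q : ℕ := n.r * n.r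

/-- The modulus. -/
def M : ℕ := n.p * n.p

theorem r_pos : 2 ≤ n.r := by
  have h1 := n.t_pos
  have h2 := n.t_lt
  by_contra h
  have : n.r = 0 ∨ n.r = 1 := by omega
  rcases this with h | h <;> rw [h] at h2 <;> omega

theorem q_pos : 4 ≤ n.q := Nat.mul_le_mul n.r_pos n.r_pos

theorem r_le_q : n.r ≤ n.q := Nat.le_mul_self _

theorem two_r_le_q : 2 * n.r ≤ n.q := Nat.mul_le_mul_right _ n.r_pos

theorem two_q_lt : 2 * n.q < n.p := n.lt_p

theorem p_le' : n.p ≤ 4 * n.q + 1 := n.p_le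

theorem p_sq_le : n.p * 9 ≤ n.M := by
  rw [M, mul_comm]
  exact Nat.mul_le_mul_right _ (by have := n.two_q_lt; have := n.q_pos; omega)

theorem t_lt' : n.t < n.r * n.q := by have := n.t_lt; rwa [mul_assoc] at this

/-- This is why the modulus is a square: it exceeds all counts of sums, even with a factor 2 to
spare for lengths of lists. -/
theorem rq_le : 2 * (n.r * n.q) ≤ n.M := by
  have h1 := n.r_le_q
  have h2 := n.two_q_lt
  rw [M]
  nlinarith

theorem div_lt {x : ℕ} (h : x ≤ n.t) : x / n.q < n.r :=
  Nat.div_lt_of_lt_mul (by have := n.t_lt'; rw [mul_comm] at this; omega)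

end Dim

/-- The numbers used by the algorithm are in their variables. -/
structure Fits (n : Dim) (σ : Mem) : Prop where
  t : σ.v .t = n.t
  r : σ.v .r = n.r
  q : σ.v .q = n.q
  p1 : σ.v .p1 = n.p - 1
  p : σ.v .p = n.p
  M : σ.v .M = n.M

theorem Fits.of_same {n : Dim} {c : Prog} {σ σ' : Mem} (h : Fits n σ) (hs : Same c σ σ')
    (hc : ∀ y ∈ [Var.t, .r, .q, .p1, .p, .M], c.writes y = false) : Fits n σ' := by
  simp only [List.forall_mem_cons] at hc
  obtain ⟨h1, h2, h3, h4, h5, h6, -⟩ := hc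
  exact ⟨by rw [hs.v _ h1, h.t], by rw [hs.v _ h2, h.r], by rw [hs.v _ h3, h.q],
    by rw [hs.v _ h4, h.p1], by rw [hs.v _ h5, h.p], by rw [hs.v _ h6, h.M]⟩

theorem Fits.set {n : Dim} {σ : Mem} (h : Fits n σ) {x : Var} (k : ℕ)
    (hx : x ∉ [Var.t, .r, .q, .p1, .p, .M]) : Fits n (σ.set x k) := by
  simp only [List.mem_cons, not_or] at hx
  obtain ⟨h1, h2, h3, h4, h5, h6, -⟩ := hx
  exact ⟨by rw [Mem.set_v, if_neg (Ne.symm h1), h.t], by rw [Mem.set_v, if_neg (Ne.symm h2), h.r],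
    by rw [Mem.set_v, if_neg (Ne.symm h3), h.q], by rw [Mem.set_v, if_neg (Ne.symm h4), h.p1],
    by rw [Mem.set_v, if_neg (Ne.symm h5), h.p], by rw [Mem.set_v, if_neg (Ne.symm h6), h.M]⟩

theorem Fits.put {n : Dim} {σ : Mem} (h : Fits n σ) (a : Arr) (i j k l : ℕ) :
    Fits n (σ.put a i j k l) := ⟨h.t, h.r, h.q, h.p1, h.p, h.M⟩

/-- The tables belong to the snapshot `A`. -/
structure Tables (n : Dim) (σ : Mem) (A : Finset ℕ) : Prop where
  N : ∀ x, σ.m .N x 0 0 = if x ∈ A then 1 else 0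
  F : ∀ u, ∀ a < n.p - 1, (σ.m .F u a 0 : ZMod (n.p * n.p)) = evalF n.p n.q A u a
  G : ∀ u, ∀ a < n.p - 1, (σ.m .G u a 0 : ZMod (n.p * n.p)) =
    evalG n.p n.q (Finset.range (n.t + 1) \ A) u a
  C : ∀ h, 0 < h → h < 2 * n.r → ∀ d ≤ n.r, ∀ a < n.p - 1,
    (σ.m .C h d a : ZMod (n.p * n.p)) = heapSum n.r (fun u => evalF n.p n.q A u a *
      evalG n.p n.q (Finset.range (n.t + 1) \ A) (u + d) a) h

/-- What does not change after the preprocessing. -/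
structure Fixed (n : Dim) (σ : Mem) : Prop extends Fits n σ where
  E : ∀ a < n.p - 1, ∀ k < n.p, (σ.m .E a k 0 : ZMod (n.p * n.p)) = root n.p a ^ k
  L : σ.m .L 0 0 0 = 1

/-- The memory represents the set `B` of sums, with the snapshot `A`. -/
structure Holds (n : Dim) (σ : Mem) (A B : Finset ℕ) : Prop where
  sub : A ⊆ B
  le : B ⊆ Finset.range (n.t + 1)
  S : ∀ x, σ.m .S x 0 0 = if x ∈ B then 1 else 0
  P : (Multiset.range (σ.v .np)).map (fun k => σ.m .P k 0 0) = (B \ A).val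
  K : ∀ w ≤ n.t, σ.m .K w 0 0 ≠ 0 → ∀ x ∈ B, x + w ≤ n.t → x + w ∈ B

theorem Holds.sum_P {n : Dim} {σ : Mem} {A B : Finset ℕ} (h : Holds n σ A B) {R : Type*}
    [AddCommMonoid R] (g : ℕ → R) :
    ∑ k ∈ Finset.range (σ.v .np), g (σ.m .P k 0 0) = ∑ y ∈ B \ A, g y := by
  simp only [Finset.sum, ← h.P, Multiset.map_map, Finset.range_val, Function.comp_def]

theorem Holds.P_mem {n : Dim} {σ : Mem} {A B : Finset ℕ} (h : Holds n σ A B) {k : ℕ}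
    (hk : k < σ.v .np) : σ.m .P k 0 0 ∈ B \ A := by
  rw [← Finset.mem_val, ← h.P]
  exact Multiset.mem_map_of_mem _ (Multiset.mem_range.2 hk)

theorem Holds.P_le {n : Dim} {σ : Mem} {A B : Finset ℕ} (h : Holds n σ A B) {k : ℕ}
    (hk : k < σ.v .np) : σ.m .P k 0 0 ≤ n.t :=
  Nat.lt_succ_iff.1 (Finset.mem_range.1 (h.le (Finset.mem_sdiff.1 (h.P_mem hk)).1))

theorem Holds.np_le {n : Dim} {σ : Mem} {A B : Finset ℕ} (h : Holds n σ A B) :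
    σ.v .np ≤ n.t + 1 := by
  have h1 := congrArg Multiset.card h.P
  rw [Multiset.card_map, Multiset.card_range, Finset.card_val] at h1
  rw [h1]
  simpa using Finset.card_le_card (Finset.sdiff_subset.trans h.le)

/-! ### The corrections -/

theorem corrProg_ok {n : Dim} {σ : Mem} {A B : Finset ℕ} {w : ℕ} (hf : Fits n σ)
    (hN : ∀ x, σ.m .N x 0 0 = if x ∈ A then 1 else 0) (hB : Holds n σ A B)
    (hw : σ.v .w = w) :
    Ok n.M corrProg σ (500 * (2 * n.r + σ.v .np) + 150) fun σ' => ∀ u < n.r,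
      (σ'.m .D (n.r + u) 0 0 : ZMod (n.p * n.p)) = ∑ y ∈ B \ A,
        ((if (y + w ≤ n.t ∧ y + w ∉ B) ∧ y / n.q = u then ((n.p - 1 : ℕ) : ZMod (n.p * n.p)) else 0) -
        (if (w ≤ y ∧ y - w ∈ A) ∧ (y - w) / n.q = u then ((n.p - 1 : ℕ) : ZMod (n.p * n.p)) else 0)) := by
  have hpM := n.p_sq_le
  have hM0 : 0 < n.M := by have := n.two_q_lt; omega
  refine Ok.seq (T₁ := 2 * n.r * 40 + 50) (T₂ := σ.v .np * 500 + 50)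
    (R := fun σ' => ∀ h < 2 * n.r, σ'.m .D h 0 0 = 0) ?_ ?_ (by omega)
  · refine Ok.loop' (n := 2 * n.r) 21 (fun k σ' => ∀ h < k, σ'.m .D h 0 0 = 0) ?_ ?_ ?_ ?_ ?_ ?_
    · simp [hf.r, two_mul]
    · have := n.rq_le; have := n.q_pos; nlinarith
    · simp
    · intro k hk σ' hs hI
      refine Ok.store (by simp) (by simp) ?_
      intro h hh
      simp only [Mem.put_m, Mem.set_m]
      split_ifs with h1
      · rfl
      · apply hI
        simp at h1
        omega
    · simp; omega
    · exact fun σ' _ h => h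
  · intro σ1 hs1 _ hD
    have hf1 : Fits n σ1 := hf.of_same hs1 (by decide)
    have hnp : σ1.v .np = σ.v .np := hs1.v _ rfl
    have hP1 : σ1.m .P = σ.m .P := hs1.m _ rfl
    have hS1 : σ1.m .S = σ.m .S := hs1.m _ rfl
    have hN1 : σ1.m .N = σ.m .N := hs1.m _ rfl
    have hf1 : Fits n σ1 := hf.of_same hs1 (by decide)
    have hcM : ((n.M : ℕ) : ZMod (n.p * n.p)) = 0 := ZMod.natCast_self _
    let g1 : ℕ → ℕ → ZMod (n.p * n.p) := fun y u =>
      if (y + w ≤ n.t ∧ y + w ∉ B) ∧ y / n.q = u then ((n.p - 1 : ℕ) : ZMod (n.p * n.p)) else 0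
    let g2 : ℕ → ℕ → ZMod (n.p * n.p) := fun y u =>
      if (w ≤ y ∧ y - w ∈ A) ∧ (y - w) / n.q = u then ((n.p - 1 : ℕ) : ZMod (n.p * n.p)) else 0
    refine Ok.loop' (n := σ.v .np) 450 (fun k σ' => ∀ u < n.r,
      (σ'.m .D (n.r + u) 0 0 : ZMod (n.p * n.p)) =
        ∑ j ∈ Finset.range k, (g1 (σ.m .P j 0 0) u - g2 (σ.m .P j 0 0) u)) ?_ ?_ ?_ ?_ ?_ ?_
    · simp [hnp]
    · have := hB.np_le; have := n.t_lt'; have := n.rq_le; omega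
    · intro u hu
      simp [hD (n.r + u) (by omega)]
    · intro k hk σ2 hs2 hI
      have hf2 : Fits n σ2 := hf1.of_same hs2 (by decide)
      have hw2 : σ2.v .w = w := by rw [hs2.v _ rfl, hs1.v _ rfl, hw]
      have hP2 : σ2.m .P = σ.m .P := by rw [hs2.m _ rfl, hP1]
      have hS2 : ∀ x, σ2.m .S x 0 0 = if x ∈ B then 1 else 0 := by rw [hs2.m _ rfl, hS1]; exact hB.S
      have hN2 : ∀ x, σ2.m .N x 0 0 = if x ∈ A then 1 else 0 := by rw [hs2.m _ rfl, hN1]; exact hN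
      have hy := hB.P_le hk
      have htM : n.t ≤ n.M := by have := n.t_lt'; have := n.rq_le; omega
      refine Ok.assign_seq (T₂ := 401) ?_ ?_ (by simp)
      · simpa [hP2] using hy.trans htM
      simp only [Expr.eval_ld, Expr.eval_v, Expr.eval_c, Mem.set_m, Mem.set_v, hP2, if_true]
      set y := σ.m .P k 0 0 with hyd
      refine Ok.seq (T₁ := 200) (T₂ := 200) (R := fun σ' => ∀ u < n.r,
        (σ'.m .D (n.r + u) 0 0 : ZMod (n.p * n.p)) =
          ∑ j ∈ Finset.range k, (g1 (σ.m .P j 0 0) u - g2 (σ.m .P j 0 0) u) + g1 y u) ?_ ?_ (by simp)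
      · refine Ok.ite (T₁ := 100) ?_ ?_ (by simp)
        · intro hc
          -- The program expresses the conjunction by a single comparison with `(t + 1) * (1 - S[y +
          -- w])`, which fails if the second factor is zero.
          have hc' : y + w ≤ n.t ∧ y + w ∉ B := by
            by_cases h : y + w ∈ B
            · simp [hS2, hw2, h] at hc
            · simp [hf2.t, hw2, hS2, h] at hc
              exact ⟨by omega, h⟩
          refine Ok.store (by simp) ?_ ?_
          · simp only [Expr.eval_mod, Expr.eval_v, Mem.set_v, reduceCtorEq, if_false, hf2.M]
            exact (Nat.mod_lt _ hM0).le
          · intro u hu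
            have := hI u hu
            simp only [Expr.eval_mod, Expr.eval_add, Expr.eval_div, Expr.eval_v, Expr.eval_c,
              Expr.eval_ld, Mem.set_v, Mem.set_m, Mem.put_m, reduceCtorEq, if_false, if_true,
              hf2.r, hf2.q, hf2.p1, hf2.M, true_and, and_true, Nat.add_left_cancel_iff]
            simp only [g1, hc', true_and, not_false_eq_true]
            by_cases hu' : u = y / n.q
            · subst hu'
              rw [if_pos rfl, if_pos rfl, Dim.M, ZMod.natCast_mod, Nat.cast_add, this]
            · rw [if_neg hu', if_neg (Ne.symm hu'), this, add_zero]
        · intro hc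
          have hc' : ¬ (y + w ≤ n.t ∧ y + w ∉ B) := by
            rintro ⟨h1, h2⟩
            simp [hf2.t, hw2, hS2, h2] at hc
            omega
          refine Ok.skip (by simp) fun u hu => ?_
          simp [g1, hc', hI u hu]
      · intro σ3 hs3 _ hI3
        have hf3 : Fits n σ3 :=
          ((hf2.set k (by decide)).set y (by decide)).of_same hs3 (by decide)
        have hw3 : σ3.v .w = w := by rw [hs3.v _ rfl]; simpa using hw2
        have hy3 : σ3.v .y = y := by rw [hs3.v _ rfl]; simp
        have hN3 : ∀ x, σ3.m .N x 0 0 = if x ∈ A then 1 else 0 := by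
          rw [hs3.m _ rfl]; simpa using hN2
        have hadd : ∀ u, ∑ j ∈ Finset.range (k + 1), (g1 (σ.m .P j 0 0) u - g2 (σ.m .P j 0 0) u) =
            ∑ j ∈ Finset.range k, (g1 (σ.m .P j 0 0) u - g2 (σ.m .P j 0 0) u) + g1 y u - g2 y u := by
          intro u; rw [Finset.sum_range_succ, add_sub_assoc]
        refine Ok.ite (T₁ := 100) ?_ ?_ (by simp)
        · intro hc
          -- Again a conjunction as one comparison. For `y < w` the truncated difference reads cell
          -- 0, but then the comparison with at most `y + 1` fails anyway.
          have hc' : w ≤ y ∧ y - w ∈ A := by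
            by_cases h : y - w ∈ A
            · simp [hw3, hN3, hy3, h] at hc
              exact ⟨by omega, h⟩
            · simp [hw3, hN3, hy3, h] at hc
          refine Ok.store (by simp) ?_ ?_
          · simp only [Expr.eval_mod, Expr.eval_v, hf3.M]
            exact (Nat.mod_lt _ hM0).le
          · intro u hu
            have := hI3 u hu
            simp only [Expr.eval_mod, Expr.eval_add, Expr.eval_sub, Expr.eval_div, Expr.eval_v,
              Expr.eval_c, Expr.eval_ld, Mem.put_m, hf3.r, hf3.q, hf3.p1, hf3.M, hw3, hy3,
              true_and, and_true, Nat.add_left_cancel_iff]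
            rw [hadd]
            simp only [g2, hc', true_and]
            by_cases hu' : u = (y - w) / n.q
            · subst hu'
              -- Adding `M - (p - 1)` subtracts `p - 1` modulo `M`.
              rw [if_pos rfl, if_pos rfl, Dim.M, ZMod.natCast_mod, Nat.cast_add,
                Nat.cast_sub (by rw [Dim.M] at hpM; omega), this]
              rw [Dim.M] at hcM
              rw [hcM]
              ring
            · rw [if_neg hu', if_neg (Ne.symm hu'), this, sub_zero]
        · intro hc
          have hc' : ¬ (w ≤ y ∧ y - w ∈ A) := by
            rintro ⟨h1, h2⟩
            simp [hw3, hN3, hy3, h2] at hc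
            omega
          refine Ok.skip (by simp) fun u hu => ?_
          simp [hadd, g2, hc', hI3 u hu]
    · simp; omega
    · intro σ' _ hI u hu
      rw [hI u hu]
      exact hB.sum_P fun y => g1 y u - g2 y u

/-! ### The search -/

/-- The sums from which adding `w` leads to a new sum. -/
def missing (n : Dim) (B : Finset ℕ) (w : ℕ) : Finset ℕ := {x ∈ B | x + w ≤ n.t ∧ x + w ∉ B}

/-- Their number in a block. -/
def leafCount (n : Dim) (B : Finset ℕ) (w u : ℕ) : ℕ := ((missing n B w).filter (· / n.q = u)).card

theorem missing_le {n : Dim} {B : Finset ℕ} {w x : ℕ} (h : x ∈ missing n B w) : x + w ≤ n.t :=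
  (Finset.mem_filter.1 h).2.1

theorem sum_leafCount (n : Dim) (B : Finset ℕ) (w : ℕ) :
    ∑ u ∈ Finset.range n.r, leafCount n B w u = (missing n B w).card := by
  refine (Finset.card_eq_sum_card_fiberwise fun x hx => ?_).symm
  have := missing_le hx
  exact Finset.mem_coe.2 (Finset.mem_range.2 (n.div_lt (by omega)))

theorem card_missing_le (n : Dim) (B : Finset ℕ) (w : ℕ) : (missing n B w).card ≤ n.t + 1 := by
  have : missing n B w ⊆ Finset.range (n.t + 1) := fun x hx => by
    have := missing_le hx
    simp only [Finset.mem_range]; omega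
  simpa using Finset.card_le_card this

/-- Three kinds of pairs `(x, x + w)` account for the change from `A` to `B`. Pairs with `x ∈ A` and
target outside `A` are counted by the tables. Those whose target has entered `B` meanwhile are taken
away, one for each new `y` with `y - w ∈ A`. Pairs that start in a new element are added. The factor
`c` will be `p - 1`, the multiple in which the evaluations deliver counts. -/
theorem leaf_identity {n : Dim} {R : Type*} [Ring R] {A B : Finset ℕ} (hAB : A ⊆ B)
    (hB : B ⊆ Finset.range (n.t + 1)) (w u : ℕ) (c : R) :
    ∑ y ∈ B \ A, ((if (y + w ≤ n.t ∧ y + w ∉ B) ∧ y / n.q = u then c else 0) -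
        (if (w ≤ y ∧ y - w ∈ A) ∧ (y - w) / n.q = u then c else 0)) +
      c * ((A.filter fun x => x / n.q = u ∧ x + w ∈ Finset.range (n.t + 1) \ A).card : R) =
    c * (leafCount n B w u : R) := by
  have h1 : c * (leafCount n B w u : R) =
      ∑ x ∈ B, if (x + w ≤ n.t ∧ x + w ∉ B) ∧ x / n.q = u then c else 0 := by
    rw [leafCount, missing, Finset.filter_filter, ← Finset.sum_filter, Finset.sum_const,
      nsmul_eq_mul, (Nat.cast_commute _ _).eq]
  have h2 : c * ((A.filter fun x => x / n.q = u ∧ x + w ∈ Finset.range (n.t + 1) \ A).card : R) =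
      ∑ x ∈ A, if x / n.q = u ∧ x + w ∈ Finset.range (n.t + 1) \ A then c else 0 := by
    rw [← Finset.sum_filter, Finset.sum_const, nsmul_eq_mul, (Nat.cast_commute _ _).eq]
  have h3 : (∑ y ∈ B \ A, if (w ≤ y ∧ y - w ∈ A) ∧ (y - w) / n.q = u then c else 0) =
      ∑ x ∈ A, if x / n.q = u ∧ x + w ∈ B \ A then c else 0 := by
    rw [← Finset.sum_filter, ← Finset.sum_filter]
    refine Finset.sum_nbij' (· - w) (· + w) ?_ ?_ ?_ ?_ fun _ _ => rfl
    · intro y hy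
      obtain ⟨h1, ⟨h2, h3⟩, h4⟩ := Finset.mem_filter.1 hy
      exact Finset.mem_filter.2 ⟨h3, h4, by rwa [Nat.sub_add_cancel h2]⟩
    · intro x hx
      obtain ⟨h1, h2, h3⟩ := Finset.mem_filter.1 hx
      exact Finset.mem_filter.2 ⟨h3, ⟨by omega, by rwa [Nat.add_sub_cancel]⟩,
        by rwa [Nat.add_sub_cancel]⟩
    · intro y hy
      obtain ⟨-, ⟨h2, -⟩, -⟩ := Finset.mem_filter.1 hy
      exact Nat.sub_add_cancel h2
    · intro x _
      exact Nat.add_sub_cancel _ _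
  rw [h1, h2, Finset.sum_sub_distrib, h3, ← Finset.sum_sdiff hAB, sub_add_eq_add_sub,
    add_sub_assoc, ← Finset.sum_sub_distrib]
  congr 1
  -- For `x ∈ A`, a target up to `t` outside `A` lies either in `B \ A` or outside `B`.
  refine Finset.sum_congr rfl fun x _ => ?_
  by_cases hu : x / n.q = u
  · by_cases hxA : x + w ∈ A
    · simp [hxA, hAB hxA]
    · by_cases hxB : x + w ∈ B
      · have := Finset.mem_range.1 (hB hxB)
        simp [hu, hxA, hxB, this]
      · simp [hu, hxA, hxB]
  · simp [hu]

/-- A node is a leaf or belongs to the cut that starts with it, so its count is one term of a sum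
equal to the total. -/
theorem heapSum_leafCount_le (n : Dim) (B : Finset ℕ) (w : ℕ) {h : ℕ} (h0 : 0 < h)
    (h1 : h < 2 * n.r) : heapSum n.r (leafCount n B w) h ≤ (missing n B w).card := by
  have hr := n.r_pos
  rw [← sum_leafCount]
  by_cases h2 : n.r ≤ h
  · rw [heapSum_leaf _ h0 h2 h1]
    exact Finset.single_le_sum (f := leafCount n B w) (fun _ _ => Nat.zero_le _)
      (Finset.mem_range.2 (by omega))
  · rw [← heapSum_one _ (by omega), ← sum_heapSum_level _ h0 (by omega)]
    exact Finset.single_le_sum (f := heapSum n.r (leafCount n B w)) (fun _ _ => Nat.zero_le _)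
      (Finset.mem_Ico.2 (by omega))

/-- The value that is computed when a node is visited. -/
def nodeValue (n : Dim) (σ : Mem) (w h k : ℕ) : ZMod (n.p * n.p) :=
  σ.m .D h 0 0 + ∑ a ∈ Finset.range k,
    ((σ.m .C h (w / n.q) a : ZMod (n.p * n.p)) * root n.p a ^ (w % n.q) +
      (σ.m .C h (w / n.q + 1) a : ZMod (n.p * n.p)) * root n.p a ^ (w % n.q + (n.p - 1) - n.q))

/-- The powers of the roots that depend on `w` are the same for all leaves, so they factor out of
the sum over the leaves. This is why one tabulated number for each root and offset serves a whole
subtree. -/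
theorem nodeValue_eq {n : Dim} {σ : Mem} {A B : Finset ℕ} {w h : ℕ} (hAB : A ⊆ B)
    (hB : B ⊆ Finset.range (n.t + 1)) (ht : Tables n σ A) (hw : w ≤ n.t)
    (h0 : 0 < h) (h1 : h < 2 * n.r)
    (hD : (σ.m .D h 0 0 : ZMod (n.p * n.p)) = heapSum n.r (fun u => ∑ y ∈ B \ A,
        ((if (y + w ≤ n.t ∧ y + w ∉ B) ∧ y / n.q = u then ((n.p - 1 : ℕ) : ZMod (n.p * n.p)) else 0) -
        (if (w ≤ y ∧ y - w ∈ A) ∧ (y - w) / n.q = u then ((n.p - 1 : ℕ) : ZMod (n.p * n.p)) else 0))) h) :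
    nodeValue n σ w h (n.p - 1) =
      ((n.p - 1 : ℕ) : ZMod (n.p * n.p)) * (heapSum n.r (leafCount n B w) h : ℕ) := by
  have hd : w / n.q < n.r := n.div_lt hw
  have hq := n.q_pos
  have h2 : ∑ a ∈ Finset.range (n.p - 1),
      ((σ.m .C h (w / n.q) a : ZMod (n.p * n.p)) * root n.p a ^ (w % n.q) +
      (σ.m .C h (w / n.q + 1) a : ZMod (n.p * n.p)) * root n.p a ^ (w % n.q + (n.p - 1) - n.q)) =
      heapSum n.r (fun u => ((n.p - 1 : ℕ) : ZMod (n.p * n.p)) *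
        ((A.filter fun x => x / n.q = u ∧ x + w ∈ Finset.range (n.t + 1) \ A).card :
          ZMod (n.p * n.p))) h := by
    rw [← funext fun u => sum_eval_mul n.prime (by omega) n.two_q_lt A
      (Finset.range (n.t + 1) \ A) u w, heapSum_sum]
    refine Finset.sum_congr rfl fun a ha => ?_
    have ha := Finset.mem_range.1 ha
    rw [heapSum_add, ht.C h h0 h1 _ hd.le a ha, ht.C h h0 h1 _ (by omega) a ha]
    congr 1
    · exact map_heapSum (AddMonoidHom.mulRight (root n.p a ^ (w % n.q))) _ h
    · exact map_heapSum (AddMonoidHom.mulRight (root n.p a ^ (w % n.q + (n.p - 1) - n.q))) _ h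
  rw [nodeValue, h2, hD, ← heapSum_add, heapSum_congr fun u _ => leaf_identity hAB hB w u _]
  have h3 := map_heapSum (r := n.r) ((AddMonoidHom.mulLeft ((n.p - 1 : ℕ) : ZMod (n.p * n.p))).comp
    (Nat.castAddMonoidHom (ZMod (n.p * n.p)))) (leafCount n B w) h
  exact h3.symm

/-- `p - 1` is coprime to `p ^ 2`, and the count is at most `t + 1`, hence below `p ^ 2`; so it
vanishes if it does so modulo `p ^ 2`. -/
theorem nodeValue_zero_iff {n : Dim} {B : Finset ℕ} {w h X : ℕ} (h0 : 0 < h) (h1 : h < 2 * n.r)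
    (hX : X < n.M) (hX' : (X : ZMod (n.p * n.p)) =
      ((n.p - 1 : ℕ) : ZMod (n.p * n.p)) * (heapSum n.r (leafCount n B w) h : ℕ)) :
    X = 0 ↔ heapSum n.r (leafCount n B w) h = 0 := by
  constructor
  · rintro rfl
    rw [Nat.cast_zero, ← Nat.cast_mul, eq_comm, ZMod.natCast_eq_zero_iff] at hX'
    have h2 : Nat.Coprime (n.p * n.p) (n.p - 1) := by
      have : Nat.Coprime n.p (n.p - 1) :=
        (Nat.coprime_self_sub_right n.prime.one_lt.le).2 (Nat.coprime_one_right _)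
      exact Nat.Coprime.mul_left this this
    have h3 := h2.dvd_of_dvd_mul_left hX'
    refine Nat.eq_zero_of_dvd_of_lt h3 ?_
    have h4 := heapSum_leafCount_le n B w h0 h1
    have h5 := card_missing_le n B w
    have h6 := n.t_lt'
    have h7 := n.rq_le
    rw [Dim.M] at h7
    have := n.q_pos
    have := n.r_pos
    nlinarith
  · intro h
    rw [h, Nat.cast_zero, mul_zero, ZMod.natCast_eq_zero_iff] at hX'
    exact Nat.eq_zero_of_dvd_of_lt hX' hX

theorem heapProg_ok {n : Dim} {σ : Mem} (hf : Fits n σ) (g : ℕ → ZMod (n.p * n.p))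
    (hg : ∀ u < n.r, (σ.m .D (n.r + u) 0 0 : ZMod (n.p * n.p)) = g u) :
    Ok n.M heapProg σ (200 * n.r + 50) fun σ' => ∀ h, 0 < h → h < 2 * n.r →
      (σ'.m .D h 0 0 : ZMod (n.p * n.p)) = heapSum n.r g h := by
  have hr := n.r_pos
  have hM0 : 0 < n.M := by have := n.two_q_lt; have := n.p_sq_le; omega
  have hrM : n.r ≤ n.M := by have := n.two_q_lt; have := n.p_sq_le; have := n.r_le_q; omega
  -- The inner nodes are treated in decreasing order, so the children of a node are complete before
  -- the node itself.
  refine Ok.loop' (n := n.r - 1) 190 (fun k σ' => ∀ h, n.r - 1 - k < h → h < 2 * n.r →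
      (σ'.m .D h 0 0 : ZMod (n.p * n.p)) = heapSum n.r g h) ?_ ?_ ?_ ?_ ?_ ?_
  · simp [hf.r]
  · omega
  · intro h h1 h2
    rw [heapSum_leaf _ (by omega) (by omega) h2, ← hg _ (by omega)]
    rw [show n.r + (h - n.r) = h by omega]
  · intro k hk σ' hs hI
    have hf' : Fits n σ' := hf.of_same hs (by decide)
    refine Ok.assign_seq (T₂ := 150) ?_ ?_ (by simp)
    · simp [hf'.r]; omega
    · refine Ok.store (by simp) ?_ ?_
      · simp [hf'.M, (Nat.mod_lt _ hM0).le]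
      · intro h h1 h2
        simp only [Expr.eval_mod, Expr.eval_add, Expr.eval_sub, Expr.eval_v, Expr.eval_c,
          Expr.eval_ld, Mem.set_v, Mem.set_m, Mem.put_m, reduceCtorEq, if_false, if_true,
          hf'.r, hf'.M, true_and, and_true]
        by_cases h3 : h = n.r - 1 - k
        · rw [if_pos h3, Dim.M, ZMod.natCast_mod, Nat.cast_add, heapSum_node _ (by omega) (by omega),
            hI _ (by omega) (by omega), hI _ (by omega) (by omega), h3, two_mul]
        · rw [if_neg h3]
          exact hI h (by omega) h2
  · simp; omega
  · exact fun σ' _ hI h h1 h2 => hI h (by omega) h2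

/-! ### Scanning leaves and visiting nodes. -/

/-- The new sums that come from `x < b` have been appended to the list `P`. -/
structure Found (n : Dim) (B : Finset ℕ) (w np : ℕ) (P : ℕ → ℕ → ℕ → ℕ) (σ : Mem) (b : ℕ) :
    Prop where
  size : σ.v .np = np
  new : (Multiset.range (σ.v .nn)).map (fun k => σ.m .P (np + k) 0 0) =
    ((missing n B w).filter (· < b)).val.map (· + w)
  old : ∀ k < np, σ.m .P k 0 0 = P k 0 0

theorem Found.nn {n : Dim} {B : Finset ℕ} {w np : ℕ} {P : ℕ → ℕ → ℕ → ℕ} {σ : Mem} {b : ℕ}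
    (h : Found n B w np P σ b) : σ.v .nn = ((missing n B w).filter (· < b)).card := by
  have := congrArg Multiset.card h.new
  rwa [Multiset.card_map, Multiset.card_range, Multiset.card_map] at this

/-- Stretches without elements of `missing` may be passed over without a scan. -/
theorem Found.mono {n : Dim} {B : Finset ℕ} {w np : ℕ} {P : ℕ → ℕ → ℕ → ℕ} {σ : Mem} {b b' : ℕ}
    (h : Found n B w np P σ b) (hb : ∀ x ∈ missing n B w, x < b ↔ x < b') :
    Found n B w np P σ b' := by
  refine ⟨h.size, ?_, h.old⟩
  rw [h.new, Finset.filter_congr hb]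

/-- `S` is not altered during the search, so the tests refer to the old set `B` throughout and the
new item is never used twice. -/
theorem scanProg_ok {n : Dim} {σ : Mem} {B : Finset ℕ} {w np h : ℕ} {P : ℕ → ℕ → ℕ → ℕ}
    (hf : Fits n σ) (hS : ∀ x, σ.m .S x 0 0 = if x ∈ B then 1 else 0) (hw : σ.v .w = w)
    (hh : σ.v .h = h) (h1 : n.r ≤ h) (h2 : h < 2 * n.r)
    (hF : Found n B w np P σ ((h - n.r) * n.q)) :
    Ok n.M scanProg σ (200 * n.q + 50) fun σ' => Found n B w np P σ' ((h + 1 - n.r) * n.q) := by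
  have hM := n.rq_le
  have hq := n.q_pos
  have hr := n.r_pos
  have hqM : n.q ≤ n.M := by nlinarith
  have htM : n.t + 2 ≤ n.M := by have := n.t_lt'; nlinarith
  refine Ok.loop' (n := n.q) 190 (fun k σ' => Found n B w np P σ' ((h - n.r) * n.q + k))
    ?_ hqM hF ?_ ?_ ?_
  · simp [hf.q]
  · intro k hk σ' hs hI
    have hf' : Fits n σ' := hf.of_same hs (by decide)
    have hw' : σ'.v .w = w := by rw [hs.v _ rfl, hw]
    have hh' : σ'.v .h = h := by rw [hs.v _ rfl, hh]
    have hS' : ∀ x, σ'.m .S x 0 0 = if x ∈ B then 1 else 0 := by rw [hs.m _ rfl]; exact hS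
    set x := (h - n.r) * n.q + k with hx
    have hxM : x < n.r * n.q := by
      have : (h - n.r + 1) * n.q ≤ n.r * n.q := Nat.mul_le_mul_right _ (by omega)
      rw [add_mul] at this; omega
    refine Ok.assign_seq (T₂ := 160) ?_ ?_ (by simp)
    · simp [hf'.r, hf'.q, hh', ← hx]; omega
    simp only [Expr.eval_add, Expr.eval_sub, Expr.eval_mul, Expr.eval_v, Mem.set_v, reduceCtorEq,
      if_false, if_true, hf'.r, hf'.q, hh', ← hx]
    have hcond : (Expr.ld .S (.v .x) (.c 0) (.c 0) * (Expr.v .x + .v .w).lt (.v .t + .c 1) *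
          (.c 1 - Expr.ld .S (.v .x + .v .w) (.c 0) (.c 0))).eval ((σ'.set .k k).set .x x) ≠ 0 ↔
        x ∈ missing n B w := by
      simp only [missing, Finset.mem_filter]
      by_cases hxB : x ∈ B
      · by_cases hxw : x + w ∈ B
        · simp [hS', hw', hxw]
        · simp [hS', hw', hxw, hxB, hf'.t]
      · simp [hS', hxB]
    refine Ok.ite (T₁ := 70) (fun hc => ?_) (fun hc => ?_) (by simp)
    · have hxm := hcond.1 hc
      have hxt := missing_le hxm
      have hnn := hI.nn
      have hnn' : σ'.v .nn ≤ n.t + 1 := by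
        rw [hnn]
        exact (Finset.card_le_card (Finset.filter_subset _ _)).trans (card_missing_le n B w)
      refine Ok.store_seq (T₂ := 30) ?_ (Ok.assign (by simp) ?_ ?_) (by simp)
      · simp [hw']; omega
      · simp; omega
      · refine ⟨?_, ?_, ?_⟩
        · simpa using hI.size
        · simp only [Expr.eval_add, Expr.eval_v, Expr.eval_c, Mem.set_v, Mem.set_m, Mem.put_v,
            Mem.put_m, reduceCtorEq, if_false, if_true, hI.size, hw', true_and, and_true,
            Nat.add_left_cancel_iff, Multiset.range_succ, Multiset.map_cons]
          have h3 : (missing n B w).filter (· < x + 1) =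
              insert x ((missing n B w).filter (· < x)) := by
            ext y
            simp only [Finset.mem_filter, Finset.mem_insert]
            constructor
            · rintro ⟨h1, h2⟩
              rcases Nat.lt_succ_iff_lt_or_eq.1 h2 with h | h
              exacts [Or.inr ⟨h1, h⟩, Or.inl h]
            · rintro (rfl | ⟨h1, h2⟩)
              exacts [⟨hxm, Nat.lt_succ_self _⟩, ⟨h1, by omega⟩]
          rw [← add_assoc, ← hx, h3, Finset.insert_val_of_notMem (by simp), Multiset.map_cons, ← hI.new]
          congr 1
          refine Multiset.map_congr rfl fun j hj => ?_
          rw [if_neg (Multiset.mem_range.1 hj).ne]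
        · intro j hj
          simp only [Expr.eval_add, Expr.eval_v, Expr.eval_c, Mem.set_v, Mem.set_m, 
            Mem.put_m, reduceCtorEq, if_false, hI.size, true_and, and_true]
          rw [if_neg (by omega), hI.old j hj]
    · have hxm : x ∉ missing n B w := fun h => hcond.2 h hc
      refine Ok.skip (by simp) ?_
      have h3 : Found n B w np P ((σ'.set .k k).set .x x) x := 
        ⟨by simpa using hI.size, by simpa using hI.new, by simpa using hI.old⟩
      refine h3.mono fun y hy => ?_
      have : y ≠ x := fun h => hxm (h ▸ hy)
      omega
  · simp; omega
  · intro σ' _ hI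
    rwa [show h + 1 - n.r = h - n.r + 1 by omega, add_mul, one_mul]

theorem Fixed.of_same {n : Dim} {c : Prog} {σ σ' : Mem} (h : Fixed n σ) (hs : Same c σ σ')
    (hc : ∀ y ∈ [Var.t, .r, .q, .p1, .p, .M], c.writes y = false) (hE : c.stores .E = false)
    (hL : σ'.m .L 0 0 0 = 1) : Fixed n σ' :=
  ⟨h.toFits.of_same hs hc, by rw [hs.m _ hE]; exact h.E, hL⟩

theorem nodeValue_congr {n : Dim} {σ σ' : Mem} (hD : σ'.m .D = σ.m .D) (hC : σ'.m .C = σ.m .C)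
    (w h k : ℕ) : nodeValue n σ' w h k = nodeValue n σ w h k := by
  simp only [nodeValue, hD, hC]

/-- Evaluating the count costs `O(q)`. A scan costs another `O(q)`, but it happens only at leaves
with nonzero count and is charged to that count. -/
theorem visitProg_ok {n : Dim} {σ : Mem} {B : Finset ℕ} {w np h : ℕ} {P : ℕ → ℕ → ℕ → ℕ}
    (hf : Fits n σ)
    (hE : ∀ a < n.p - 1, ∀ k < n.p, (σ.m .E a k 0 : ZMod (n.p * n.p)) = root n.p a ^ k)
    (hS : ∀ x, σ.m .S x 0 0 = if x ∈ B then 1 else 0) (hw : σ.v .w = w)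
    (hd : σ.v .d = w / n.q) (hdl : σ.v .dl = w % n.q) (hh : σ.v .h = h) (h1 : 0 < h)
    (h2 : h < 2 * n.r) (hL : σ.m .L h 0 0 = 0)
    (hV : nodeValue n σ w h (n.p - 1) =
      ((n.p - 1 : ℕ) : ZMod (n.p * n.p)) * (heapSum n.r (leafCount n B w) h : ℕ))
    (hF : Found n B w np P σ ((h - n.r) * n.q)) :
    Ok n.M visitProg σ (1000 * n.q * (1 + heapSum n.r (leafCount n B w) h)) fun σ' =>
      (σ'.m .L h 0 0 ≠ 0 ↔ heapSum n.r (leafCount n B w) h ≠ 0) ∧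
      (∀ j, j ≠ h → σ'.m .L j 0 0 = σ.m .L j 0 0) ∧
      Found n B w np P σ' ((h + 1 - n.r) * n.q) := by
  have hpM := n.p_sq_le
  have hp := n.p_le'
  have hqp := n.two_q_lt
  have hq := n.q_pos
  have hwq := Nat.mod_lt w (show 0 < n.q by omega)
  have hM0 : 0 < n.M := by omega
  set f := heapSum n.r (leafCount n B w) h with hfd
  refine Ok.of_bdd fun hb => ?_
  refine Ok.assign_seq (T₂ := 740 * n.q + (if f = 0 then 0 else 200 * n.q)) ?_ ?_ ?_
  · exact hb.m _ _ _ _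
  rotate_left 1
  · simp only [Expr.cost_ld, Expr.cost_v, Expr.cost_c]
    split_ifs with h0
    · rw [h0]; omega
    · have : 1000 * n.q * 2 ≤ 1000 * n.q * (1 + f) := Nat.mul_le_mul_left _ (by omega)
      omega
  refine Ok.seq (T₁ := 550 * n.q) (T₂ := 150 * n.q + (if f = 0 then 0 else 200 * n.q))
    (R := fun σ' => σ'.v .X < n.M ∧
      (σ'.v .X : ZMod (n.p * n.p)) = nodeValue n σ w h (n.p - 1)) ?_ ?_ (by omega)
  -- The entry of `D` with which the accumulation starts is only known to be at most `M`; a strict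
  -- bound holds after the first reduction.
  · refine Ok.loop' (n := n.p - 1) 120 (fun k σ' => (0 < k → σ'.v .X < n.M) ∧
      (σ'.v .X : ZMod (n.p * n.p)) = nodeValue n σ w h k) ?_ ?_ ?_ ?_ ?_ ?_
    · simp [hf.p1]
    · omega
    · simp [nodeValue, hh]
    · intro k hk σ' hs hI
      have hf' : Fits n σ' := (hf.set _ (by decide)).of_same hs (by decide)
      have hw' : σ'.v .w = w := by rw [hs.v _ rfl]; simpa using hw
      have hh' : σ'.v .h = h := by rw [hs.v _ rfl]; simpa using hh
      have hd' : σ'.v .d = w / n.q := by rw [hs.v _ rfl]; simpa using hd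
      have hdl' : σ'.v .dl = w % n.q := by rw [hs.v _ rfl]; simpa using hdl
      have hC' : σ'.m .C = σ.m .C := by rw [hs.m _ rfl]; simp
      have hE' : σ'.m .E = σ.m .E := by rw [hs.m _ rfl]; simp
      refine Ok.assign (by simp) ?_ ?_
      · simp [hf'.M, (Nat.mod_lt _ hM0).le]
      · simp only [Expr.eval_mod, Expr.eval_add, Expr.eval_sub, Expr.eval_mul, Expr.eval_v,
          Expr.eval_c, Expr.eval_ld, Mem.set_v, Mem.set_m, reduceCtorEq, if_false, if_true, hf'.M,
          hf'.p1, hf'.q, hh', hd', hdl', hC', hE']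
        refine ⟨fun _ => Nat.mod_lt _ hM0, ?_⟩
        rw [Dim.M, ZMod.natCast_mod]
        push_cast
        rw [hI.2, hE k hk _ (by omega), hE k hk _ (by omega), nodeValue, nodeValue,
          Finset.sum_range_succ]
        ring
    · simp; omega
    · exact fun σ' _ hI => ⟨hI.1 (by omega), hI.2⟩
  · intro σ1 hs1 _ hX
    have hf1 : Fits n σ1 := (hf.set _ (by decide)).of_same hs1 (by decide)
    have hw1 : σ1.v .w = w := by rw [hs1.v _ rfl]; simpa using hw
    have hh1 : σ1.v .h = h := by rw [hs1.v _ rfl]; simpa using hh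
    have hL1 : σ1.m .L = σ.m .L := by rw [hs1.m _ rfl]; simp
    have hP1 : σ1.m .P = σ.m .P := by rw [hs1.m _ rfl]; simp
    have hS1 : ∀ x, σ1.m .S x 0 0 = if x ∈ B then 1 else 0 := by
      rw [hs1.m _ rfl]; simpa using hS
    have hF1 : Found n B w np P σ1 ((h - n.r) * n.q) := by
      refine ⟨?_, ?_, ?_⟩
      · rw [hs1.v _ rfl]; simpa using hF.size
      · rw [hs1.v _ rfl, hP1]; simpa using hF.new
      · rw [hP1]; exact hF.old
    have hz := nodeValue_zero_iff h1 h2 hX.1 (hX.2.trans hV)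
    -- A leaf that is not scanned contains nothing to be found. At an inner node both thresholds are
    -- zero by truncated subtraction.
    have hleaf : ∀ {σ' : Mem}, (n.r ≤ h → f = 0) → Found n B w np P σ' ((h - n.r) * n.q) →
        Found n B w np P σ' ((h + 1 - n.r) * n.q) := by
      intro σ' hlf hF'
      by_cases h3 : n.r ≤ h
      · refine hF'.mono fun x hx => ?_
        have h4 := hlf h3
        rw [hfd, heapSum_leaf _ h1 h3 h2, leafCount, Finset.card_eq_zero,
          Finset.filter_eq_empty_iff] at h4
        have h5 : ¬ x / n.q = h - n.r := h4 hx
        rw [← Nat.div_lt_iff_lt_mul (by omega), ← Nat.div_lt_iff_lt_mul (by omega)]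
        omega
      · rwa [show h + 1 - n.r = h - n.r by omega]
    refine Ok.ite (T₁ := 140 * n.q + (if f = 0 then 0 else 200 * n.q)) ?_ ?_ (by simp; omega)
    · intro hc
      have hf0 : f ≠ 0 := fun h0 => hc (by simpa using hz.2 h0)
      rw [if_neg hf0]
      refine Ok.store_seq (T₂ := 100 * n.q + 200 * n.q) ?_ ?_ (by simp; omega)
      · simp; omega
      have hf2 := hf1.put .L h 0 0 1
      simp only [Expr.eval_c, Expr.eval_v, hh1]
      refine Ok.ite (T₁ := 90 * n.q + 200 * n.q) ?_ ?_ (by simp; omega)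
      · intro hc2
        have h3 : h < n.r := by
          by_contra h3
          simp [hh1, hf1.r, h3] at hc2
        refine Ok.skip (by omega) ⟨by simpa using hf0, fun j hj => by simp [hj, hL1], ?_⟩
        refine hleaf (by omega) ⟨?_, ?_, ?_⟩
        · simpa using hF1.size
        · simpa using hF1.new
        · simpa using hF1.old
      · intro hc2
        have h3 : n.r ≤ h := by
          by_contra h3
          simp [hh1, hf1.r] at hc2
          omega
        refine Ok.mono (scanProg_ok (n := n) (B := B) (w := w) (np := np) (h := h) (P := P)
          hf2 (by simpa using hS1) (by simpa using hw1) (by simpa using hh1) h3 h2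
          ⟨by simpa using hF1.size, by simpa using hF1.new, by simpa using hF1.old⟩)
          (by omega) fun σ' hs' _ hF' => ⟨?_, fun j hj => ?_, hF'⟩
        · rw [hs'.m _ rfl]; simpa using hf0
        · rw [hs'.m _ rfl]; simp [hj, hL1]
    · intro hc
      have hf0 : f = 0 := hz.1 (by simpa using hc)
      refine Ok.skip (by omega) ⟨?_, fun j _ => by rw [hL1], hleaf (fun _ => hf0) hF1⟩
      rw [hL1, hL, hf0]

/-- Every node is the parent of at most two nodes. -/
theorem sum_half_le (g : ℕ → ℕ) (r : ℕ) :
    ∑ k ∈ Finset.range (2 * r - 1), g ((k + 1) / 2) ≤ 2 * ∑ j ∈ Finset.range r, g j := by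
  cases r with
  | zero => simp
  | succ r =>
    have : ∀ m, ∑ k ∈ Finset.range (2 * m + 1), g ((k + 1) / 2) + g 0 =
        2 * ∑ j ∈ Finset.range (m + 1), g j := by
      intro m
      induction m with
      | zero => simp; ring
      | succ m ih =>
        rw [show 2 * (m + 1) + 1 = 2 * m + 1 + 1 + 1 by ring, Finset.sum_range_succ,
          Finset.sum_range_succ, Finset.sum_range_succ _ (m + 1),
          show (2 * m + 1 + 1) / 2 = m + 1 by omega, show (2 * m + 1 + 1 + 1) / 2 = m + 1 by omega]
        omega
    have := this r
    rw [show 2 * (r + 1) - 1 = 2 * r + 1 by omega]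
    omega

/-- The number of levels of the tree. -/
def Dim.depth (n : Dim) : ℕ := Nat.log 2 n.r + 2

theorem searchProg_ok {n : Dim} {σ : Mem} {B : Finset ℕ} {w np : ℕ} {P : ℕ → ℕ → ℕ → ℕ}
    (hf : Fixed n σ)
    (hS : ∀ x, σ.m .S x 0 0 = if x ∈ B then 1 else 0) (hw : σ.v .w = w)
    (hd : σ.v .d = w / n.q) (hdl : σ.v .dl = w % n.q)
    (hV : ∀ h, 0 < h → h < 2 * n.r → nodeValue n σ w h (n.p - 1) =
      ((n.p - 1 : ℕ) : ZMod (n.p * n.p)) * (heapSum n.r (leafCount n B w) h : ℕ))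
    (hF : Found n B w np P σ 0) :
    Ok n.M searchProg σ (2500 * n.q + 3000 * n.q * n.depth * (missing n B w).card) fun σ' =>
      σ'.m .L 0 0 0 = 1 ∧ Found n B w np P σ' (n.r * n.q) := by
  have hr := n.r_pos
  have hq := n.two_r_le_q
  have hqp := n.two_q_lt
  have hpM := n.p_sq_le
  set f := heapSum n.r (leafCount n B w) with hfd
  -- Node 0 acts as a parent of the root and is marked permanently, so the root is always visited. A
  -- visit of node `h` is charged to `g (h / 2)`, which is at least one whenever the visit takes
  -- place.
  let g : ℕ → ℕ := fun h => if h = 0 then 1 else f h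
  refine Ok.loop (n := 2 * n.r - 1)
    (fun k => 100 + 1000 * n.q * (g ((k + 1) / 2) + f (k + 1)))
    (fun k σ' => (∀ h, 0 < h → h ≤ k → (σ'.m .L h 0 0 ≠ 0 ↔ f h ≠ 0)) ∧ σ'.m .L 0 0 0 = 1 ∧
      Found n B w np P σ' ((k + 1 - n.r) * n.q)) ?_ ?_ ?_ ?_ ?_ ?_
  · simp [hf.r, two_mul]
  · omega
  · refine ⟨fun h h1 h2 => by omega, hf.L, ?_⟩
    rwa [show 0 + 1 - n.r = 0 by omega, zero_mul]
  · intro k hk σ' hs ⟨hI1, hI2, hI3⟩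
    have hf' : Fits n σ' := hf.toFits.of_same hs (by decide)
    have hw' : σ'.v .w = w := by rw [hs.v _ rfl]; simpa using hw
    have hd' : σ'.v .d = w / n.q := by rw [hs.v _ rfl]; simpa using hd
    have hdl' : σ'.v .dl = w % n.q := by rw [hs.v _ rfl]; simpa using hdl
    have hC' : σ'.m .C = σ.m .C := by rw [hs.m _ rfl]
    have hD' : σ'.m .D = σ.m .D := by rw [hs.m _ rfl]
    have hE' : σ'.m .E = σ.m .E := by rw [hs.m _ rfl]
    have hS' : ∀ x, σ'.m .S x 0 0 = if x ∈ B then 1 else 0 := by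
      rw [hs.m _ rfl]; exact hS
    refine Ok.assign_seq (T₂ := 80 + 1000 * n.q * (g ((k + 1) / 2) + f (k + 1))) ?_ ?_
      (by simp; omega)
    · simp; omega
    refine Ok.store_seq (T₂ := 50 + 1000 * n.q * (g ((k + 1) / 2) + f (k + 1))) ?_ ?_
      (by simp; omega)
    · simp
    simp only [Expr.eval_add, Expr.eval_v, Expr.eval_c, Mem.set_v, if_true]
    set σ2 := ((σ'.set .e k).set .h (k + 1)).put .L (k + 1) 0 0 0 with hσ2
    have hF2 : Found n B w np P σ2 ((k + 1 - n.r) * n.q) :=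
      ⟨by simpa [σ2] using hI3.size, by simpa [σ2] using hI3.new, by simpa [σ2] using hI3.old⟩
    have hpar : ((Expr.ld .L (.v .h / .c 2) (.c 0) (.c 0)).eval σ2 ≠ 0 ↔ g ((k + 1) / 2) ≠ 0) := by
      have : (k + 1) / 2 ≠ k + 1 := by omega
      simp only [Expr.eval_ld, Expr.eval_div, Expr.eval_v, Expr.eval_c, σ2, Mem.put_v, Mem.put_m,
        Mem.set_v, Mem.set_m, if_true, this, false_and, and_false, if_false, true_and, g]
      split_ifs with h0
      · simp [h0, hI2]
      · exact hI1 _ (by omega) (by omega)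
    refine Ok.ite (T₁ := 1 + 1000 * n.q * (g ((k + 1) / 2) + f (k + 1))) ?_ ?_ (by simp; omega)
    · intro hc
      have hg := hpar.1 hc
      refine (visitProg_ok (n := n) (σ := σ2) (B := B) (w := w) (np := np) (h := k + 1) (P := P)
        (((hf'.set _ (by decide)).set _ (by decide)).put _ _ _ _ _) ?_ ?_ ?_ ?_ ?_ ?_ ?_ ?_ ?_ ?_
        hF2).mono ?_ ?_
      · simpa [σ2, hE'] using hf.E
      · simpa [σ2] using hS'
      · simpa [σ2] using hw'
      · simpa [σ2] using hd'
      · simpa [σ2] using hdl'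
      · simp [σ2]
      · omega
      · omega
      · simp [σ2]
      · have hC2 : σ2.m .C = σ.m .C := by funext i j l; simp [σ2, hC']
        have hD2 : σ2.m .D = σ.m .D := by funext i j l; simp [σ2, hD']
        rw [nodeValue_congr hD2 hC2]
        exact hV _ (by omega) (by omega)
      · have : 1000 * n.q * (1 + f (k + 1)) ≤ 1000 * n.q * (g ((k + 1) / 2) + f (k + 1)) :=
          Nat.mul_le_mul_left _ (by omega)
        exact this.trans (by omega)
      · rintro σ3 - - ⟨h1, h2, h3⟩
        refine ⟨fun h h4 h5 => ?_, ?_, h3⟩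
        · rcases Nat.lt_succ_iff_lt_or_eq.1 (Nat.lt_succ_of_le h5) with h6 | rfl
          · rw [h2 h h6.ne]
            simpa [σ2, h6.ne] using hI1 h h4 (by omega)
          · exact h1
        · rw [h2 0 (by omega)]
          simpa [σ2] using hI2
    · intro hc
      have hg : g ((k + 1) / 2) = 0 := by
        by_contra h0
        exact hpar.2 h0 hc
      have hk0 : (k + 1) / 2 ≠ 0 := fun h0 => by simp [g, h0] at hg
      -- Below a node of count zero all counts are zero. So the mark that has just been cleared is
      -- right, and an unvisited leaf needs no scan.
      have hf0 : f (k + 1) = 0 := by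
        refine heapSum_child_eq_zero (by omega) (by omega) ?_
        simpa [g, hk0] using hg
      refine Ok.skip (by omega) ⟨fun h h4 h5 => ?_, by simpa [σ2] using hI2, ?_⟩
      · rcases Nat.lt_succ_iff_lt_or_eq.1 (Nat.lt_succ_of_le h5) with h6 | rfl
        · simpa [σ2, h6.ne] using hI1 h h4 (by omega)
        · simp [σ2, hf0]
      · refine hF2.mono fun x hx => ?_
        by_cases h3 : n.r ≤ k + 1
        · rw [hfd, heapSum_leaf _ (by omega) h3 (by omega), leafCount, Finset.card_eq_zero,
            Finset.filter_eq_empty_iff] at hf0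
          have h5 : ¬ x / n.q = k + 1 - n.r := hf0 hx
          rw [← Nat.div_lt_iff_lt_mul (by omega), ← Nat.div_lt_iff_lt_mul (by omega)]
          omega
        · rw [show k + 1 + 1 - n.r = k + 1 - n.r by omega]
  · simp only [Finset.sum_add_distrib, ← Finset.mul_sum, Finset.sum_const, Finset.card_range,
      smul_eq_mul, Expr.cost_sub, Expr.cost_add, Expr.cost_v, Expr.cost_c]
    have h1 : ∑ k ∈ Finset.range (2 * n.r - 1), f (k + 1) ≤ n.depth * (missing n B w).card := by
      have := sum_heapSum_le (leafCount n B w) (show 0 < n.r by omega)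
      rw [heapSum_one _ (by omega), sum_leafCount, Finset.sum_Ico_eq_sum_range] at this
      simpa [Dim.depth, add_comm 1] using this
    have h2 : ∑ k ∈ Finset.range (2 * n.r - 1), g ((k + 1) / 2) ≤
        2 + 2 * (n.depth * (missing n B w).card) := by
      refine (sum_half_le g n.r).trans ?_
      have h3 : ∑ j ∈ Finset.range n.r, g j = 1 + ∑ k ∈ Finset.range (n.r - 1), f (k + 1) := by
        rw [show n.r = n.r - 1 + 1 by omega, Finset.sum_range_succ', add_comm]
        simp [g]
      have h4 : ∑ k ∈ Finset.range (n.r - 1), f (k + 1) ≤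
          ∑ k ∈ Finset.range (2 * n.r - 1), f (k + 1) :=
        Finset.sum_le_sum_of_subset (Finset.range_subset_range.2 (by omega))
      omega
    set Dm := n.depth * (missing n B w).card with hDm
    have h5 : 1000 * n.q * (∑ k ∈ Finset.range (2 * n.r - 1), g ((k + 1) / 2) +
        ∑ k ∈ Finset.range (2 * n.r - 1), f (k + 1)) ≤ 1000 * n.q * (2 + 3 * Dm) :=
      Nat.mul_le_mul_left _ (by omega)
    have h6 : 3000 * n.q * n.depth * (missing n B w).card = 1000 * n.q * (3 * Dm) := by
      rw [hDm]; ring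
    rw [h6]
    rw [mul_add _ 2] at h5
    have h7 := n.q_pos
    have h8 : (2 * n.r - 1) * 100 + (2 * n.r - 1) * 9 + 100 ≤ 220 * n.q := by omega
    omega
  · rintro σ' - ⟨-, h1, h2⟩
    refine ⟨h1, ?_⟩
    rwa [show 2 * n.r - 1 + 1 - n.r = n.r by omega] at h2

/-! ### Entering the new sums -/

/-- The attained sums after the insertion of `w`. -/
def newSums (n : Dim) (B : Finset ℕ) (w : ℕ) : Finset ℕ :=
  B ∪ (missing n B w).map (addRightEmbedding w)

theorem mem_newSums {n : Dim} {B : Finset ℕ} {w z : ℕ} :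
    z ∈ newSums n B w ↔ z ∈ B ∨ ∃ x ∈ B, x + w = z ∧ z ≤ n.t := by
  simp only [newSums, missing, Finset.mem_union, Finset.mem_map, Finset.mem_filter,
    addRightEmbedding_apply]
  constructor
  · rintro (h | ⟨x, ⟨h1, h2, h3⟩, rfl⟩)
    exacts [Or.inl h, Or.inr ⟨x, h1, rfl, h2⟩]
  · rintro (h | ⟨x, h1, rfl, h2⟩)
    · exact Or.inl h
    · by_cases h3 : x + w ∈ B
      exacts [Or.inl h3, Or.inr ⟨x, ⟨h1, h2, h3⟩, rfl⟩]

theorem disjoint_missing (n : Dim) (B : Finset ℕ) (w : ℕ) :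
    Disjoint B ((missing n B w).map (addRightEmbedding w)) := by
  rw [Finset.disjoint_right]
  intro z hz
  obtain ⟨x, hx, rfl⟩ := Finset.mem_map.1 hz
  exact (Finset.mem_filter.1 hx).2.2

theorem card_newSums (n : Dim) (B : Finset ℕ) (w : ℕ) :
    (newSums n B w).card = B.card + (missing n B w).card := by
  rw [newSums, Finset.card_union_of_disjoint (disjoint_missing n B w), Finset.card_map]

/-- `(y + w) + v = (y + v) + w`: a weight `v` that leads to no new sum now will not do so after
other insertions either. This makes the marks in `K` permanent. -/
theorem closed_newSums {n : Dim} {B : Finset ℕ} (w : ℕ) {v : ℕ}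
    (h : ∀ x ∈ B, x + v ≤ n.t → x + v ∈ B) :
    ∀ x ∈ newSums n B w, x + v ≤ n.t → x + v ∈ newSums n B w := by
  intro x hx hv
  rw [mem_newSums] at hx ⊢
  rcases hx with hx | ⟨y, hy, rfl, -⟩
  · exact Or.inl (h x hx hv)
  · exact Or.inr ⟨y + v, h y hy (by omega), by omega, hv⟩

theorem commitProg_ok {n : Dim} {σ : Mem} {A B : Finset ℕ} {w np : ℕ} {P : ℕ → ℕ → ℕ → ℕ}
    (hAB : A ⊆ B) (hB : B ⊆ Finset.range (n.t + 1))
    (hS : ∀ x, σ.m .S x 0 0 = if x ∈ B then 1 else 0)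
    (hP : (Multiset.range np).map (fun k => P k 0 0) = (B \ A).val)
    (hK : ∀ w ≤ n.t, σ.m .K w 0 0 ≠ 0 → ∀ x ∈ B, x + w ≤ n.t → x + w ∈ B)
    (hw : σ.v .w = w) (hF : Found n B w np P σ (n.r * n.q)) :
    Ok n.M commitProg σ (200 + 100 * (missing n B w).card) fun σ' =>
      Holds n σ' A (newSums n B w) ∧ σ'.v .np = np + (missing n B w).card ∧
      (∀ v, σ.m .K v 0 0 ≠ 0 → σ'.m .K v 0 0 ≠ 0) ∧
      ((missing n B w).card = 0 → σ'.m .K w 0 0 ≠ 0) := by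
  have hfil : (missing n B w).filter (· < n.r * n.q) = missing n B w := by
    refine Finset.filter_true_of_mem fun x hx => ?_
    have := missing_le hx
    have := n.t_lt'
    omega
  have hnn : σ.v .nn = (missing n B w).card := by rw [hF.nn, hfil]
  have hnew := hF.new
  rw [hfil] at hnew
  have hM := n.rq_le
  have ht := n.t_lt'
  have hr := n.r_pos
  have hq := n.q_pos
  have htM : 2 * (n.t + 1) ≤ n.M := by omega
  have hmt := card_missing_le n B w
  have hnp : np ≤ n.t + 1 := by
    have := congrArg Multiset.card hP
    rw [Multiset.card_map, Multiset.card_range, Finset.card_val] at this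
    rw [this]
    simpa using Finset.card_le_card (Finset.sdiff_subset.trans hB)
  refine Ok.seq (T₁ := 50) (T₂ := 140 + 100 * (missing n B w).card)
    (R := fun σ' => (∀ v, σ'.m .K v 0 0 ≠ 0 ↔ σ.m .K v 0 0 ≠ 0 ∨ ((missing n B w).card = 0 ∧ v = w)))
    ?_ ?_ (by omega)
  · refine Ok.ite (T₁ := 30) (fun hc => ?_) (fun hc => ?_) (by simp)
    · simp only [Expr.eval_v, hnn] at hc
      exact Ok.skip (by simp) fun v => by simp [hc]
    · simp only [Expr.eval_v, hnn] at hc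
      refine Ok.store (by simp) (by simp; omega) fun v => ?_
      simp only [Expr.eval_v, Expr.eval_c, hw, hc, Mem.put_m, true_and, and_true]
      by_cases h : v = w
      · simp [h]
      · simp [h]
  · intro σ1 hs1 _ hK1
    have hS1 : ∀ x, σ1.m .S x 0 0 = if x ∈ B then 1 else 0 := by rw [hs1.m _ rfl]; exact hS
    have hP1 : σ1.m .P = σ.m .P := hs1.m _ rfl
    have hnn1 : σ1.v .nn = (missing n B w).card := by rw [hs1.v _ rfl, hnn]
    have hnp1 : σ1.v .np = np := by rw [hs1.v _ rfl, hF.size]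
    refine Ok.seq (T₁ := 20 + 100 * (missing n B w).card) (T₂ := 30) (R := fun σ' =>
      ∀ x, σ'.m .S x 0 0 = if x ∈ newSums n B w then 1 else 0) ?_ ?_ (by omega)
    · refine Ok.loop' (n := (missing n B w).card) 80 (fun k σ' => ∀ x, σ'.m .S x 0 0 =
        if x ∈ B ∨ ∃ j < k, σ.m .P (np + j) 0 0 = x then 1 else 0) ?_ ?_ ?_ ?_ ?_ ?_
      · simp [hnn1]
      · omega
      · simpa using hS1
      · intro k hk σ2 hs2 hI
        have hP2 : σ2.m .P = σ.m .P := by rw [hs2.m _ rfl, hP1]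
        have hnp2 : σ2.v .np = np := by rw [hs2.v _ rfl, hnp1]
        refine Ok.store (by simp) (by simp; omega) fun x => ?_
        simp only [Expr.eval_ld, Expr.eval_add, Expr.eval_v, Expr.eval_c, Mem.put_m, Mem.set_v,
          Mem.set_m, reduceCtorEq, if_false, if_true, hnp2, hP2, true_and, and_true, hI x]
        by_cases h1 : x = σ.m .P (np + k) 0 0
        · rw [if_pos h1, if_pos (Or.inr ⟨k, Nat.lt_succ_self k, h1.symm⟩)]
        · rw [if_neg h1]
          refine if_congr (or_congr_right ?_) rfl rfl
          constructor
          · rintro ⟨j, hj, h⟩; exact ⟨j, by omega, h⟩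
          · rintro ⟨j, hj, h⟩
            refine ⟨j, ?_, h⟩
            have : j ≠ k := fun hjk => h1 (hjk ▸ h.symm)
            omega
      · simp; omega
      · intro σ2 _ hI x
        rw [hI x]
        refine if_congr ?_ rfl rfl
        rw [newSums, Finset.mem_union, ← Finset.mem_val (s := Finset.map _ _), Finset.map_val]
        refine or_congr_right ?_
        change _ ↔ x ∈ Multiset.map (· + w) _
        rw [← hnew, hnn]
        simp [Multiset.mem_map]
    · intro σ2 hs2 _ hS2
      have hP2 : σ2.m .P = σ.m .P := by rw [hs2.m _ rfl, hP1]
      have hnp2 : σ2.v .np = np := by rw [hs2.v _ rfl, hnp1]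
      have hnn2 : σ2.v .nn = (missing n B w).card := by rw [hs2.v _ rfl, hnn1]
      have hK2 : σ2.m .K = σ1.m .K := hs2.m _ rfl
      refine Ok.assign (by simp) (by simp [hnp2, hnn2]; omega) ⟨⟨?_, ?_, ?_, ?_, ?_⟩, ?_, ?_, ?_⟩
      · exact hAB.trans Finset.subset_union_left
      · intro z hz
        rw [mem_newSums] at hz
        rcases hz with hz | ⟨x, hx, rfl, h⟩
        exacts [hB hz, Finset.mem_range.2 (by omega)]
      · simpa using hS2
      · have h1 : newSums n B w \ A = (B \ A).disjUnion ((missing n B w).map (addRightEmbedding w))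
            ((disjoint_missing n B w).mono_left Finset.sdiff_subset) := by
          rw [Finset.disjUnion_eq_union, newSums, Finset.union_sdiff_distrib]
          congr 1
          exact Finset.sdiff_eq_self_of_disjoint ((disjoint_missing n B w).mono_left hAB).symm
        rw [h1, Finset.disjUnion_val, Finset.map_val, ← hP]
        change _ = _ + Multiset.map (· + w) _
        rw [← hnew, hnn]
        simp only [Expr.eval_add, Expr.eval_v, Mem.set_v, Mem.set_m, if_true, hnp2, hnn2, hP2,
          Multiset.range_add, Multiset.map_add, Multiset.map_map, Function.comp_def]
        congr 1
        exact Multiset.map_congr rfl fun k hk => hF.old k (Multiset.mem_range.1 hk)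
      · intro v hv hKv
        simp only [Mem.set_m, hK2] at hKv
        refine closed_newSums w ?_
        rcases (hK1 v).1 hKv with h | ⟨h, rfl⟩
        · exact hK v hv h
        · intro x hx hxv
          by_contra hn
          rw [Finset.card_eq_zero] at h
          exact Finset.notMem_empty x (h ▸ Finset.mem_filter.2 ⟨hx, hxv, hn⟩)
      · simp [hnp2, hnn2]
      · intro v hv
        simp only [Mem.set_m, hK2]
        exact (hK1 v).2 (Or.inl hv)
      · intro h0
        simp only [Mem.set_m, hK2]
        exact (hK1 w).2 (Or.inr ⟨h0, rfl⟩)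

/-! ### Renewing the snapshot -/

theorem evalF_insert {p q : ℕ} {A : Finset ℕ} {y : ℕ} (hy : y ∉ A) (u a : ℕ) :
    evalF p q (insert y A) u a = evalF p q A u a + if y / q = u then root p a ^ (y % q) else 0 := by
  rw [evalF, evalF, Finset.filter_insert]
  split_ifs with h
  · rw [Finset.sum_insert (fun h => hy (Finset.mem_filter.1 h).1), add_comm]
  · rw [add_zero]

theorem evalG_insert {p q : ℕ} {A : Finset ℕ} {y : ℕ} (hy : y ∉ A) (u a : ℕ) :
    evalG p q (insert y A) u a =
      evalG p q A u a + if y / q = u then root p a ^ (p - 1 - y % q) else 0 := by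
  rw [evalG, evalG, Finset.filter_insert]
  split_ifs with h
  · rw [Finset.sum_insert (fun h => hy (Finset.mem_filter.1 h).1), add_comm]
  · rw [add_zero]

theorem evalG_sdiff_insert {p q : ℕ} {U A : Finset ℕ} {y : ℕ} (hU : y ∈ U) (hy : y ∉ A)
    (u a : ℕ) : evalG p q (U \ insert y A) u a =
      evalG p q (U \ A) u a - if y / q = u then root p a ^ (p - 1 - y % q) else 0 := by
  have h : U \ A = insert y (U \ insert y A) := by
    ext z
    by_cases hz : z = y
    · subst hz; simp [hU, hy]
    · simp [hz]
  rw [h, evalG_insert (by simp), add_sub_cancel_right]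

theorem evalProg_ok {n : Dim} {σ : Mem} {A B : Finset ℕ} (hf : Fixed n σ) (ht : Tables n σ A)
    (hB : Holds n σ A B) :
    Ok n.M evalProg σ (20 + 2000 * n.q * σ.v .np) fun σ' =>
      (∀ x, σ'.m .N x 0 0 = if x ∈ B then 1 else 0) ∧
      (∀ u, ∀ a < n.p - 1, (σ'.m .F u a 0 : ZMod (n.p * n.p)) = evalF n.p n.q B u a) ∧
      (∀ u, ∀ a < n.p - 1, (σ'.m .G u a 0 : ZMod (n.p * n.p)) =
        evalG n.p n.q (Finset.range (n.t + 1) \ B) u a) := by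
  have hp := n.p_le'
  have hqp := n.two_q_lt
  have hpM := n.p_sq_le
  have hq := n.q_pos
  have hM0 : 0 < n.M := by omega
  have hrq := n.rq_le
  have htq := n.t_lt'
  have hcM : ((n.M : ℕ) : ZMod (n.p * n.p)) = 0 := ZMod.natCast_self _
  have hnodup : ((Multiset.range (σ.v .np)).map (fun k => σ.m .P k 0 0)).Nodup := by
    rw [hB.P]; exact (B \ A).nodup
  have hinj := Multiset.inj_on_of_nodup_map hnodup
  -- The snapshot after `k` entries of the list. The equation of multisets in `Holds.P` makes the
  -- entries distinct and new, so each evaluation receives each element exactly once.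
  let Ak : ℕ → Finset ℕ := fun k => A ∪ (Finset.range k).image fun j => σ.m .P j 0 0
  have hAk : ∀ k, Ak (k + 1) = insert (σ.m .P k 0 0) (Ak k) := by
    intro k
    simp only [Ak, Finset.range_add_one, Finset.image_insert, Finset.union_insert]
  have hnotMem : ∀ k < σ.v .np, σ.m .P k 0 0 ∉ Ak k := by
    intro k hk hmem
    rcases Finset.mem_union.1 hmem with h | h
    · exact (Finset.mem_sdiff.1 (hB.P_mem hk)).2 h
    · obtain ⟨j, hj, h⟩ := Finset.mem_image.1 h
      have hj := Finset.mem_range.1 hj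
      have := hinj j (Multiset.mem_range.2 (by omega)) k (Multiset.mem_range.2 hk) h
      omega
  have hlast : Ak (σ.v .np) = B := by
    have h1 : (Finset.range (σ.v .np)).image (fun j => σ.m .P j 0 0) = B \ A := by
      ext x
      rw [← Finset.mem_val (s := B \ A), ← hB.P]
      simp
    simp only [Ak, h1]
    exact Finset.union_sdiff_of_subset hB.sub
  refine Ok.loop' (n := σ.v .np) (70 + 1400 * n.q) (fun k σ' =>
      (∀ x, σ'.m .N x 0 0 = if x ∈ Ak k then 1 else 0) ∧
      (∀ u, ∀ a < n.p - 1, (σ'.m .F u a 0 : ZMod (n.p * n.p)) = evalF n.p n.q (Ak k) u a) ∧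
      (∀ u, ∀ a < n.p - 1, (σ'.m .G u a 0 : ZMod (n.p * n.p)) =
        evalG n.p n.q (Finset.range (n.t + 1) \ Ak k) u a)) ?_ ?_ ?_ ?_ ?_ ?_
  · simp
  · have := hB.np_le; omega
  · have h0 : Ak 0 = A := by simp [Ak]
    rw [h0]
    exact ⟨ht.N, ht.F, ht.G⟩
  · intro k hk σ1 hs1 ⟨hN, hFk, hGk⟩
    have hf1 : Fits n σ1 := hf.toFits.of_same hs1 (by decide)
    have hP1 : σ1.m .P = σ.m .P := hs1.m _ rfl
    have hE1 : σ1.m .E = σ.m .E := hs1.m _ rfl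
    have hy := hB.P_le hk
    have hyq := Nat.mod_lt (σ.m .P k 0 0) (show 0 < n.q by omega)
    refine Ok.assign_seq (T₂ := 40 + 1400 * n.q) ?_ ?_ (by simp; omega)
    · simp [hP1]; omega
    simp only [Expr.eval_ld, Expr.eval_v, Expr.eval_c, Mem.set_m, Mem.set_v, hP1, if_true]
    set y := σ.m .P k 0 0 with hyd
    refine Ok.store_seq (T₂ := 10 + 1400 * n.q) ?_ ?_ (by simp; omega)
    · simp; omega
    simp only [Expr.eval_v, Expr.eval_c, Mem.set_v, if_true]
    set σ2 := ((σ1.set .k k).set .y y).put .N y 0 0 1 with hσ2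
    have hf2 : Fits n σ2 := ((hf1.set _ (by decide)).set _ (by decide)).put _ _ _ _ _
    refine Ok.loop' (n := n.p - 1) 320 (fun a σ' =>
      (∀ u, ∀ b < n.p - 1, (σ'.m .F u b 0 : ZMod (n.p * n.p)) = evalF n.p n.q (Ak k) u b +
        if b < a ∧ y / n.q = u then root n.p b ^ (y % n.q) else 0) ∧
      (∀ u, ∀ b < n.p - 1, (σ'.m .G u b 0 : ZMod (n.p * n.p)) =
        evalG n.p n.q (Finset.range (n.t + 1) \ Ak k) u b -
          if b < a ∧ y / n.q = u then root n.p b ^ (n.p - 1 - y % n.q) else 0)) ?_ ?_ ?_ ?_ ?_ ?_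
    · simp [hf2.p1]
    · omega
    · refine ⟨fun u b hb => ?_, fun u b hb => ?_⟩
      · simpa [σ2] using hFk u b hb
      · simpa [σ2] using hGk u b hb
    · intro a ha σ3 hs3 ⟨hF3, hG3⟩
      have hf3 : Fits n σ3 := hf2.of_same hs3 (by decide)
      have hy3 : σ3.v .y = y := by rw [hs3.v _ rfl]; simp [σ2]
      have hE3 : ∀ b < n.p - 1, ∀ k < n.p,
          (σ3.m .E b k 0 : ZMod (n.p * n.p)) = root n.p b ^ k := by
        rw [hs3.m _ rfl]; simpa [σ2, hE1] using hf.E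
      refine Ok.of_bdd fun hb3 => ?_
      have hEM : σ3.m .E a (n.p - 1 - y % n.q) 0 ≤ n.M := hb3.m _ _ _ _
      refine Ok.store_seq (T₂ := 150) ?_ (Ok.store (by simp) ?_ ?_) (by simp)
      · simp [hf3.M, (Nat.mod_lt _ hM0).le]
      · simp [hf3.M, (Nat.mod_lt _ hM0).le]
      · simp only [Expr.eval_mod, Expr.eval_add, Expr.eval_sub, Expr.eval_div, Expr.eval_v,
          Expr.eval_c, Expr.eval_ld, Mem.set_v, Mem.set_m, Mem.put_v, Mem.put_m, reduceCtorEq,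
          if_false, if_true, hf3.M, hf3.q, hf3.p1, hy3, true_and, and_true, false_and]
        refine ⟨fun u b hb => ?_, fun u b hb => ?_⟩
        · by_cases hu : y / n.q = u
          · by_cases hba : b = a
            · subst hba
              rw [if_pos ⟨hu.symm, rfl⟩, if_pos ⟨Nat.lt_succ_self b, hu⟩, Dim.M, ZMod.natCast_mod,
                Nat.cast_add, hF3 _ b hb, hE3 b hb _ (by omega), if_neg (by simp), add_zero, hu]
            · rw [if_neg (fun h => hba h.2), hF3 u b hb]
              congr 1
              exact if_congr (and_congr_left' (by omega)) rfl rfl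
          · rw [if_neg (fun h => hu h.1.symm), hF3 u b hb, if_neg (fun h => hu h.2),
              if_neg (fun h => hu h.2)]
        · by_cases hu : y / n.q = u
          · by_cases hba : b = a
            · subst hba
              rw [if_pos ⟨hu.symm, rfl⟩, if_pos ⟨Nat.lt_succ_self b, hu⟩, Dim.M, ZMod.natCast_mod,
                Nat.cast_add, Nat.cast_sub (by rw [Dim.M] at hEM; exact hEM), hG3 _ b hb,
                hE3 b hb _ (by omega), if_neg (by simp), sub_zero, hu]
              rw [Dim.M] at hcM
              rw [hcM]
              ring
            · rw [if_neg (fun h => hba h.2), hG3 u b hb]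
              congr 1
              exact if_congr (and_congr_left' (by omega)) rfl rfl
          · rw [if_neg (fun h => hu h.1.symm), hG3 u b hb, if_neg (fun h => hu h.2),
              if_neg (fun h => hu h.2)]
    · simp; omega
    · intro σ3 hs3 ⟨hF3, hG3⟩
      refine ⟨fun x => ?_, fun u a ha => ?_, fun u a ha => ?_⟩
      · rw [hs3.m _ rfl]
        simp only [σ2, Mem.put_m, Mem.set_m, hN, hAk, Finset.mem_insert, true_and, and_true]
        by_cases hx : x = y
        · simp [hx, hyd]
        · simp [hx, ← hyd]
      · rw [hF3 u a ha, hAk, evalF_insert (hnotMem k hk)]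
        simp [ha, hyd]
      · rw [hG3 u a ha, hAk, evalG_sdiff_insert (Finset.mem_range.2 (by omega)) (hnotMem k hk)]
        simp [ha, hyd]
  · simp only [Expr.cost_v]
    have : σ.v .np * (70 + 1400 * n.q + 9) ≤ σ.v .np * (2000 * n.q) := Nat.mul_le_mul_left _ (by omega)
    rw [mul_comm (2000 * n.q)]
    omega
  · intro σ' _ hI
    rwa [hlast] at hI

/-- There are about `2 * r` nodes, `r + 1` offsets and `p - 1` roots, hence `O(q ^ 2)` entries
because `q = r ^ 2`. Spread over the `q` new sums between two renewals, this is `O(q)` for each.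
Decreasing order of the nodes puts children first. -/
theorem tableProg_ok {n : Dim} {σ : Mem} (hf : Fits n σ) {f g : ℕ → ℕ → ZMod (n.p * n.p)}
    (hF : ∀ u, ∀ a < n.p - 1, (σ.m .F u a 0 : ZMod (n.p * n.p)) = f u a)
    (hG : ∀ u, ∀ a < n.p - 1, (σ.m .G u a 0 : ZMod (n.p * n.p)) = g u a) :
    Ok n.M tableProg σ (2000 * n.q * n.q) fun σ' => ∀ h, 0 < h → h < 2 * n.r → ∀ d ≤ n.r,
      ∀ a < n.p - 1, (σ'.m .C h d a : ZMod (n.p * n.p)) =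
        heapSum n.r (fun u => f u a * g (u + d) a) h := by
  have hr := n.r_pos
  have hrq := n.two_r_le_q
  have hq := n.q_pos
  have hqp := n.two_q_lt
  have hp := n.p_le'
  have hpM := n.p_sq_le
  have hM0 : 0 < n.M := by omega
  have t1 : (n.p - 1) * 109 + 7 ≤ 440 * n.q := by omega
  have t2 : (n.r + 1) * (440 * n.q + 9) ≤ 750 * (n.r * n.q) := by nlinarith
  have t3 : 2 * n.r * (800 * (n.r * n.q)) ≤ 1600 * n.q * n.q := by
    rw [show 1600 * n.q * n.q = 2 * n.r * (800 * (n.r * n.q)) by simp only [Dim.q]; ring]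
  have hrq2 : 2 * 4 ≤ n.r * n.q := Nat.mul_le_mul hr hq
  have hqq : 4 * n.q ≤ n.q * n.q := Nat.mul_le_mul_right _ hq
  let H : ℕ → ℕ → ℕ → Mem → Prop := fun h d a σ' =>
    (σ'.m .C h d a : ZMod (n.p * n.p)) = heapSum n.r (fun u => f u a * g (u + d) a) h
  refine Ok.loop' (n := 2 * n.r - 1) (770 * (n.r * n.q)) (fun k σ' =>
    ∀ h, 2 * n.r - 1 - k < h → h < 2 * n.r → ∀ d ≤ n.r, ∀ a < n.p - 1, H h d a σ') ?_ ?_ ?_ ?_ ?_ ?_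
  · simp [hf.r, two_mul]
  · omega
  · intro h h1 h2; omega
  · intro k hk σ1 hs1 hI1
    have hf1 : Fits n σ1 := hf.of_same hs1 (by decide)
    set h := 2 * n.r - 1 - k with hh
    have he : (Expr.v .r + .v .r - .c 1 - .v .k).eval (σ1.set .k k) = h := by
      simp [hf1.r]; omega
    refine Ok.assign_seq (T₂ := 760 * (n.r * n.q)) ?_ ?_ (by simp; omega)
    · rw [he]; omega
    rw [he]
    refine Ok.loop' (n := n.r + 1) (440 * n.q) (fun d σ' =>
      (∀ h', h < h' → h' < 2 * n.r → ∀ d ≤ n.r, ∀ a < n.p - 1, H h' d a σ') ∧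
      ∀ d' < d, ∀ a < n.p - 1, H h d' a σ') ?_ ?_ ?_ ?_ ?_ ?_
    · simp [hf1.r]
    · omega
    · exact ⟨by simpa [H] using hI1, by simp⟩
    · intro d hd σ2 hs2 ⟨hI2, hJ2⟩
      have hf2 : Fits n σ2 := ((hf1.set _ (by decide)).set _ (by decide)).of_same hs2 (by decide)
      have hh2 : σ2.v .h = h := by rw [hs2.v _ rfl]; simp
      have hF2 : σ2.m .F = σ.m .F := by rw [hs2.m _ rfl]; simp [hs1.m .F rfl]
      have hG2 : σ2.m .G = σ.m .G := by rw [hs2.m _ rfl]; simp [hs1.m .G rfl]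
      refine Ok.loop' (n := n.p - 1) 100 (fun a σ' =>
        (∀ h', h < h' → h' < 2 * n.r → ∀ d ≤ n.r, ∀ a < n.p - 1, H h' d a σ') ∧
        (∀ d' < d, ∀ a < n.p - 1, H h d' a σ') ∧ ∀ a' < a, H h d a' σ') ?_ ?_ ?_ ?_ ?_ ?_
      · simp [hf2.p1]
      · omega
      · exact ⟨by simpa [H] using hI2, by simpa [H] using hJ2, by simp⟩
      · intro a ha σ3 hs3 ⟨hI3, hJ3, hK3⟩
        have hf3 : Fits n σ3 := (hf2.set _ (by decide)).of_same hs3 (by decide)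
        have hh3 : σ3.v .h = h := by rw [hs3.v _ rfl]; simpa using hh2
        have hd3 : σ3.v .d = d := by rw [hs3.v _ rfl]; simp
        have hF3 : σ3.m .F = σ.m .F := by rw [hs3.m _ rfl]; simpa using hF2
        have hG3 : σ3.m .G = σ.m .G := by rw [hs3.m _ rfl]; simpa using hG2
        -- Leaves and inner nodes differ only in the expression that is stored; its effect on the
        -- invariant is settled here for both.
        have fin : ∀ e : Expr, e.cost ≤ 73 → e.eval (σ3.set .a a) < n.M →
            ((e.eval (σ3.set .a a) : ℕ) : ZMod (n.p * n.p)) =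
              heapSum n.r (fun u => f u a * g (u + d) a) h →
            Ok n.M (.store .C (.v .h) (.v .d) (.v .a) e) (σ3.set .a a) 93 fun σ' =>
              (∀ h', h < h' → h' < 2 * n.r → ∀ d ≤ n.r, ∀ a < n.p - 1, H h' d a σ') ∧
              (∀ d' < d, ∀ a < n.p - 1, H h d' a σ') ∧ ∀ a' < a + 1, H h d a' σ' := by
          intro e hc hlt he
          refine Ok.store (by simp; omega) hlt.le ⟨?_, ?_, ?_⟩
          · intro h' h1 h2 d' h3 a' h4
            simp only [H, Mem.put_m, Expr.eval_v, Mem.set_v, Mem.set_m, reduceCtorEq, if_false, hh3,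
              h1.ne', false_and, and_false]
            exact hI3 h' h1 h2 d' h3 a' h4
          · intro d' h1 a' h2
            simp only [H, Mem.put_m, Expr.eval_v, Mem.set_v, Mem.set_m, reduceCtorEq, if_false, hd3,
              h1.ne, false_and, and_false]
            exact hJ3 d' h1 a' h2
          · intro a' h1
            simp only [H, Mem.put_m, Expr.eval_v, Mem.set_v, Mem.set_m, reduceCtorEq, if_false, hd3,
              hh3, true_and, if_true]
            split_ifs with h2
            · rw [he, h2]
            · exact hK3 a' (by omega)
        refine Ok.ite (T₁ := 93) (fun hc => ?_) (fun hc => ?_) (by simp)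
        · have hhr : h < n.r := by
            by_contra h1
            simp [hh3, hf3.r, h1] at hc
          refine fin _ (by simp) (by simp [hf3.M, Nat.mod_lt _ hM0]) ?_
          simp only [Expr.eval_mod, Expr.eval_add, Expr.eval_v, Expr.eval_c,
            Expr.eval_ld, Mem.set_v, Mem.set_m, reduceCtorEq, if_false, if_true, hh3, hd3, hf3.M]
          rw [Dim.M, ZMod.natCast_mod, Nat.cast_add, heapSum_node _ (by omega) hhr, ← two_mul,
            hI3 (2 * h) (by omega) (by omega) d (by omega) a ha,
            hI3 (2 * h + 1) (by omega) (by omega) d (by omega) a ha]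
        · have hhr : n.r ≤ h := by
            by_contra h1
            simp [hh3, hf3.r] at hc
            omega
          refine fin _ (by simp) (by simp [hf3.M, Nat.mod_lt _ hM0]) ?_
          simp only [Expr.eval_mod, Expr.eval_add, Expr.eval_mul, Expr.eval_sub, Expr.eval_v,
            Expr.eval_c, Expr.eval_ld, Mem.set_v, Mem.set_m, reduceCtorEq, if_false, if_true, hh3,
            hd3, hf3.M, hf3.r, hF3, hG3]
          rw [Dim.M, ZMod.natCast_mod, Nat.cast_mul, heapSum_leaf _ (by omega) hhr (by omega),
            hF _ a ha, hG _ a ha]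
      · simp; omega
      · rintro σ3 - ⟨h1, h2, h3⟩
        refine ⟨h1, fun d' hd' a ha => ?_⟩
        rcases Nat.lt_succ_iff_lt_or_eq.1 hd' with h4 | rfl
        exacts [h2 d' h4 a ha, h3 a ha]
    · simp; omega
    · rintro σ2 - ⟨h1, h2⟩ h' h3 h4 d hd a ha
      by_cases h5 : h' = h
      · rw [h5]; exact h2 d (by omega) a ha
      · exact h1 h' (by omega) h4 d hd a ha
  · have : (2 * n.r - 1) * (770 * (n.r * n.q) + 9) ≤ 2 * n.r * (800 * (n.r * n.q)) :=
      Nat.mul_le_mul (by omega) (by omega)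
    have h2 : 1600 * n.q * n.q = 1600 * (n.q * n.q) := by ring
    have h3 : 2000 * n.q * n.q = 2000 * (n.q * n.q) := by ring
    simp; omega
  · exact fun σ' _ hI h h1 h2 d hd a ha => hI h (by omega) h2 d hd a ha

theorem rebuildProg_ok {n : Dim} {σ : Mem} {A B : Finset ℕ} (hf : Fixed n σ) (ht : Tables n σ A)
    (hB : Holds n σ A B) :
    Ok n.M rebuildProg σ (100 + 2000 * n.q * σ.v .np + 2000 * n.q * n.q) fun σ' =>
      Tables n σ' B ∧ Holds n σ' B B ∧ σ'.v .np = 0 := by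
  refine Ok.seq (evalProg_ok hf ht hB) (T₂ := 20 + 2000 * n.q * n.q) ?_ (by omega)
  intro σ1 hs1 _ ⟨hN, hF, hG⟩
  have hf1 : Fits n σ1 := hf.toFits.of_same hs1 (by decide)
  refine Ok.assign_seq (T₂ := 2000 * n.q * n.q) (by simp) ?_ (by simp)
  refine Ok.mono (tableProg_ok (hf1.set _ (by decide)) (f := evalF n.p n.q B)
    (g := evalG n.p n.q (Finset.range (n.t + 1) \ B)) (by simpa using hF) (by simpa using hG)) le_rfl
    fun σ2 hs2 _ hC => ?_
  have hS : σ2.m .S = σ.m .S := by rw [hs2.m _ rfl]; simp [hs1.m .S rfl]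
  have hK : σ2.m .K = σ.m .K := by rw [hs2.m _ rfl]; simp [hs1.m .K rfl]
  have hnp : σ2.v .np = 0 := by rw [hs2.v _ rfl]; simp
  refine ⟨⟨?_, ?_, ?_, hC⟩, ⟨subset_rfl, hB.le, by rw [hS]; exact hB.S, ?_,
    by rw [hK]; exact hB.K⟩, hnp⟩
  · rw [hs2.m _ rfl]; simpa using hN
  · rw [hs2.m _ rfl]; simpa using hF
  · rw [hs2.m _ rfl]; simpa using hG
  · rw [hnp]; simp

theorem Tables.of_same {n : Dim} {c : Prog} {σ σ' : Mem} {A : Finset ℕ} (h : Tables n σ A)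
    (hs : Same c σ σ') (hc : ∀ a ∈ [Arr.N, .F, .G, .C], c.stores a = false) : Tables n σ' A := by
  simp only [List.forall_mem_cons] at hc
  obtain ⟨h1, h2, h3, h4, -⟩ := hc
  exact ⟨by rw [hs.m _ h1]; exact h.N, by rw [hs.m _ h2]; exact h.F, by rw [hs.m _ h3]; exact h.G,
    by rw [hs.m _ h4]; exact h.C⟩

/-! ### Insertions -/

/-- An upper bound for the running time of an insertion of a weight that is not marked. -/
def addTime (n : Dim) (np m : ℕ) : ℕ :=
  10000 * n.q + 5000 * n.q * n.depth * m +
    if np + m < n.q then 0 else 5000 * n.q * (np + m)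

theorem addProg_ok {n : Dim} {σ : Mem} {A B : Finset ℕ} {w : ℕ} (hf : Fixed n σ)
    (ht : Tables n σ A) (hB : Holds n σ A B) (hnp : σ.v .np < n.q) (hw : σ.v .w = w)
    (hwt : w ≤ n.t) :
    Ok n.M addProg σ (addTime n (σ.v .np) (missing n B w).card) fun σ' =>
      (∃ A', Fixed n σ' ∧ Tables n σ' A' ∧ Holds n σ' A' (newSums n B w)) ∧
      σ'.v .np = (if σ.v .np + (missing n B w).card < n.q then
        σ.v .np + (missing n B w).card else 0) ∧
      (∀ v, σ.m .K v 0 0 ≠ 0 → σ'.m .K v 0 0 ≠ 0) ∧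
      ((missing n B w).card = 0 → σ'.m .K w 0 0 ≠ 0) := by
  have hr := n.r_pos
  have hq := n.q_pos
  have hrq := n.two_r_le_q
  have hrq' := n.rq_le
  have htq := n.t_lt'
  have hqM : n.q ≤ n.M := by have := n.two_q_lt; have := n.p_sq_le; omega
  set m := (missing n B w).card with hm
  set np := σ.v .np with hnpd
  set Tr := if np + m < n.q then 0 else 5000 * n.q * (np + m) with hTr
  have hwM : w ≤ n.M := by omega
  have hd : (Expr.v .w / .v .q).eval σ = w / n.q := by simp [hw, hf.q]
  have hdl : (Expr.v .w % .v .q).eval (σ.set .d (w / n.q)) = w % n.q := by simp [hw, hf.q]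
  have hdep : 3000 * n.q * n.depth * m + 100 * m ≤ 3100 * n.q * n.depth * m := by
    have h1 : 1 ≤ n.q * n.depth := Nat.one_le_iff_ne_zero.2
      (Nat.mul_ne_zero (by omega) (by simp [Dim.depth]))
    have h2 : 1 * m ≤ n.q * n.depth * m := Nat.mul_le_mul_right _ h1
    nlinarith
  set U := n.q * n.depth * m with hU
  have e1 : 3000 * n.q * n.depth * m = 3000 * U := by rw [hU]; ring
  have e2 : 3100 * n.q * n.depth * m = 3100 * U := by rw [hU]; ring
  have e3 : 5000 * n.q * n.depth * m = 5000 * U := by rw [hU]; ring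
  unfold addTime
  rw [← hTr, e3]
  rw [e1, e2] at hdep
  refine Ok.assign_seq (T₂ := 9900 * n.q + 5000 * U + Tr) ?_ ?_ (by simp; omega)
  · rw [hd]; exact (Nat.div_le_self _ _).trans hwM
  rw [hd]
  refine Ok.assign_seq (T₂ := 9800 * n.q + 5000 * U + Tr) ?_ ?_ (by simp; omega)
  · rw [hdl]; exact (Nat.mod_le _ _).trans hwM
  rw [hdl]
  refine Ok.assign_seq (T₂ := 9700 * n.q + 5000 * U + Tr) (by simp) ?_ (by simp; omega)
  set σ0 := ((σ.set .d (w / n.q)).set .dl (w % n.q)).set .nn ((Expr.c 0).eval _) with hσ0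
  have hf0 : Fits n σ0 :=
    ((hf.toFits.set _ (by decide)).set _ (by decide)).set _ (by decide)
  have hm0 : σ0.m = σ.m := rfl
  have hnp0 : σ0.v .np = np := rfl
  have hw0 : σ0.v .w = w := hw
  have hB0 : Holds n σ0 A B := ⟨hB.sub, hB.le, hB.S, hB.P, hB.K⟩
  refine Ok.seq (corrProg_ok hf0 (by rw [hm0]; exact ht.N) hB0 hw0)
    (T₂ := 8400 * n.q + 5000 * U + Tr) ?_ (by rw [hnp0]; omega)
  intro σ1 hs1 _ hD1
  have hf1 : Fits n σ1 := hf0.of_same hs1 (by decide)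
  refine Ok.seq (heapProg_ok hf1 _ hD1) (T₂ := 8100 * n.q + 5000 * U + Tr) ?_ (by omega)
  intro σ2 hs2 _ hD2
  have hL2 : σ2.m .L = σ.m .L := by rw [hs2.m _ rfl, hs1.m _ rfl, hm0]
  have hE2 : σ2.m .E = σ.m .E := by rw [hs2.m _ rfl, hs1.m _ rfl, hm0]
  have hS2 : σ2.m .S = σ.m .S := by rw [hs2.m _ rfl, hs1.m _ rfl, hm0]
  have hP2 : σ2.m .P = σ.m .P := by rw [hs2.m _ rfl, hs1.m _ rfl, hm0]
  have hK2 : σ2.m .K = σ.m .K := by rw [hs2.m _ rfl, hs1.m _ rfl, hm0]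
  have hv2 : ∀ x ∈ [Var.w, .d, .dl, .np, .nn], σ2.v x = σ0.v x := by
    intro x hx
    rw [hs2.v x (by revert hx; revert x; decide), hs1.v x (by revert hx; revert x; decide)]
  have hf2 : Fixed n σ2 := ⟨hf1.of_same hs2 (by decide), by rw [hE2]; exact hf.E,
    by rw [hL2]; exact hf.L⟩
  have ht2 : Tables n σ2 A :=
    Tables.of_same (Tables.of_same (σ := σ0) ⟨ht.N, ht.F, ht.G, ht.C⟩ hs1 (by decide)) hs2
      (by decide)
  have hw2 : σ2.v .w = w := (hv2 _ (by decide)).trans hw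
  have hnp2 : σ2.v .np = np := hv2 _ (by decide)
  have hF2 : Found n B w np (σ.m .P) σ2 0 := by
    refine ⟨hnp2, ?_, fun k _ => by rw [hP2]⟩
    rw [hv2 .nn (by decide)]
    simp [σ0]
  refine Ok.seq (searchProg_ok hf2 (by rw [hS2]; exact hB.S) hw2 (hv2 _ (by decide))
    (hv2 _ (by decide)) (fun h h1 h2 => nodeValue_eq hB.sub hB.le ht2 hwt h1 h2 (hD2 h h1 h2)) hF2)
    (T₂ := 5500 * n.q + 100 * m + Tr) ?_ (by rw [e1]; omega)
  intro σ3 hs3 _ ⟨hL3, hF3⟩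
  have hf3 : Fixed n σ3 := hf2.of_same hs3 (by decide) rfl hL3
  have ht3 : Tables n σ3 A := ht2.of_same hs3 (by decide)
  have hS3 : σ3.m .S = σ.m .S := by rw [hs3.m _ rfl, hS2]
  have hK3 : σ3.m .K = σ.m .K := by rw [hs3.m _ rfl, hK2]
  refine Ok.seq (commitProg_ok hB.sub hB.le (by rw [hS3]; exact hB.S) hB.P
    (by rw [hK3]; exact hB.K) ((hs3.v _ rfl).trans hw2) hF3) (T₂ := 5300 * n.q + Tr) ?_ (by omega)
  intro σ4 hs4 _ ⟨hB4, hnp4, hK4, hK4'⟩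
  rw [hK3] at hK4
  have hf4 : Fixed n σ4 := hf3.of_same hs4 (by decide) rfl (by rw [hs4.m _ rfl]; exact hL3)
  have ht4 : Tables n σ4 A := ht3.of_same hs4 (by decide)
  refine Ok.ite (T₁ := 5000 * n.q + Tr) (fun hc => ?_) (fun hc => ?_) (by simp; omega)
  · have hlt : np + m < n.q := by
      by_contra h
      simp [hnp4, ← hm, hf4.q] at hc
      omega
    refine Ok.skip (by omega) ⟨⟨A, hf4, ht4, hB4⟩, ?_, hK4, hK4'⟩
    rw [if_pos hlt, hnp4]
  · have hlt : ¬ np + m < n.q := by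
      intro h
      simp [hnp4, ← hm, hf4.q] at hc
      omega
    refine Ok.mono (rebuildProg_ok hf4 ht4 hB4) ?_ ?_
    · rw [hTr, if_neg hlt, hnp4, ← hm]
      -- A renewal takes place only after at least `q` new sums, which pay for the quadratic cost of
      -- the tables.
      have : n.q * n.q ≤ n.q * (np + m) := Nat.mul_le_mul_left _ (by omega)
      nlinarith
    · rintro σ5 hs5 - ⟨ht5, hB5, hnp5⟩
      have hK5 : σ5.m .K = σ4.m .K := hs5.m _ rfl
      refine ⟨⟨_, hf4.of_same hs5 (by decide) rfl (by rw [hs5.m _ rfl]; exact hf4.L), ht5, hB5⟩,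
        ?_, by rw [hK5]; exact hK4, by rw [hK5]; exact hK4'⟩
      rw [if_neg hlt, hnp5]

/-! ### The preprocessing -/

theorem Dim.r_sub_one_le (n : Dim) : n.r ≤ n.t + 1 := by
  have h1 := n.le_t
  have h2 := n.r_pos
  have h3 : 1 * (n.r - 1) ≤ (n.r - 1) * (n.r - 1) := Nat.mul_le_mul_right _ (by omega)
  have h4 : (n.r - 1) * 1 ≤ (n.r - 1) * (n.r - 1) * (n.r - 1) := by
    rw [mul_comm]; exact Nat.mul_le_mul (by omega) (by omega)
  omega

/-- An upper bound for the running time of the preprocessing, up to a factor. -/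
def Dim.work (n : Dim) : ℕ := n.r * n.q * n.q

theorem Dim.sq_le_work (n : Dim) : n.q * n.q * 2 ≤ n.work := by
  rw [work, mul_comm, mul_assoc]; exact Nat.mul_le_mul_right _ n.r_pos

theorem Dim.t_lt_work (n : Dim) : (n.t + 1) * n.q ≤ n.work := Nat.mul_le_mul_right _ n.t_lt'

theorem Dim.q_le_sq (n : Dim) : 4 * n.q ≤ n.q * n.q := Nat.mul_le_mul_right _ n.q_pos

/-- Brute force is affordable. The cube root is found by counting up, and the prime by trial
division of at most `2 * q + 1` candidates in time `O(q)` each. `hmin` is needed because the program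
settles on the first prime above `2 * q`. -/
theorem paramProg_ok {n : Dim} {σ : Mem} (hmin : ∀ p : ℕ, p.Prime → 2 * n.q < p → n.p ≤ p)
    (hio : σ.v .io = n.t) :
    Ok n.M paramProg σ (10000 * n.work) fun σ' => Fits n σ' := by
  have hr := n.r_pos
  have hrq := n.two_r_le_q
  have hq := n.q_pos
  have hqp := n.two_q_lt
  have hp := n.p_le'
  have hpM := n.p_sq_le
  have hrM := n.rq_le
  have ht := n.t_lt'
  have hrt := n.r_sub_one_le
  have w1 := n.sq_le_work
  have w2 := n.t_lt_work
  have w3 := n.q_le_sq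
  have w4 : 4 * (n.t + 1) ≤ (n.t + 1) * n.q := by rw [mul_comm]; exact Nat.mul_le_mul_left _ hq
  refine Ok.assign_seq (T₂ := 9900 * n.work) (by simp [hio]; omega) ?_ (by simp; omega)
  refine Ok.assign_seq (T₂ := 9800 * n.work) (by simp) ?_ (by simp; omega)
  simp only [Expr.eval_v, Expr.eval_c, hio]
  set σ0 := (σ.set .t n.t).set .r 0 with hσ0
  refine Ok.seq (T₁ := 100 * n.work) (T₂ := 9600 * n.work)
    (R := fun σ' => σ'.v .r = n.r) ?_ ?_ (by omega)
  · refine Ok.loop' (n := n.t + 1) 50 (fun k σ' => σ'.v .r = min k n.r) ?_ ?_ ?_ ?_ ?_ ?_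
    · simp [σ0]
    · omega
    · simp [σ0]
    · intro k hk σ1 hs1 hI
      have ht1 : σ1.v .t = n.t := by rw [hs1.v _ rfl]; simp [σ0]
      refine Ok.ite (T₁ := 20) (fun hc => ?_) (fun hc => ?_) (by simp)
      · refine Ok.skip (by simp) ?_
        have hc' : n.t < σ1.v .r * σ1.v .r * σ1.v .r := by
          by_contra h
          simp [ht1, h] at hc
        have h1 : n.r ≤ k := by
          by_contra h
          have h2 : σ1.v .r ≤ n.r - 1 := by rw [hI]; omega
          have h3 := Nat.mul_le_mul (Nat.mul_le_mul h2 h2) h2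
          have := n.le_t
          omega
        simp only [Mem.set_v, reduceCtorEq, if_false, hI]
        omega
      · have hc' : σ1.v .r * σ1.v .r * σ1.v .r ≤ n.t := by
          by_contra h
          simp [ht1] at hc
          omega
        have h1 : k < n.r := by
          by_contra h
          have h2 : σ1.v .r = n.r := by rw [hI]; omega
          rw [h2] at hc'
          have := n.t_lt
          omega
        refine Ok.assign (by simp) ?_ ?_
        · simp [hI]; omega
        · simp [hI]; omega
    · simp; omega
    · intro σ1 _ hI
      rw [hI]; omega
  intro σ1 hs1 _ hr1
  have ht1 : σ1.v .t = n.t := by rw [hs1.v _ rfl]; simp [σ0]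
  have e1 : (Expr.v .r * .v .r).eval σ1 = n.q := by simp [hr1, Dim.q]
  refine Ok.assign_seq (T₂ := 9500 * n.work) (by rw [e1]; omega) ?_ (by simp; omega)
  rw [e1]
  refine Ok.assign_seq (T₂ := 9400 * n.work) (by simp) ?_ (by simp; omega)
  simp only [Expr.eval_c]
  set σ2 := (σ1.set .q n.q).set .p1 0 with hσ2
  refine Ok.seq (T₁ := 9300 * n.work) (T₂ := 90 * n.work)
    (R := fun σ' => σ'.v .p1 = n.p - 1) ?_ ?_ (by omega)
  · refine Ok.loop' (n := 2 * n.q + 1) (100 + 400 * n.q)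
      (fun k σ' => σ'.v .p1 = if n.p ≤ 2 * n.q + k then n.p - 1 else 0) ?_ ?_ ?_ ?_ ?_ ?_
    · simp [σ2]; omega
    · omega
    · simp [σ2, hqp]
    · intro k hk σ3 hs3 hI
      have hq3 : σ3.v .q = n.q := by rw [hs3.v _ rfl]; simp [σ2]
      have e3 : (Expr.v .q + .v .q + .v .k).eval (σ3.set .k k) = 2 * n.q + k := by
        simp [hq3, two_mul]
      refine Ok.assign_seq (T₂ := 80 + 400 * n.q) (by rw [e3]; omega) ?_ (by simp; omega)
      rw [e3]
      refine Ok.assign_seq (T₂ := 70 + 400 * n.q) (by simp) ?_ (by simp; omega)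
      simp only [Expr.eval_c]
      set σ4 := ((σ3.set .k k).set .y (2 * n.q + k)).set .f 0 with hσ4
      have hy4 : σ4.v .y = 2 * n.q + k := by simp [σ4]
      refine Ok.seq (T₁ := 40 + 400 * n.q) (T₂ := 20)
        (R := fun σ' => σ'.v .f = 0 ↔ (2 * n.q + k + 1).Prime) ?_ ?_ (by omega)
      · refine Ok.loop' (n := 2 * n.q + k - 1) 50
          (fun e σ' => σ'.v .f = 0 ↔ ∀ j < e, ¬ j + 2 ∣ 2 * n.q + k + 1) ?_ ?_ ?_ ?_ ?_ ?_
        · simp [hy4]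
        · omega
        · simp [σ4]
        · intro e he σ5 hs5 hI5
          have hy5 : σ5.v .y = 2 * n.q + k := by rw [hs5.v _ rfl, hy4]
          have e5 : ((Expr.v .y + .c 1) % (.v .e + .c 2)).eval (σ5.set .e e) =
              (2 * n.q + k + 1) % (e + 2) := by simp [hy5]
          refine Ok.ite (T₁ := 20) (fun hc => ?_) (fun hc => ?_) (by simp)
          · rw [e5] at hc
            refine Ok.skip (by simp) ?_
            simp only [Mem.set_v, reduceCtorEq, if_false, hI5, Nat.forall_lt_succ_right]
            exact (and_iff_left fun h => hc (Nat.mod_eq_zero_of_dvd h)).symm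
          · rw [e5] at hc
            refine Ok.assign (by simp) (by simp; omega) ?_
            simp only [Mem.set_v, if_true, Expr.eval_c, one_ne_zero, false_iff]
            exact fun h => h e (Nat.lt_succ_self e) (Nat.dvd_of_mod_eq_zero hc)
        · simp; omega
        · intro σ5 _ hI5
          rw [hI5, Nat.prime_def_lt']
          constructor
          · refine fun h => ⟨by omega, fun m h1 h2 => ?_⟩
            have := h (m - 2) (by omega)
            rwa [Nat.sub_add_cancel h1] at this
          · exact fun h j hj => h.2 _ (by omega) (by omega)
      · intro σ5 hs5 _ hR
        have hp5 : σ5.v .p1 = if n.p ≤ 2 * n.q + k then n.p - 1 else 0 := by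
          rw [hs5.v _ rfl]; simpa [σ4] using hI
        have hy5 : σ5.v .y = 2 * n.q + k := by rw [hs5.v _ rfl, hy4]
        refine Ok.ite (T₁ := 10) (fun hc => ?_) (fun hc => ?_) (by simp)
        · refine Ok.skip (by simp) ?_
          simp only [Expr.eval_add, Expr.eval_v] at hc
          rw [hp5]
          by_cases h1 : n.p ≤ 2 * n.q + k
          · rw [if_pos h1, if_pos (by omega)]
          · rw [if_neg h1, if_neg]
            intro h2
            have h3 : n.p = 2 * n.q + k + 1 := by omega
            rw [hp5, if_neg h1, add_zero] at hc
            exact hc (hR.2 (h3 ▸ n.prime))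
        · simp only [Expr.eval_add, Expr.eval_v] at hc
          have h1 : (2 * n.q + k + 1).Prime := hR.1 (by omega)
          have h2 := hmin _ h1 (by omega)
          refine Ok.assign (by simp) (by simp [hy5]; omega) ?_
          have h3 : ¬ n.p ≤ 2 * n.q + k := by
            intro h
            rw [hp5, if_pos h] at hc
            omega
          simp only [Mem.set_v, if_true, Expr.eval_v, hy5]
          rw [if_pos (by omega)]
          omega
    · have : (2 * n.q + 1) * (100 + 400 * n.q + 9) ≤ 3 * n.q * (450 * n.q) :=
        Nat.mul_le_mul (by omega) (by omega)
      have h2 : 3 * n.q * (450 * n.q) = 1350 * (n.q * n.q) := by ring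
      simp; omega
    · intro σ3 _ hI
      rw [hI, if_pos (by omega)]
  · intro σ3 hs3 _ hp3
    have e4 : (Expr.v .p1 + .c 1).eval σ3 = n.p := by simp [hp3]; omega
    refine Ok.assign_seq (T₂ := 20) (by rw [e4]; omega) ?_ (by simp; omega)
    rw [e4]
    refine Ok.assign (by simp) (by simp [Dim.M]) ⟨?_, ?_, ?_, ?_, ?_, ?_⟩
    · simp [hs3.v .t rfl, σ2, ht1]
    · simp [hs3.v .r rfl, σ2, hr1]
    · simp [hs3.v .q rfl, σ2]
    · simp [hp3]
    · simp
    · simp [Dim.M]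

theorem powerProg_ok {n : Dim} {σ : Mem} (hf : Fits n σ) :
    Ok n.M powerProg σ (10000 * n.work) fun σ' => ∀ a < n.p - 1, ∀ k < n.p,
      (σ'.m .E a k 0 : ZMod (n.p * n.p)) = root n.p a ^ k := by
  have hq := n.q_pos
  have hqp := n.two_q_lt
  have hp := n.p_le'
  have hpM := n.p_sq_le
  have w1 := n.sq_le_work
  have w3 := n.q_le_sq
  have hM0 : 0 < n.M := by omega
  refine Ok.loop' (n := n.p - 1) (650 * n.q) (fun a σ' => ∀ b < a, ∀ k < n.p,
      (σ'.m .E b k 0 : ZMod (n.p * n.p)) = root n.p b ^ k) ?_ ?_ ?_ ?_ ?_ ?_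
  · simp [hf.p1]
  · omega
  · simp
  · intro a ha σ1 hs1 hI
    have hf1 : Fits n σ1 := hf.of_same hs1 (by decide)
    refine Ok.assign_seq (T₂ := 640 * n.q) (by simp; omega) ?_ (by simp; omega)
    simp only [Expr.eval_c]
    set σ2 := (σ1.set .a a).set .z 1 with hσ2
    have hf2 : Fits n σ2 := (hf1.set _ (by decide)).set _ (by decide)
    refine Ok.seq (T₁ := 170 * n.q) (T₂ := 460 * n.q)
      (R := fun σ' => (σ'.v .z : ZMod (n.p * n.p)) = root n.p a) ?_ ?_ (by omega)
    · refine Ok.loop' (n := n.p) 25 (fun k σ' =>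
        (σ'.v .z : ZMod (n.p * n.p)) = ((a + 1 : ℕ) : ZMod (n.p * n.p)) ^ k) ?_ ?_ ?_ ?_ ?_ ?_
      · simp [hf2.p]
      · omega
      · simp [σ2]
      · intro k hk σ3 hs3 hI3
        have hM3 : σ3.v .M = n.M := by rw [hs3.v _ rfl, hf2.M]
        have ha3 : σ3.v .a = a := by rw [hs3.v _ rfl]; simp [σ2]
        refine Ok.assign (by simp) ?_ ?_
        · simp [hM3, (Nat.mod_lt _ hM0).le]
        · simp only [Expr.eval_mod, Expr.eval_mul, Expr.eval_add, Expr.eval_v, Expr.eval_c,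
            Mem.set_v, reduceCtorEq, if_false, if_true, hM3, ha3]
          rw [Dim.M, ZMod.natCast_mod, Nat.cast_mul, hI3, pow_succ]
      · simp; omega
      · exact fun σ3 _ hI3 => hI3
    · intro σ3 hs3 _ hz3
      have hf3 : Fits n σ3 := hf2.of_same hs3 (by decide)
      have ha3 : σ3.v .a = a := by rw [hs3.v _ rfl]; simp [σ2]
      have hE3 : σ3.m .E = σ1.m .E := by rw [hs3.m _ rfl]; simp [σ2]
      refine Ok.assign_seq (T₂ := 450 * n.q) (by simp; omega) ?_ (by simp; omega)
      simp only [Expr.eval_c]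
      refine Ok.loop' (n := n.p) 90 (fun k σ' =>
        (σ'.v .y : ZMod (n.p * n.p)) = root n.p a ^ k ∧
        (∀ b < a, ∀ k < n.p, (σ'.m .E b k 0 : ZMod (n.p * n.p)) = root n.p b ^ k) ∧
        ∀ j < k, (σ'.m .E a j 0 : ZMod (n.p * n.p)) = root n.p a ^ j) ?_ ?_ ?_ ?_ ?_ ?_
      · simp [hf3.p]
      · omega
      · exact ⟨by simp, by simpa [hE3] using hI, by simp⟩
      · intro k hk σ4 hs4 ⟨hy4, hI4, hJ4⟩
        have hM4 : σ4.v .M = n.M := by rw [hs4.v _ rfl]; simpa using hf3.M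
        have ha4 : σ4.v .a = a := by rw [hs4.v _ rfl]; simpa using ha3
        have hz4 : (σ4.v .z : ZMod (n.p * n.p)) = root n.p a := by
          rw [hs4.v _ rfl]; simpa using hz3
        refine Ok.of_bdd fun hb => ?_
        refine Ok.store_seq (T₂ := 40) (hb.v _) ?_ (by simp)
        refine Ok.assign (by simp) ?_ ⟨?_, ?_, ?_⟩
        · simp [hM4, (Nat.mod_lt _ hM0).le]
        · simp only [Expr.eval_mod, Expr.eval_mul, Expr.eval_v, Mem.set_v, Mem.put_v,
            reduceCtorEq, if_false, if_true, hM4]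
          rw [Dim.M, ZMod.natCast_mod, Nat.cast_mul, hy4, hz4, pow_succ]
        · intro b hb k' hk'
          simp only [Expr.eval_v, Expr.eval_c, Mem.set_v, Mem.set_m, Mem.put_m, reduceCtorEq,
            if_false, ha4, hb.ne, false_and, and_false]
          exact hI4 b hb k' hk'
        · intro j hj
          simp only [Expr.eval_v, Expr.eval_c, Mem.set_v, Mem.set_m, Mem.put_m, reduceCtorEq,
            if_false, if_true, ha4, true_and, and_true]
          split_ifs with h
          · rw [hy4, h]
          · exact hJ4 j (by omega)
      · simp; omega
      · rintro σ4 - ⟨-, h1, h2⟩ b hb k hk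
        rcases Nat.lt_succ_iff_lt_or_eq.1 hb with h | rfl
        exacts [h1 b h k hk, h2 k hk]
  · have : (n.p - 1) * (650 * n.q + 9) ≤ 4 * n.q * (660 * n.q) := Nat.mul_le_mul (by omega) (by omega)
    have h2 : 4 * n.q * (660 * n.q) = 2640 * (n.q * n.q) := by ring
    simp; omega
  · exact fun σ1 _ hI => hI

theorem complProg_ok {n : Dim} {σ : Mem} (hf : Fits n σ) (hG : ∀ u a, σ.m .G u a 0 = 0)
    (hE : ∀ a < n.p - 1, ∀ k < n.p, (σ.m .E a k 0 : ZMod (n.p * n.p)) = root n.p a ^ k) :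
    Ok n.M complProg σ (10000 * n.work) fun σ' => ∀ u, ∀ a < n.p - 1,
      (σ'.m .G u a 0 : ZMod (n.p * n.p)) = evalG n.p n.q (Finset.range (n.t + 1)) u a := by
  have hq := n.q_pos
  have hqp := n.two_q_lt
  have hp := n.p_le'
  have hpM := n.p_sq_le
  have hrM := n.rq_le
  have ht := n.t_lt'
  have w2 := n.t_lt_work
  have w4 : 4 * (n.t + 1) ≤ (n.t + 1) * n.q := by rw [mul_comm]; exact Nat.mul_le_mul_left _ hq
  have hM0 : 0 < n.M := by omega
  refine Ok.loop' (n := n.t + 1) (850 * n.q) (fun x σ' => ∀ u, ∀ a < n.p - 1,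
      (σ'.m .G u a 0 : ZMod (n.p * n.p)) = evalG n.p n.q (Finset.range x) u a) ?_ ?_ ?_ ?_ ?_ ?_
  · simp [hf.t]
  · omega
  · intro u a _
    simp [hG, evalG]
  · intro x hx σ1 hs1 hI
    have hf1 : Fits n σ1 := hf.of_same hs1 (by decide)
    have hE1 : σ1.m .E = σ.m .E := hs1.m _ rfl
    have hxq := Nat.mod_lt x (show 0 < n.q by omega)
    refine Ok.loop' (n := n.p - 1) 200 (fun a σ' => ∀ u, ∀ b < n.p - 1,
      (σ'.m .G u b 0 : ZMod (n.p * n.p)) = evalG n.p n.q (Finset.range x) u b +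
        if b < a ∧ x / n.q = u then root n.p b ^ (n.p - 1 - x % n.q) else 0) ?_ ?_ ?_ ?_ ?_ ?_
    · simp [hf1.p1]
    · omega
    · simpa using hI
    · intro a ha σ2 hs2 hI2
      have hf2 : Fits n σ2 := (hf1.set _ (by decide)).of_same hs2 (by decide)
      have hx2 : σ2.v .x = x := by rw [hs2.v _ rfl]; simp
      have hE2 : σ2.m .E = σ.m .E := by rw [hs2.m _ rfl]; simp [hE1]
      refine Ok.store (by simp) ?_ ?_
      · simp [hf2.M, (Nat.mod_lt _ hM0).le]
      · simp only [Expr.eval_mod, Expr.eval_add, Expr.eval_sub, Expr.eval_div, Expr.eval_v,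
          Expr.eval_c, Expr.eval_ld, Mem.set_v, Mem.set_m, Mem.put_m, reduceCtorEq, if_false,
          if_true, hf2.M, hf2.q, hf2.p1, hx2, hE2, true_and, and_true]
        intro u b hb
        by_cases hu : x / n.q = u
        · by_cases hba : b = a
          · subst hba
            rw [if_pos ⟨hu.symm, rfl⟩, if_pos ⟨Nat.lt_succ_self b, hu⟩, Dim.M, ZMod.natCast_mod,
              Nat.cast_add, hI2 _ b hb, hE b hb _ (by omega), if_neg (by simp), add_zero, hu]
          · rw [if_neg (fun h => hba h.2), hI2 u b hb]
            congr 1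
            exact if_congr (and_congr_left' (by omega)) rfl rfl
        · rw [if_neg (fun h => hu h.1.symm), hI2 u b hb, if_neg (fun h => hu h.2),
            if_neg (fun h => hu h.2)]
    · simp; omega
    · intro σ2 _ hI2 u a ha
      rw [hI2 u a ha, Finset.range_add_one, evalG_insert Finset.notMem_range_self]
      simp [ha]
  · have : (n.t + 1) * (850 * n.q + 9) ≤ 860 * ((n.t + 1) * n.q) := by nlinarith
    simp; omega
  · exact fun σ1 _ hI => hI

/-- The first snapshot is empty, so its products are zero and the blank array `C` is already right.
The sum 0 counts as added since the snapshot; the blank cell `P[0]` lists it once `np` is 1. -/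
theorem initProg_ok {n : Dim} {σ : Mem} (hmin : ∀ p : ℕ, p.Prime → 2 * n.q < p → n.p ≤ p)
    (hio : σ.v .io = n.t) (h0 : ∀ a i j k, σ.m a i j k = 0) :
    Ok n.M initProg σ (40000 * n.work) fun σ' =>
      Fixed n σ' ∧ Tables n σ' ∅ ∧ Holds n σ' ∅ {0} ∧ σ'.v .np = 1 := by
  have hq := n.q_pos
  have hqp := n.two_q_lt
  have hpM := n.p_sq_le
  have w1 := n.sq_le_work
  have w3 := n.q_le_sq
  refine Ok.seq (paramProg_ok hmin hio) (T₂ := 29900 * n.work) ?_ (by omega)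
  intro σ1 hs1 _ hf1
  refine Ok.seq (powerProg_ok hf1) (T₂ := 19800 * n.work) ?_ (by omega)
  intro σ2 hs2 _ hE2
  have hf2 : Fits n σ2 := hf1.of_same hs2 (by decide)
  have hz2 : ∀ a ≠ Arr.E, ∀ i j k, σ2.m a i j k = 0 := by
    intro a ha i j k
    rw [hs2.m a (by cases a <;> first | rfl | simp at ha), hs1.m a (by cases a <;> rfl), h0]
  refine Ok.seq (complProg_ok hf2 (fun u a => hz2 _ (by decide) _ _ _) hE2) (T₂ := 9700 * n.work)
    ?_ (by omega)
  intro σ3 hs3 _ hG3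
  have hf3 : Fits n σ3 := hf2.of_same hs3 (by decide)
  have hE3 : σ3.m .E = σ2.m .E := hs3.m _ rfl
  have hz3 : ∀ a ∉ [Arr.E, .G], ∀ i j k, σ3.m a i j k = 0 := by
    intro a ha i j k
    rw [hs3.m a (by cases a <;> first | rfl | simp at ha), hz2 a (by rintro rfl; simp at ha)]
  refine Ok.store_seq (T₂ := 9500 * n.work) (by simp; omega) ?_ (by simp; omega)
  refine Ok.store_seq (T₂ := 9400 * n.work) (by simp; omega) ?_ (by simp; omega)
  refine Ok.assign (by simp; omega) (by simp; omega) ?_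
  simp only [Expr.eval_c]
  have hzero : ∀ h, heapSum n.r (fun _ => (0 : ZMod (n.p * n.p))) h = 0 := fun h =>
    (map_heapSum (r := n.r) (0 : ZMod (n.p * n.p) →+ ZMod (n.p * n.p)) (fun _ => 0) h).symm
  refine ⟨⟨((hf3.put _ _ _ _ _).put _ _ _ _ _).set _ (by decide), ?_, ?_⟩, ⟨?_, ?_, ?_, ?_⟩,
    ⟨?_, ?_, ?_, ?_, ?_⟩, ?_⟩
  · simpa [hE3] using hE2
  · simp
  · intro x
    simpa using hz3 .N (by decide) x 0 0
  · intro u a _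
    simp [hz3 .F (by decide), evalF]
  · intro u a ha
    simpa using hG3 u a ha
  · intro h _ _ d _ a _
    simp [hz3 .C (by decide), evalF, hzero]
  · simp
  · simp
  · intro x
    simp [hz3 .S (by decide)]
  · simp [hz3 .P (by decide)]
  · intro w _ hw
    simp [hz3 .K (by decide)] at hw
  · simp

/-! ### One operation -/

/-- The memory represents the set `B` of attained sums. -/
structure Core (n : Dim) (σ : Mem) (B : Finset ℕ) : Prop where
  holds : ∃ A, Fixed n σ ∧ Tables n σ A ∧ Holds n σ A B
  np_lt : σ.v .np < n.q

theorem Core.set {n : Dim} {σ : Mem} {B : Finset ℕ} (h : Core n σ B) {x : Var} (k : ℕ)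
    (hx : x ∉ [Var.t, .r, .q, .p1, .p, .M, .np]) : Core n (σ.set x k) B := by
  have hnp : (σ.set x k).v .np = σ.v .np := by
    rw [Mem.set_v, if_neg]
    rintro rfl
    simp at hx
  obtain ⟨A, hf, ht, hB⟩ := h.holds
  refine ⟨⟨A, ⟨hf.toFits.set k ?_, hf.E, hf.L⟩, ⟨ht.N, ht.F, ht.G, ht.C⟩,
    ⟨hB.sub, hB.le, hB.S, by rw [hnp]; exact hB.P, hB.K⟩⟩, by rw [hnp]; exact h.np_lt⟩
  simp only [List.mem_cons, not_or] at hx ⊢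
  tauto

/-- The weights that are not marked. -/
def unmarked (n : Dim) (σ : Mem) : Finset ℕ := {w ∈ Finset.range (n.t + 1) | σ.m .K w 0 0 = 0}

/-- The potential function of the amortized analysis. -/
def potential (n : Dim) (σ : Mem) (B : Finset ℕ) : ℕ :=
  n.q * (10000 * (unmarked n σ).card + (15000 + 5000 * n.depth) * (n.t + 1 - B.card) +
    5000 * σ.v .np)

theorem potential_set (n : Dim) (σ : Mem) (B : Finset ℕ) {x : Var} (k : ℕ) (hx : x ≠ .np) :
    potential n (σ.set x k) B = potential n σ B := by
  rw [potential, potential, Mem.set_v, if_neg hx.symm]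
  rfl

/-- If nothing new is found, `w` becomes marked, and the potential of one unmarked weight pays for
the basic cost. Otherwise each of the `m ≥ 1` new sums releases `15000 + 5000 * depth` units of `q`:
`10000` for the basic cost, `5000 * depth` for its part of the search, and `5000` saved for the next
renewal. At a renewal exactly these savings are spent. -/
theorem addTime_add_potential_le {n : Dim} {σ σ' : Mem} {B : Finset ℕ} {w : ℕ}
    (hB : newSums n B w ⊆ Finset.range (n.t + 1)) (hwt : w ≤ n.t) (hw : σ.m .K w 0 0 = 0)
    (hnp' : σ'.v .np = (if σ.v .np + (missing n B w).card < n.q then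
      σ.v .np + (missing n B w).card else 0))
    (hK : ∀ v, σ.m .K v 0 0 ≠ 0 → σ'.m .K v 0 0 ≠ 0)
    (hKw : (missing n B w).card = 0 → σ'.m .K w 0 0 ≠ 0) (hnp : σ.v .np < n.q) :
    addTime n (σ.v .np) (missing n B w).card + potential n σ' (newSums n B w) ≤
      potential n σ B := by
  have hsub : unmarked n σ' ⊆ unmarked n σ := by
    intro v hv
    obtain ⟨h1, h2⟩ := Finset.mem_filter.1 hv
    refine Finset.mem_filter.2 ⟨h1, ?_⟩
    by_contra h3
    exact hK v h3 h2
  have hcard := Finset.card_le_card hB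
  rw [Finset.card_range, card_newSums] at hcard
  rw [addTime, potential, potential, hnp', card_newSums]
  set m := (missing n B w).card with hm
  set np := σ.v .np
  set D := n.depth
  obtain ⟨R, hR⟩ : ∃ R, n.t + 1 = B.card + m + R := ⟨n.t + 1 - (B.card + m), by omega⟩
  rw [show n.t + 1 - B.card = R + m by omega, show n.t + 1 - (B.card + m) = R by omega]
  rw [show (if np + m < n.q then 0 else 5000 * n.q * (np + m)) =
    n.q * (if np + m < n.q then 0 else 5000 * (np + m)) by split_ifs <;> ring]
  rw [show 10000 * n.q + 5000 * n.q * D * m = n.q * (10000 + 5000 * D * m) by ring, ← mul_add,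
    ← mul_add]
  refine Nat.mul_le_mul_left _ ?_
  rw [mul_add _ R m, add_mul _ _ m]
  rcases Nat.eq_zero_or_pos m with h0 | h0
  · have : (unmarked n σ').card < (unmarked n σ).card := by
      refine Finset.card_lt_card ⟨hsub, fun h => ?_⟩
      have h1 := h (Finset.mem_filter.2 ⟨Finset.mem_range.2 (by omega : w < n.t + 1), hw⟩)
      exact hKw h0 (Finset.mem_filter.1 h1).2
    rw [h0, add_zero, if_pos hnp, if_pos hnp]
    omega
  · have := Finset.card_le_card hsub
    split_ifs <;> omega

theorem newSums_subset {n : Dim} {B : Finset ℕ} (hB : B ⊆ Finset.range (n.t + 1)) (w : ℕ) :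
    newSums n B w ⊆ Finset.range (n.t + 1) := by
  intro z hz
  rw [mem_newSums] at hz
  rcases hz with hz | ⟨x, hx, rfl, h⟩
  exacts [hB hz, Finset.mem_range.2 (by omega)]

theorem insertProg_ok {n : Dim} {σ : Mem} {B : Finset ℕ} {w : ℕ} (h : Core n σ B)
    (hio : σ.v .io = w) (hw : w ≤ n.t) :
    ∃ T, Ok n.M insertProg σ T fun σ' => Core n σ' (newSums n B w) ∧
      T + potential n σ' (newSums n B w) ≤ potential n σ B + 100 := by
  obtain ⟨A, hf, -, -⟩ := h.holds
  have hwM : w ≤ n.M := by have := n.t_lt'; have := n.rq_le; omega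
  obtain ⟨A, hf', ht', hB'⟩ := (h.set (x := .w) w (by decide)).holds
  refine ⟨100 + if σ.m .K w 0 0 = 0 then addTime n (σ.v .np) (missing n B w).card else 0, ?_⟩
  refine Ok.ite (T₁ := 50 + if σ.m .K w 0 0 = 0 then
    addTime n (σ.v .np) (missing n B w).card else 0) (fun hc => ?_) (fun _ => ?_) (by simp; omega)
  · simp [hio, hf.t, hw] at hc
  refine Ok.assign_seq (T₂ := 40 + if σ.m .K w 0 0 = 0 then
    addTime n (σ.v .np) (missing n B w).card else 0) (by simpa [hio]) ?_ (by simp; omega)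
  simp only [Expr.eval_v, hio]
  refine Ok.ite (T₁ := 1 + if σ.m .K w 0 0 = 0 then
    addTime n (σ.v .np) (missing n B w).card else 0) (fun hc => ?_) (fun hc => ?_) (by simp; omega)
  · simp only [Expr.eval_ld, Expr.eval_v, Expr.eval_c, Mem.set_v, Mem.set_m, if_true] at hc
    have hn : newSums n B w = B := by
      ext z
      rw [mem_newSums]
      refine ⟨?_, Or.inl⟩
      rintro (h | ⟨x, h1, rfl, h2⟩)
      exacts [h, hB'.K w hw hc x h1 h2]
    rw [hn, if_neg hc]
    refine Ok.skip (by simp) ⟨h.set _ (by decide), ?_⟩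
    rw [potential_set _ _ _ _ (by decide)]
    omega
  · simp only [Expr.eval_ld, Expr.eval_v, Expr.eval_c, Mem.set_v, Mem.set_m, if_true] at hc
    rw [if_pos hc]
    refine Ok.mono (addProg_ok hf' ht' hB' h.np_lt (by simp) hw) (by simp) ?_
    rintro σ' - - ⟨h1, h2, h3, h4⟩
    have hnp : σ'.v .np < n.q := by
      have := n.q_pos
      rw [h2]; split_ifs <;> omega
    refine ⟨⟨h1, hnp⟩, ?_⟩
    have := addTime_add_potential_le (σ := σ) (newSums_subset hB'.le w) hw hc h2 h3 h4 h.np_lt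
    omega

theorem queryProg_ok {n : Dim} {σ : Mem} {B : Finset ℕ} {t : ℕ} (h : Core n σ B)
    (hio : σ.v .io = t) :
    Ok n.M queryProg σ 30 fun σ' => Core n σ' B ∧ potential n σ' B = potential n σ B ∧
      (σ'.v .io ≠ 0 ↔ t ∈ B) := by
  obtain ⟨A, hf, ht, hB⟩ := h.holds
  refine Ok.of_bdd fun hb => Ok.assign (by simp) (hb.m _ _ _ _) ⟨h.set _ (by decide), potential_set _ _ _ _ (by decide), ?_⟩
  · simp [hio, hB.S]

/-! ### The whole computation -/

/-- The algorithm. -/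
def alg : Algorithm where
  init := initProg.code 22
  insert := insertProg.code 22
  query := queryProg.code 22

/-- The sums that are attained after some operations. -/
def sums (n : Dim) : Finset ℕ → List Op → Finset ℕ
  | B, [] => B
  | B, Op.insert w :: ops => sums n (newSums n B w) ops
  | B, Op.query _ :: ops => sums n B ops

/-- Discarding sums above `t` loses nothing, since weights are nonnegative and partial sums of a sum
up to `t` are themselves up to `t`. The start `B` is arbitrary for the sake of the induction. -/
theorem mem_sums {n : Dim} (ops : List Op) : ∀ {B : Finset ℕ}, B ⊆ Finset.range (n.t + 1) →
    ∀ x, x ∈ sums n B ops ↔ x ≤ n.t ∧ ∃ b ∈ B, ∃ u ≤ items ops, b + u.sum = x := by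
  induction ops with
  | nil =>
    intro B hB x
    simp only [sums, items, nonpos_iff_eq_zero, exists_eq_left, Multiset.sum_zero, add_zero,
      exists_eq_right]
    exact ⟨fun h => ⟨Nat.lt_succ_iff.1 (Finset.mem_range.1 (hB h)), h⟩, fun h => h.2⟩
  | cons op ops ih =>
    intro B hB x
    cases op with
    | query t => exact ih hB x
    | insert w =>
      rw [sums, ih (newSums_subset hB w)]
      refine and_congr_right fun hx => ?_
      constructor
      · rintro ⟨b, hb, u, hu, rfl⟩
        rcases mem_newSums.1 hb with hb | ⟨c, hc, rfl, -⟩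
        · exact ⟨b, hb, u, hu.trans (Multiset.le_cons_self _ _), rfl⟩
        · exact ⟨c, hc, w ::ₘ u, (Multiset.cons_le_cons_iff w).2 hu, by
            rw [Multiset.sum_cons, add_assoc]⟩
      · rintro ⟨b, hb, u, hu, rfl⟩
        rw [items] at hu
        by_cases hw : w ∈ u
        · obtain ⟨u', rfl⟩ := Multiset.exists_cons_of_mem hw
          rw [Multiset.sum_cons] at hx ⊢
          exact ⟨b + w, mem_newSums.2 (Or.inr ⟨b, hb, rfl, by omega⟩), u',
            (Multiset.cons_le_cons_iff w).1 hu, by rw [add_assoc]⟩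
        · exact ⟨b, mem_newSums.2 (Or.inl hb), u, (Multiset.le_cons_of_notMem hw).1 hu, rfl⟩

theorem mem_sums_iff {n : Dim} {ops : List Op} {x : ℕ} (hx : x ≤ n.t) :
    x ∈ sums n {0} ops ↔ IsSubsetSum (items ops) x := by
  rw [mem_sums ops (by simp)]
  simp [hx, IsSubsetSum]

/-- The largest exponent belongs to the nested address `S[P[np + k]]`: `4 * 2 + 9 = 17` for the
inner access and `4 * 17 + 9 = 77` for the outer one. -/
theorem Prog.deg_alg : initProg.deg ≤ 77 ∧ insertProg.deg ≤ 77 ∧ queryProg.deg ≤ 77 := by decide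

theorem Ok.runs {n : Dim} {W : ℕ} (hW : n.M ^ 77 < 2 ^ W) {c : Prog} (hc : c.deg ≤ 77)
    {s : Store} {σ : Mem} {T : ℕ} {Q : Mem → Prop} (h : Ok n.M c σ T Q) (hb : Bdd n.M σ)
    (hs : Agree s σ) :
    ∃ s' σ', ∃ T' ≤ T, Runs W (c.code 22) s s' T' ∧ Agree s' σ' ∧ Bdd n.M σ' ∧ Q σ' := by
  have hM : 2 ≤ n.M := by have := n.two_q_lt; have := n.p_sq_le; omega
  have hW1 : 1 < 2 ^ W := (Nat.one_le_pow _ _ (by omega)).trans_lt hW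
  obtain ⟨hg, hT, hQ⟩ := h hb
  obtain ⟨s', hr, ha, -⟩ := c.code_runs hW1 le_rfl hs (Prog.safe_of_good hM hW c hc hb hg)
  exact ⟨s', _, _, hT, hr, ha, hb.run c hg, hQ⟩

theorem Mem.set_set (σ : Mem) (x : Var) (k l : ℕ) : (σ.set x k).set x l = σ.set x l := by
  simp only [Mem.set]
  congr 1
  funext y
  split_ifs <;> rfl

theorem Bdd.set_of_set {Z : ℕ} {σ : Mem} {x : Var} {k l : ℕ} (h : Bdd Z (σ.set x k)) (hl : l ≤ Z) :
    Bdd Z (σ.set x l) := by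
  refine ⟨fun y => ?_, h.m⟩
  have := h.v y
  rw [Mem.set_v] at this ⊢
  split_ifs at this ⊢
  exacts [hl, this]

/-- A weight is only bounded by the word length and may exceed `M`. Therefore the bound on the
memory is required only with `io` cleared, and weights above `t`, which the program skips, are
handled directly instead of by `Ok`. -/
theorem insert_runs {n : Dim} {W : ℕ} (hW : n.M ^ 77 < 2 ^ W) {s : Store} {σ : Mem} {B : Finset ℕ}
    {w : ℕ} (hw : w < 2 ^ W) (hs : Agree s σ) (hb : Bdd n.M (σ.set .io 0)) (h : Core n σ B) :
    ∃ s' σ' T, Runs W alg.insert (s.setReg W 0 w) s' T ∧ Agree s' σ' ∧ Bdd n.M (σ'.set .io 0) ∧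
      Core n σ' (newSums n B w) ∧ T + potential n σ' (newSums n B w) ≤ potential n σ B + 100 := by
  have hM : 2 ≤ n.M := by have := n.two_q_lt; have := n.p_sq_le; omega
  have hW1 : 1 < 2 ^ W := (Nat.one_le_pow _ _ (by omega)).trans_lt hW
  have hMW : n.M < 2 ^ W := (Nat.le_self_pow (by norm_num) _).trans_lt hW
  have htM : n.t ≤ n.M := by have := n.t_lt'; have := n.rq_le; omega
  have hs' : Agree (s.setReg W 0 w) (σ.set .io w) := hs.set W .io hw
  have h' : Core n (σ.set .io w) B := h.set _ (by decide)
  have hpot : potential n (σ.set .io w) B = potential n σ B :=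
    potential_set _ _ _ _ (by decide)
  by_cases hwt : w ≤ n.t
  · obtain ⟨T, hT⟩ := insertProg_ok h' (by simp) hwt
    obtain ⟨s2, σ2, T2, hT2, hr, ha, hb2, hc, hp⟩ := hT.runs hW Prog.deg_alg.2.1
      (hb.set_of_set (hwt.trans htM)) hs'
    exact ⟨s2, σ2, T2, hr, ha, hb2.set _ (by omega), hc, by omega⟩
  · obtain ⟨A, hf, -, -⟩ := h'.holds
    have hc : ((Expr.v .t).lt (.v .io)).eval (σ.set .io w) ≠ 0 := by
      have := hf.t
      rw [Expr.eval_lt, Expr.eval_v, Expr.eval_v, this]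
      simp
      omega
    have hsafe : insertProg.Safe W (σ.set .io w) := by
      refine ⟨⟨?_, ?_, ?_⟩, ?_⟩
      · have := hf.t
        change (σ.set .io w).v .t < 2 ^ W
        omega
      · simpa [Expr.Safe] using hw
      · simp only [AOp.eval]
        split_ifs <;> omega
      · rw [if_pos hc]
        trivial
    have hrun : insertProg.run (σ.set .io w) = σ.set .io w := by
      rw [insertProg, Prog.run, if_pos hc, Prog.run]
    have hcost : insertProg.cost (σ.set .io w) ≤ 100 := by
      rw [insertProg, Prog.cost, if_pos hc, Prog.cost]
      simp
    have hn : newSums n B w = B := by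
      ext z
      rw [mem_newSums]
      refine ⟨?_, Or.inl⟩
      rintro (h | ⟨x, h1, rfl, h2⟩)
      exacts [h, absurd h2 (by omega)]
    obtain ⟨s2, hr, ha, -⟩ := Prog.code_runs hW1 insertProg le_rfl hs' hsafe
    rw [hrun] at ha
    rw [hn]
    exact ⟨s2, _, _, hr, ha, by rwa [Mem.set_set], h',
      by rw [hpot]; omega⟩

/-- The amortized bounds telescope: the potential at the start pays for everything except a constant
for each operation. -/
theorem tasks_reaches {n : Dim} {W : ℕ} (hW : n.M ^ 77 < 2 ^ W) (ops : List Op) :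
    ∀ (i : ℕ) {s : Store} {σ : Mem} {B : Finset ℕ} (r : ℕ → Option Bool),
    Agree s σ → Bdd n.M (σ.set .io 0) → Core n σ B → (∀ w, Op.insert w ∈ ops → w < 2 ^ W) →
    (∀ t, Op.query t ∈ ops → t ≤ n.t) →
    ∃ T s' r', T ≤ potential n σ B + 200 * ops.length ∧
      Reaches W T ⟨alg.tasks i ops, s, r⟩ ⟨[], s', r'⟩ ∧ (∀ j < i, r' j = r j) ∧
      ∀ j t, ops[j]? = some (Op.query t) →
        r' (i + j) = some (decide (t ∈ sums n B (ops.take j))) := by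
  have hMW : n.M < 2 ^ W := (Nat.le_self_pow (by norm_num) _).trans_lt hW
  have htM : n.t ≤ n.M := by have := n.t_lt'; have := n.rq_le; omega
  induction ops with
  | nil =>
    intro i s σ B r _ _ _ _ _
    exact ⟨0, s, r, Nat.zero_le _, Reaches.refl _ _, fun _ _ => rfl, by simp⟩
  | cons op ops ih =>
    intro i s σ B r hs hb h hins hque
    have hins' : ∀ w, Op.insert w ∈ ops → w < 2 ^ W := fun w hw => hins w (List.mem_cons_of_mem _ hw)
    have hque' : ∀ t, Op.query t ∈ ops → t ≤ n.t := fun t ht => hque t (List.mem_cons_of_mem _ ht)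
    cases op with
    | insert w =>
      obtain ⟨s1, σ1, T1, hr1, ha1, hb1, hc1, hp1⟩ :=
        insert_runs hW (hins w List.mem_cons_self) hs hb h
      obtain ⟨T2, s2, r2, hT2, hr2, hi2, ho2⟩ := ih (i + 1) r ha1 hb1 hc1 hins' hque'
      refine ⟨1 + (T1 + T2), s2, r2, ?_, ?_, fun j hj => hi2 j (by omega), ?_⟩
      · rw [List.length_cons]; omega
      · exact (Reaches.of_step (by simp [Algorithm.tasks, step])).trans ((hr1 _ _).trans hr2)
      · intro j t hj
        cases j with
        | zero => simp at hj
        | succ j =>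
          rw [List.getElem?_cons_succ] at hj
          rw [show i + (j + 1) = i + 1 + j by omega, ho2 j t hj]
          rfl
    | query t =>
      have ht := hque t List.mem_cons_self
      obtain ⟨s1, σ1, T1, hT1, hr1, ha1, hb1, hc1, hp1, hq1⟩ :=
        (queryProg_ok (t := t) (h.set (x := .io) t (by decide)) (by simp)).runs hW Prog.deg_alg.2.2
          (hb.set_of_set (ht.trans htM)) (hs.set W .io (by omega))
      have hpot : potential n (σ.set .io t) B = potential n σ B :=
        potential_set _ _ _ _ (by decide)
      obtain ⟨T2, s2, r2, hT2, hr2, hi2, ho2⟩ := ih (i + 1)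
        (Function.update r i (some (decide (s1.reg 0 ≠ 0)))) ha1 (hb1.set _ (by omega)) hc1
        hins' hque'
      refine ⟨1 + (T1 + (1 + T2)), s2, r2, ?_, ?_, fun j hj => ?_, ?_⟩
      · rw [List.length_cons]; omega
      · exact (Reaches.of_step (by simp [Algorithm.tasks, step]; rfl)).trans
          ((hr1 _ _).trans ((Reaches.of_step rfl).trans hr2))
      · rw [hi2 j (by omega), Function.update_of_ne (by omega)]
      · intro j t' hj
        cases j with
        | zero =>
          simp only [List.getElem?_cons_zero, Option.some.injEq, Op.query.injEq] at hj
          subst hj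
          have := ha1.reg .io
          rw [Var.idx] at this
          rw [add_zero, hi2 i (by omega), Function.update_self, this]
          simp [hq1, sums]
        | succ j =>
          rw [List.getElem?_cons_succ] at hj
          rw [show i + (j + 1) = i + 1 + j by omega, ho2 j t' hj]
          rfl

/-- Bertrand's postulate supplies a prime above `2 * r ^ 2` and at most `4 * r ^ 2`; the least one
above `2 * r ^ 2` is taken. -/
theorem exists_dim {t : ℕ} (ht : 0 < t) :
    ∃ n : Dim, n.t = t ∧ ∀ p : ℕ, p.Prime → 2 * n.q < p → n.p ≤ p := by
  classical
  have h1 : ∃ r : ℕ, t < r * r * r := ⟨t + 1, by nlinarith [Nat.zero_le (t * t * t)]⟩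
  set r := Nat.find h1 with hr
  have hr1 : t < r * r * r := Nat.find_spec h1
  have hr0 : 0 < r := by
    by_contra h
    rw [show r = 0 by omega] at hr1
    omega
  have hr2 : (r - 1) * (r - 1) * (r - 1) ≤ t :=
    not_lt.1 (Nat.find_min h1 (show r - 1 < r by omega))
  obtain ⟨p₀, hp₀, hlt, hle⟩ := Nat.exists_prime_lt_and_le_two_mul (2 * (r * r))
    (Nat.mul_ne_zero two_ne_zero (Nat.mul_ne_zero hr0.ne' hr0.ne'))
  have h2 : ∃ p : ℕ, p.Prime ∧ 2 * (r * r) < p := ⟨p₀, hp₀, hlt⟩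
  have h3 : Nat.find h2 ≤ p₀ := Nat.find_min' h2 ⟨hp₀, hlt⟩
  exact ⟨⟨t, r, Nat.find h2, ht, hr1, hr2, (Nat.find_spec h2).1, (Nat.find_spec h2).2, by omega⟩,
    rfl, fun p hp hlt => Nat.find_min' h2 ⟨hp, hlt⟩⟩

/-- With `N = t + l ≥ 3` the prime is at most `4 * N ^ 2 + 1 ≤ N ^ 4`, so `M ≤ N ^ 8`. -/
theorem Dim.M_pow_lt (n : Dim) {W l i j : ℕ} (hl : 2 ≤ l) (hij : 8 * i < j)
    (hW : (n.t + l) ^ j ≤ 2 ^ W) : n.M ^ i < 2 ^ W := by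
  refine lt_of_lt_of_le ?_ hW
  have ht := n.t_pos
  have hr := n.r_sub_one_le
  have hp := n.p_le
  set N := n.t + l with hN
  have h1 : n.r * n.r ≤ N * N := Nat.mul_le_mul (by omega) (by omega)
  have h9 : 3 * 3 ≤ N * N := Nat.mul_le_mul (by omega) (by omega)
  have h2 : n.p ≤ N ^ 4 := by
    rw [show N ^ 4 = (N * N) * (N * N) by ring]
    have := Nat.mul_le_mul_right (N * N) h9
    omega
  calc n.M ^ i ≤ (N ^ 4 * N ^ 4) ^ i := Nat.pow_le_pow_left (Nat.mul_le_mul h2 h2) _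
    _ = N ^ (8 * i) := by rw [← pow_add, ← pow_mul]
    _ < N ^ j := Nat.pow_lt_pow_right (by omega) hij

theorem Dim.two_le_depth (n : Dim) : 2 ≤ n.depth := Nat.le_add_left _ _

/-- The exponent is `617 = 8 * 77 + 1`: numbers up to `M ^ 77` occur, and `M` is at most the eighth
power of `t + oprs`. -/
theorem start_reaches {n : Dim} (hmin : ∀ p : ℕ, p.Prime → 2 * n.q < p → n.p ≤ p) {W : ℕ}
    {ops : List Op} (h : Admissible 617 W n.t ops) :
    ∃ T s r, T ≤ 300 * ops.length + 100000 * (n.depth * n.work) ∧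
      Reaches W T (alg.start n.t ops) ⟨[], s, r⟩ ∧
      ∀ i t, ops[i]? = some (Op.query t) →
        ∃ b : Bool, r i = some b ∧ (b = true ↔ IsSubsetSum (items (ops.take i)) t) := by
  have hW := n.M_pow_lt (i := 77) h.two_le_oprs (by norm_num) h.word_size
  have hMW : n.M < 2 ^ W := (Nat.le_self_pow (by norm_num) _).trans_lt hW
  have htM : n.t ≤ n.M := by have := n.t_lt'; have := n.rq_le; omega
  let σ₀ : Mem := ⟨fun _ => 0, fun _ _ _ _ => 0⟩
  have hb₀ : Bdd n.M σ₀ := ⟨fun _ => Nat.zero_le _, fun _ _ _ _ => Nat.zero_le _⟩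
  obtain ⟨s1, σ1, T1, hT1, hr1, ha1, hb1, hf1, ht1, hB1, hnp1⟩ :=
    (initProg_ok (σ := σ₀.set .io n.t) hmin (by simp) fun _ _ _ _ => rfl).runs hW Prog.deg_alg.1
      (hb₀.set _ htM) (Agree.zero.set W .io (htM.trans_lt hMW))
  have hc1 : Core n σ1 {0} := ⟨⟨∅, hf1, ht1, hB1⟩, by have := n.q_pos; omega⟩
  obtain ⟨T2, s2, r2, hT2, hr2, -, ho2⟩ := tasks_reaches hW ops 0 (fun _ => none) ha1
    (hb1.set _ (Nat.zero_le _)) hc1 h.weight_lt h.target_le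
  refine ⟨1 + (T1 + T2), s2, r2, ?_, ?_, fun i t hi => ⟨_, by rw [← ho2 i t hi, zero_add], ?_⟩⟩
  · have hq := n.q_pos
    have hd := n.two_le_depth
    have hl := h.two_le_oprs
    have h1 := n.t_lt_work
    have h2 : (unmarked n σ1).card ≤ n.t + 1 :=
      (Finset.card_le_card (Finset.filter_subset _ _)).trans (Finset.card_range _).le
    have h3 : potential n σ1 {0} ≤ 25000 * (n.depth * n.work) := by
      rw [potential, hnp1, Finset.card_singleton, Nat.add_sub_cancel]
      have h4 : 10000 * (unmarked n σ1).card + (15000 + 5000 * n.depth) * n.t + 5000 * 1 ≤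
          25000 * (n.depth * (n.t + 1)) := by nlinarith
      calc _ ≤ n.q * (25000 * (n.depth * (n.t + 1))) := Nat.mul_le_mul_left _ h4
        _ = 25000 * (n.depth * ((n.t + 1) * n.q)) := by ring
        _ ≤ _ := Nat.mul_le_mul_left _ (Nat.mul_le_mul_left _ h1)
    have h5 : 2 * n.work ≤ n.depth * n.work := Nat.mul_le_mul_right _ hd
    omega
  · exact (Reaches.of_step rfl).trans ((hr1 _ _).trans hr2)
  · rw [decide_eq_true_iff]
    exact mem_sums_iff (h.target_le t (List.mem_of_getElem? hi))

/-! ### From a certain run to time bounds and probabilities. -/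

theorem Reaches.finishesWithin {A : Algorithm} {W tmax T : ℕ} {ops : List Op} {s : Store}
    {r : ℕ → Option Bool} (h : Reaches W T (A.start tmax ops) ⟨[], s, r⟩) :
    A.FinishesWithin W tmax ops T := by
  intro c hc
  rw [h, PMF.support_pure, Set.mem_singleton_iff] at hc
  rw [hc]

/-- A finished configuration rests. If `T'` is the later time, nothing changes after `T`. If `T'` is
earlier, every configuration possible at `T'` is already finished, so the distribution at `T'`
equals the one at `T`. -/
theorem Reaches.of_finishesWithin {A : Algorithm} {W tmax T T' : ℕ} {ops : List Op} {s : Store}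
    {r : ℕ → Option Bool} (h : Reaches W T (A.start tmax ops) ⟨[], s, r⟩)
    (h' : A.FinishesWithin W tmax ops T') : Reaches W T' (A.start tmax ops) ⟨[], s, r⟩ := by
  rcases le_total T T' with hle | hle
  · obtain ⟨m, rfl⟩ := Nat.exists_eq_add_of_le hle
    exact h.trans (Reaches.rest W m s r)
  · obtain ⟨m, rfl⟩ := Nat.exists_eq_add_of_le hle
    have h1 : (steps W T' (A.start tmax ops)).bind (steps W m) = steps W T' (A.start tmax ops) := by
      conv_rhs => rw [← PMF.bind_pure (steps W T' (A.start tmax ops))]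
      ext c
      rw [PMF.bind_apply, PMF.bind_apply]
      refine tsum_congr fun x => ?_
      by_cases hx : x ∈ (steps W T' (A.start tmax ops)).support
      · obtain ⟨k, s', r'⟩ := x
        have hk : k = [] := h' _ hx
        subst hk
        rw [show steps W m _ = PMF.pure _ from Reaches.rest W m s' r']
      · rw [PMF.mem_support_iff, not_not] at hx
        rw [hx, zero_mul, zero_mul]
    unfold Reaches at h ⊢
    rwa [steps_add, h1] at h

/-! ### Estimates -/

theorem Dim.depth_le (n : Dim) : (n.depth : ℝ) ≤ 3 + 2 * Real.log n.t := by
  have hr := n.r_pos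
  have ht : (1 : ℝ) ≤ n.t := by exact_mod_cast n.t_pos
  have h1 : 2 ^ Nat.log 2 n.r ≤ 2 * n.t :=
    (Nat.pow_log_le_self 2 (by omega)).trans (by have := n.r_sub_one_le; have := n.t_pos; omega)
  have h2 : (2 : ℝ) ^ Nat.log 2 n.r ≤ 2 * n.t := by exact_mod_cast h1
  have h3 := Real.log_le_log (by positivity) h2
  rw [Real.log_pow, Real.log_mul (by norm_num) (by linarith)] at h3
  have h4 : (1 : ℝ) / 2 ≤ Real.log 2 := by have := Real.log_two_gt_d9; linarith
  have h5 := Real.log_nonneg ht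
  have h6 : (Nat.log 2 n.r : ℝ) ≤ 1 + 2 * Real.log n.t := by
    by_contra h
    rw [not_le] at h
    nlinarith
  rw [depth]
  push_cast
  linarith

/-- The work is `r ^ 5`. With `j = r - 1 ≥ 1` one has `r ≤ 2 * j` and `j ^ 3 ≤ t`, whence the factor
`2 ^ 5`. -/
theorem Dim.work_le (n : Dim) : (n.work : ℝ) ≤ 32 * (n.t : ℝ) ^ ((5 : ℝ) / 3) := by
  have hr := n.r_pos
  obtain ⟨j, hj⟩ : ∃ j, n.r = j + 1 := ⟨n.r - 1, by omega⟩
  have h1 := n.le_t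
  rw [hj, Nat.add_sub_cancel] at h1
  have h2 : ((j : ℝ) ^ 3) ≤ n.t := by
    have : j ^ 3 ≤ n.t := by rw [pow_three']; exact h1
    exact_mod_cast this
  have h3 : (j : ℝ) ^ 5 ≤ (n.t : ℝ) ^ ((5 : ℝ) / 3) := by
    calc (j : ℝ) ^ 5 = ((j : ℝ) ^ 3) ^ ((5 : ℝ) / 3) := by
          rw [← Real.rpow_natCast (j : ℝ) 3, ← Real.rpow_mul (by positivity),
            ← Real.rpow_natCast]
          norm_num
      _ ≤ _ := Real.rpow_le_rpow (by positivity) h2 (by norm_num)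
  have h4 : n.work ≤ 32 * j ^ 5 := by
    have : n.r ≤ 2 * j := by omega
    calc n.work = n.r ^ 5 := by rw [work, q]; ring
      _ ≤ (2 * j) ^ 5 := Nat.pow_le_pow_left this 5
      _ = 32 * j ^ 5 := by ring
  have h5 : (n.work : ℝ) ≤ 32 * (j : ℝ) ^ 5 := by exact_mod_cast h4
  linarith

theorem exists_time {W tmax : ℕ} {ops : List Op} (h : Admissible 617 W tmax ops) :
    ∃ T : ℕ, alg.FinishesWithin W tmax ops T ∧ (T : ℝ) ≤ 300 * ops.length +
      3200000 * (3 + 2 * Real.log tmax) * (tmax : ℝ) ^ ((5 : ℝ) / 3) := by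
  obtain ⟨n, rfl, hmin⟩ := exists_dim h.tmax_pos
  obtain ⟨T, s, r, hT, hr, -⟩ := start_reaches hmin h
  refine ⟨T, hr.finishesWithin, ?_⟩
  have h1 : (T : ℝ) ≤ 300 * ops.length + 100000 * (n.depth * n.work) := by exact_mod_cast hT
  have h2 : (n.depth * n.work : ℝ) ≤ (3 + 2 * Real.log n.t) * (32 * (n.t : ℝ) ^ ((5 : ℝ) / 3)) :=
    mul_le_mul n.depth_le n.work_le (Nat.cast_nonneg _)
      (le_trans (Nat.cast_nonneg _) n.depth_le)
  linarith

/-- For `t ≥ 2` both logarithms are at least `0.69`, so the left factor is absorbed by a multiple of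
their product. For `t = 1` that product vanishes and the number of operations, at least 2,
dominates. -/
theorem three_add_log_mul_rpow_le {t l : ℕ} (ht : 1 ≤ t) (hl : 2 ≤ l) :
    (3 + 2 * Real.log t) * (t : ℝ) ^ ((5 : ℝ) / 3) ≤
      20 * (l + (t : ℝ) ^ ((5 : ℝ) / 3) * Real.log t ^ 2 * Real.log l) := by
  have hl' : (2 : ℝ) ≤ l := by exact_mod_cast hl
  have hlog : (1 : ℝ) / 2 ≤ Real.log 2 := by have := Real.log_two_gt_d9; linarith
  have hlog2 : (69 : ℝ) / 100 ≤ Real.log 2 := by have := Real.log_two_gt_d9; linarith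
  rcases Nat.lt_or_ge 1 t with h | h
  · have ht' : (2 : ℝ) ≤ t := by exact_mod_cast h
    have h1 : (69 : ℝ) / 100 ≤ Real.log t := hlog2.trans (Real.log_le_log (by norm_num) ht')
    have h2 : (69 : ℝ) / 100 ≤ Real.log l := hlog2.trans (Real.log_le_log (by norm_num) hl')
    have h3 : 3 + 2 * Real.log t ≤ 20 * (Real.log t ^ 2 * Real.log l) := by
      have : Real.log t ^ 2 * (69 / 100) ≤ Real.log t ^ 2 * Real.log l :=
        mul_le_mul_of_nonneg_left h2 (sq_nonneg _)
      nlinarith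
    have h4 : 0 ≤ (t : ℝ) ^ ((5 : ℝ) / 3) := by positivity
    nlinarith
  · obtain rfl : t = 1 := by omega
    simp
    linarith

end DynSubsetSum

/-! ### The main theorem. -/

theorem theorem1 :
    ∃ (A : DynSubsetSum.Algorithm) (κ : ℕ),
      -- amortized time per operation
      (∃ C : ℝ, ∀ (W tmax : ℕ) (ops : List DynSubsetSum.Op),
        DynSubsetSum.Admissible κ W tmax ops →
          ∃ T : ℕ, A.FinishesWithin W tmax ops T ∧
            (T : ℝ) / (ops.length : ℝ) ≤
              C * (1 + (tmax : ℝ) ^ ((5 : ℝ) / 3) * Real.log (tmax : ℝ) ^ 2 *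
                Real.log (ops.length : ℝ) / (ops.length : ℝ))) ∧
      -- the amortized time is truly sublinear once there are enough operations
      (∀ ε : ℝ, 0 < ε → ∃ δ : ℝ, 0 < δ ∧ ∃ C : ℝ,
        ∀ (W tmax : ℕ) (ops : List DynSubsetSum.Op),
          DynSubsetSum.Admissible κ W tmax ops →
            (tmax : ℝ) ^ ((2 : ℝ) / 3 + ε) ≤ (ops.length : ℝ) →
              ∃ T : ℕ, A.FinishesWithin W tmax ops T ∧
                (T : ℝ) / (ops.length : ℝ) ≤ C * (tmax : ℝ) ^ (1 - δ)) ∧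
      -- each query is answered correctly with high probability
      (∀ (W tmax : ℕ) (ops : List DynSubsetSum.Op),
        DynSubsetSum.Admissible κ W tmax ops →
          ∀ T : ℕ, A.FinishesWithin W tmax ops T →
            ∀ i t : ℕ, ops[i]? = some (DynSubsetSum.Op.query t) →
              ENNReal.ofReal (1 - 1 / (tmax : ℝ) ^ 3) ≤ A.probCorrect W tmax ops T i t) := by
  -- The second constant is `20 * 3200000`, from the comparison of the logarithmic factors.
  refine ⟨DynSubsetSum.alg, 617, ⟨300 + 64000000, fun W tmax ops h => ?_⟩, fun ε hε => ?_,
    fun W tmax ops h T hT i t hi => ?_⟩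
  · obtain ⟨T, hT, hle⟩ := DynSubsetSum.exists_time h
    refine ⟨T, hT, ?_⟩
    have hl : (0 : ℝ) < ops.length := by
      have := h.two_le_oprs
      exact_mod_cast (by omega : 0 < ops.length)
    have h1 := DynSubsetSum.three_add_log_mul_rpow_le h.tmax_pos h.two_le_oprs
    have h2 : 0 ≤ (tmax : ℝ) ^ ((5 : ℝ) / 3) * Real.log tmax ^ 2 * Real.log ops.length :=
      mul_nonneg (by positivity) (Real.log_natCast_nonneg _)
    rw [div_le_iff₀ hl, mul_assoc, add_mul 1, div_mul_cancel₀ _ hl.ne', one_mul]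
    linarith
  · have hε' : 0 < min ε 1 := lt_min hε one_pos
    set e := min ε 1 with he
    -- Half of the surplus exponent `e` absorbs the logarithm, the other half is the gain `δ`.
    -- Capping `ε` at 1 keeps `1 - δ` positive, so that the constant cost per operation is covered
    -- too.
    refine ⟨e / 2, by positivity, 300 + 3200000 * (3 + 4 / e), fun W tmax ops h hops => ?_⟩
    obtain ⟨T, hT, hle⟩ := DynSubsetSum.exists_time h
    refine ⟨T, hT, ?_⟩
    have ht : (1 : ℝ) ≤ tmax := by exact_mod_cast h.tmax_pos
    have ht0 : (0 : ℝ) < tmax := by linarith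
    have hl : (0 : ℝ) < ops.length := by
      have := h.two_le_oprs
      exact_mod_cast (by omega : 0 < ops.length)
    have he1 : e ≤ 1 := min_le_right _ _
    have hops' : (tmax : ℝ) ^ ((2 : ℝ) / 3 + e) ≤ ops.length :=
      (Real.rpow_le_rpow_of_exponent_le ht (by linarith [min_le_left ε 1])).trans hops
    have h1 : (1 : ℝ) ≤ (tmax : ℝ) ^ (1 - e / 2) := Real.one_le_rpow ht (by linarith)
    have h2 : 3 + 2 * Real.log tmax ≤ (3 + 4 / e) * (tmax : ℝ) ^ (e / 2) := by
      have h3 := Real.log_le_rpow_div ht0.le (half_pos hε')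
      have h4 : (1 : ℝ) ≤ (tmax : ℝ) ^ (e / 2) := Real.one_le_rpow ht (by linarith)
      have h5 : (tmax : ℝ) ^ (e / 2) / (e / 2) = 2 / e * (tmax : ℝ) ^ (e / 2) := by field_simp
      rw [h5] at h3
      have h6 : 4 / e = 2 * (2 / e) := by ring
      rw [h6]
      linarith
    -- Both exponents add up to `5 / 3 + e / 2`; the second factor on the right is at most the
    -- number of operations.
    have h7 : (tmax : ℝ) ^ (e / 2) * (tmax : ℝ) ^ ((5 : ℝ) / 3) =
        (tmax : ℝ) ^ (1 - e / 2) * (tmax : ℝ) ^ ((2 : ℝ) / 3 + e) := by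
      rw [← Real.rpow_add ht0, ← Real.rpow_add ht0]
      congr 1
      ring
    have h8 : (3 + 2 * Real.log tmax) * (tmax : ℝ) ^ ((5 : ℝ) / 3) ≤
        (3 + 4 / e) * ((tmax : ℝ) ^ (1 - e / 2) * ops.length) := by
      calc _ ≤ (3 + 4 / e) * (tmax : ℝ) ^ (e / 2) * (tmax : ℝ) ^ ((5 : ℝ) / 3) := by gcongr
        _ = (3 + 4 / e) * ((tmax : ℝ) ^ (1 - e / 2) * (tmax : ℝ) ^ ((2 : ℝ) / 3 + e)) := by
          rw [mul_assoc, h7]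
        _ ≤ _ := by gcongr
    have h9 : (ops.length : ℝ) ≤ (tmax : ℝ) ^ (1 - e / 2) * ops.length :=
      le_mul_of_one_le_left hl.le h1
    rw [div_le_iff₀ hl]
    linarith
  · obtain ⟨n, rfl, hmin⟩ := DynSubsetSum.exists_dim h.tmax_pos
    obtain ⟨T₀, s, r, -, hr, hc⟩ := DynSubsetSum.start_reaches hmin h
    have hr' : DynSubsetSum.steps W T (DynSubsetSum.alg.start n.t ops) = PMF.pure _ :=
      hr.of_finishesWithin hT
    rw [DynSubsetSum.Algorithm.probCorrect, hr', PMF.toOuterMeasure_pure_apply, if_pos]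
    swap
    · exact hc i t hi
    -- The run is deterministic and its answer correct, so the probability is 1.
    refine ENNReal.ofReal_le_one.2 ?_
    have : 0 ≤ 1 / (n.t : ℝ) ^ 3 := by positivity
    linarith
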